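/- **Setting.** Let $n\in\mathbb N$, $\mathbb R_+=[0,\infty)$. Let $X=(X_t)_{t\ge0}$ be a càdlàg Feller process on $\mathbb R^n$, with laws $\mathbf P^x$ ($X_0=x$ $\mathbf P^x$-a.s.), Feller semigroup $P_tf(x)=\mathbf E^x[f(X_t)]$ on $C_0(\mathbb R^n)$ (a positive, strongly continuous contraction semigroup for which $X$ is Markov) and infinitesimal generator $\mathcal L$ with domain $\mathcal D(\mathcal L)$. Let $\beta:\mathbb R_+\to\mathbb R_+$ and $g:\mathbb R_+\times(0,\infty)\to\mathbb R_+$ be continuous with $m(s):=\int_{(0,\infty)}(1\wedge r)\,g(s,r)\,dr<\infty$ for all $s\ge 0$, and for $\Re u\ge0$ put $$\psi_s(u)=-u\beta(s)+\int_{(0,\infty)}(e^{-ur}-1)\,g(s,r)\,dr .$$ Let $Z=(Z_t)_{t\ge0}$ be an additive subordinator (nondecreasing càdlàg $\mathbb R_+$-valued paths, independent increments), independent of $X$, such that for all $t\ge 0$ and $\Re u\ge0$ the function $s\mapsto\psi_s(u)$ is integrable on $[0,t]$ and $\mathbf E[e^{-uZ_t}]=\exp\big(\int_0^t\psi_s(u)\,ds\big)$.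 For $D_0\in\mathbb R_+$ let $D_t=D_0+t$ and $Y_t=X_{Z_{D_t}}$. For $f\in C_0(\mathbb R_+\times\mathbb R^n)$ write $f_s=f(s,\cdot)$, and call $f$ *regular* if $f_s\in\mathcal D(\mathcal L)$ for all $s\in\mathbb R_+$, $\partial f/\partial s$ exists on $\mathbb R_+\times\mathbb R^n$ (right derivative at $s=0$), and the functions $(s,x)\mapsto\mathcal Lf_s(x)$ and $(s,x)\mapsto\frac{\partial f}{\partial s}(s,x)$ belong to $C_0(\mathbb R_+\times\mathbb R^n)$. For regular $f$ put $$\mathcal Af(s,x)=\frac{\partial f}{\partial s}(s,x)+\beta(s)\,\mathcal Lf_s(x)+\int_{(0,\infty)}\big[P_rf_s(x)-f(s,x)\big]\,g(s,r)\,dr .$$ **Theorem.** There is a Feller semigroup $(Q_t)_{t\ge0}$ on $C_0(\mathbb R_+\times\mathbb R^n)$, namely $$Q_tf(s,x)=\int_{[0,\infty)}P_rf_{s+t}(x)\,\lambda_{s,s+t}(dr),\qquad \lambda_{s,s+t}=\text{law of }Z_{s+t}-Z_s,$$ such that for every $X_0=x\in\mathbb R^n$ and every $D_0\in\mathbb R_+$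 the process $(D,Y)$ is a càdlàg Feller process with state space $\mathbb R_+\times\mathbb R^n$ and semigroup $(Q_t)$. Its infinitesimal generator $\mathcal L'$ is densely defined in $C_0(\mathbb R_+\times\mathbb R^n)$, and: 1. For every regular $f$ the integral in $\mathcal Af(s,x)$ converges absolutely for all $(s,x)$; and if $\mathcal Af\in C_0(\mathbb R_+\times\mathbb R^n)$, then $f\in\mathcal D(\mathcal L')$ and $\mathcal L'f=\mathcal Af$. 2. If $m$ is continuous on $\mathbb R_+$, then $\lim_{t\searrow0}t^{-1}(Q_tf-f)(s,x)=\mathcal Af(s,x)$ for every regular $f$ and every $(s,x)$, and the regular $f$ with $\mathcal Af\in C_0(\mathbb R_+\times\mathbb R^n)$ are dense in $C_0(\mathbb R_+\times\mathbb R^n)$. 3. If $m$ is continuous and both $m$ and $\beta$ are bounded, then every regular $f$ satisfies $\mathcal Af\in C_0(\mathbb R_+\times\mathbb R^n)$, $f\in\mathcal D(\mathcal L')$ and $\mathcal L'f=\mathcal Af$. -/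

import Mathlib

open MeasureTheory ProbabilityTheory Filter Topology Set
open scoped NNReal ZeroAtInfty

noncomputable section

namespace AdditiveTimeChange

/-- Right-continuous with left limits, for a path indexed by `[0, ∞)`. -/
def IsCadlag {S : Type*} [TopologicalSpace S] (γ : ℝ≥0 → S) : Prop :=
  ∀ t, ContinuousWithinAt γ (Ici t) t ∧ ∃ y, Tendsto γ (𝓝[<] t) (𝓝 y)

/-- A Feller semigroup: a strongly continuous, positive, contraction semigroup on `C₀(S)`. -/
structure IsFellerSemigroup {S : Type*} [TopologicalSpace S]
    (P : ℝ≥0 → C₀(S, ℝ) →L[ℝ] C₀(S, ℝ)) : Prop where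
  zero : P 0 = ContinuousLinearMap.id ℝ C₀(S, ℝ)
  add : ∀ s t, P (s + t) = (P s).comp (P t)
  pos : ∀ t f, (∀ x, 0 ≤ f x) → ∀ x, 0 ≤ P t f x
  contraction : ∀ t f, ‖P t f‖ ≤ ‖f‖
  strong : ∀ f, Tendsto (fun t => P t f) (𝓝[>] 0) (𝓝 f)

/-- `f` belongs to the domain of the infinitesimal generator of `P`, and the generator maps
`f` to `h` (the limit is taken in the norm of `C₀(S)`). -/
def HasGenerator {S : Type*} [TopologicalSpace S]
    (P : ℝ≥0 → C₀(S, ℝ) →L[ℝ] C₀(S, ℝ)) (f h : C₀(S, ℝ)) : Prop :=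
  Tendsto (fun t : ℝ≥0 => (t : ℝ)⁻¹ • (P t f - f)) (𝓝[>] 0) (𝓝 h)

/-- The domain of the infinitesimal generator. -/
def generatorDomain {S : Type*} [TopologicalSpace S]
    (P : ℝ≥0 → C₀(S, ℝ) →L[ℝ] C₀(S, ℝ)) : Set C₀(S, ℝ) :=
  {f | ∃ h, HasGenerator P f h}

/-- The σ-algebra generated by the process up to time `s`. -/
abbrev pastσ {Ω S : Type*} [mS : MeasurableSpace S] (X : ℝ≥0 → Ω → S) (s : ℝ≥0) :
    MeasurableSpace Ω :=
  ⨆ l ≤ s, MeasurableSpace.comap (X l) mS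

/-- Under `μ`, the process `X` is a càdlàg Feller process with transition semigroup `P`: `P` is
a Feller semigroup and `X` is Markov for its own filtration with transition semigroup `P`. -/
structure IsFellerProcess {Ω S : Type*} [MeasurableSpace Ω] [TopologicalSpace S]
    [MeasurableSpace S] (μ : Measure Ω) (X : ℝ≥0 → Ω → S)
    (P : ℝ≥0 → C₀(S, ℝ) →L[ℝ] C₀(S, ℝ)) : Prop where
  semigroup : IsFellerSemigroup P
  measurable : ∀ t, Measurable (X t)
  cadlag : ∀ ω, IsCadlag (fun t => X t ω)
  markov : ∀ s t f,
    μ[fun ω => f (X (s + t) ω) | pastσ X s] =ᵐ[μ] fun ω => P t f (X s ω)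

/-- A Feller process with its family of laws: `Pr x` is the law of `X` started at `x`, and
`P t f x` is the expectation of `f (X t)` under `Pr x`. -/
structure IsFellerFamily {Ω S : Type*} [MeasurableSpace Ω] [TopologicalSpace S]
    [MeasurableSpace S] (Pr : S → Measure Ω) (X : ℝ≥0 → Ω → S)
    (P : ℝ≥0 → C₀(S, ℝ) →L[ℝ] C₀(S, ℝ)) : Prop where
  feller : ∀ x, IsFellerProcess (Pr x) X P
  start : ∀ x, ∀ᵐ ω ∂Pr x, X 0 ω = x
  expectation : ∀ t f x, P t f x = ∫ ω, f (X t ω) ∂Pr x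

/-- The total mass `∫_(0,∞) (1 ∧ r) g(s,r) dr`. -/
def jumpMass (g : ℝ → ℝ → ℝ) (s : ℝ) : ℝ :=
  ∫ r in Ioi (0 : ℝ), min 1 r * g s r

/-- Admissible characteristics. Only the values for `s ≥ 0`, `r > 0` matter. -/
structure IsCharacteristics (β : ℝ → ℝ) (g : ℝ → ℝ → ℝ) : Prop where
  drift_nonneg : ∀ s, 0 ≤ s → 0 ≤ β s
  drift_cont : ContinuousOn β (Ici 0)
  jump_nonneg : ∀ s r, 0 ≤ s → 0 < r → 0 ≤ g s r
  jump_cont : ContinuousOn (Function.uncurry g) (Ici 0 ×ˢ Ioi 0)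
  jump_int : ∀ s, 0 ≤ s → IntegrableOn (fun r => min 1 r * g s r) (Ioi 0)

/-- `ψ_s(u) = -u β(s) + ∫_(0,∞) (e^{-ur} - 1) g(s,r) dr`. -/
def laplaceDensity (β : ℝ → ℝ) (g : ℝ → ℝ → ℝ) (s : ℝ) (u : ℂ) : ℂ :=
  -u * (β s : ℂ) + ∫ r in Ioi (0 : ℝ), (Complex.exp (-u * (r : ℂ)) - 1) * (g s r : ℂ)

/-- Under `μ`, `Z` is an additive subordinator (nondecreasing càdlàg paths, independent
increments) whose Laplace exponent at time `t` is `∫_0^t ψ_s(u) ds`. -/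
structure IsAdditiveSubordinator {Ω : Type*} [MeasurableSpace Ω] (μ : Measure Ω)
    (Z : ℝ≥0 → Ω → ℝ≥0) (β : ℝ → ℝ) (g : ℝ → ℝ → ℝ) : Prop where
  measurable : ∀ t, Measurable (Z t)
  mono : ∀ ω, Monotone (fun t => Z t ω)
  cadlag : ∀ ω, IsCadlag (fun t => Z t ω)
  indep_incr : HasIndepIncrements (fun t ω => (Z t ω : ℝ)) μ
  exponent_int : ∀ u : ℂ, 0 ≤ u.re → ∀ t : ℝ≥0,
    IntervalIntegrable (fun s => laplaceDensity β g s u) volume 0 t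
  laplace : ∀ u : ℂ, 0 ≤ u.re → ∀ t : ℝ≥0,
    ∫ ω, Complex.exp (-u * ((Z t ω : ℝ) : ℂ)) ∂μ
      = Complex.exp (∫ s in (0 : ℝ)..t, laplaceDensity β g s u)

/-- The slice `f_s = f(s, ·)`. -/
def slice {S : Type*} [TopologicalSpace S] (f : C₀(ℝ≥0 × S, ℝ)) (s : ℝ≥0) : C₀(S, ℝ) where
  toFun x := f (s, x)
  continuous_toFun := by fun_prop
  zero_at_infty' := by
    refine f.zero_at_infty'.comp ?_
    rw [← Filter.coprod_cocompact, Filter.tendsto_iff_comap, Filter.coprod, Filter.comap_sup]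
    refine le_trans ?_ le_sup_right
    rw [Filter.comap_comap]
    exact le_of_eq Filter.comap_id.symm

/-- `f ∈ C₀(ℝ₊ × S)` has `f_s ∈ D(L)` for all `s`, the functions `(s,x) ↦ L f_s(x)` and
`(s,x) ↦ ∂f/∂s(s,x)` belong to `C₀(ℝ₊ × S)`, and they are `Lf` and `df`
(the derivative at `s = 0` is the right derivative). -/
structure IsRegularFunction {S : Type*} [TopologicalSpace S]
    (P : ℝ≥0 → C₀(S, ℝ) →L[ℝ] C₀(S, ℝ)) (f df Lf : C₀(ℝ≥0 × S, ℝ)) : Prop where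
  gen : ∀ s, HasGenerator P (slice f s) (slice Lf s)
  deriv : ∀ (s : ℝ≥0) (x : S),
    HasDerivWithinAt (fun v : ℝ => f (v.toNNReal, x)) (df (s, x)) (Ici 0) (s : ℝ)

/-- The integrand `[P_r f_s(x) - f(s,x)] g(s,r)`. -/
def jumpIntegrand {S : Type*} [TopologicalSpace S]
    (P : ℝ≥0 → C₀(S, ℝ) →L[ℝ] C₀(S, ℝ)) (g : ℝ → ℝ → ℝ) (f : C₀(ℝ≥0 × S, ℝ))
    (s : ℝ≥0) (x : S) (r : ℝ) : ℝ :=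
  (P r.toNNReal (slice f s) x - f (s, x)) * g s r

/-- `∂f/∂s(s,x) + β(s) L f_s(x) + ∫_(0,∞) [P_r f_s(x) - f(s,x)] g(s,r) dr`. -/
def phillipsFormula {S : Type*} [TopologicalSpace S]
    (P : ℝ≥0 → C₀(S, ℝ) →L[ℝ] C₀(S, ℝ)) (β : ℝ → ℝ) (g : ℝ → ℝ → ℝ)
    (f df Lf : C₀(ℝ≥0 × S, ℝ)) (s : ℝ≥0) (x : S) : ℝ :=
  df (s, x) + β s * Lf (s, x) + ∫ r in Ioi (0 : ℝ), jumpIntegrand P g f s x r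

/-- The space-time process `(D_t, Y_t) = (d + t, X_{Z_{d + t}})` with `D_0 = d`. -/
def timeChanged {Ω S : Type*} (X : ℝ≥0 → Ω → S) (Z : ℝ≥0 → Ω → ℝ≥0) (d : ℝ≥0) :
    ℝ≥0 → Ω → ℝ≥0 × S :=
  fun t ω => (d + t, X (Z (d + t) ω) ω)

end AdditiveTimeChange

end

open AdditiveTimeChange

noncomputable section

namespace AdditiveTimeChange

/-! For `a ≤ b` put `R(a,b)e = E[P_{Z_b - Z_a} e]`. Independence of the increments and `P_{r+q} =
P_r P_q` give `R(a,b)R(b,c) = R(a,c)`. Since `Z` has no fixed times of discontinuity, `R(a,b)e` is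
jointly continuous in `(a,b,e)`. Taking time as a coordinate turns this evolution system into the
semigroup `(Q_t f)_s = R(s,s+t) f_{s+t}`. The law of an increment is determined by its Laplace
transform on the imaginary axis, so `Q` is the same under every `Pr x`. For the Markov property,
freeze the path of `Z` and use the Markov property of `X` between the now deterministic times
`Z_{d+s}` and `Z_{d+s+t}`; then freeze the path of `X` and integrate out the increment of `Z`, which
is independent of the past of `Z`.

The analytic core is the integrated Phillips formula `R(a,b)e - e = ∫_a^b R(a,v) A_v e dv` for `e`
in the domain of `L`, where `A_v e = β(v) L e + ∫ (P_r e - e) g(v,r) dr`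
(`evolution_sub_eq_integral`). Writing `P_r e - e = ∫_0^r P_q L e dq`, both sides become integrals
of `y ↦ P_y L e` against positive measures on `[0,∞)` that do not involve `P`: the tail of `Z_b -
Z_a` on the left, a drift part and a jump part on the right. Equality of these measures can be
tested on characters, that is, for multiplication by `e^{iξt}` on `ℂ`, where the formula is the
chain rule `∫_a^b ψ_v exp(∫_a^v ψ) dv = exp(∫_a^b ψ) - 1`. The measures may be infinite, as `Z_b -
Z_a` need not have a mean. The argument is therefore run for `e^{-εt} P_t`, and `ε → 0` by dominated
convergence.

For a differentiable family `F` in the domain, a product rule gives `R(a,b)F(b) - F(a) = ∫_a^b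
R(a,v)(F'(v) + A_v F(v)) dv`. As `A_v` is only locally integrable in `v`, this is proved by
comparing increments (`eq_of_increments_small`) and not by differentiation. For regular `f` it says
`(Q_t f - f)_s = ∫_s^{s+t} R(s,v) (𝒜f)_v dv`. If `𝒜f` is some `G` in `C₀`, the integrand is
`(Q_{v-s} G)_s`, which is close to `G_s` uniformly in `s` by strong continuity of `Q`, so `f` is in
the domain. If `m` is continuous, Scheffé's lemma makes `v ↦ (𝒜f)_v` continuous in norm, which gives
the pointwise limit. Bounded characteristics make `𝒜f` vanish at infinity. Density comes from a
cut-off in time followed by averages in time and along the orbits of `P`. -/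

/-! ### Contraction semigroups on Banach spaces -/

/-- A strongly continuous contraction semigroup on a normed space. -/
structure IsContractionSemigroup {E : Type*} [NormedAddCommGroup E] [NormedSpace ℝ E]
    (P : ℝ≥0 → E →L[ℝ] E) : Prop where
  zero : P 0 = ContinuousLinearMap.id ℝ E
  add : ∀ s t, P (s + t) = (P s).comp (P t)
  contraction : ∀ t e, ‖P t e‖ ≤ ‖e‖
  strong : ∀ e, Tendsto (fun t => P t e) (𝓝[>] 0) (𝓝 e)

/-- The generator of the semigroup `P` maps `e` to `k`. -/
def GeneratorMaps {E : Type*} [NormedAddCommGroup E] [NormedSpace ℝ E]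
    (P : ℝ≥0 → E →L[ℝ] E) (e k : E) : Prop :=
  Tendsto (fun t : ℝ≥0 => (t : ℝ)⁻¹ • (P t e - e)) (𝓝[>] 0) (𝓝 k)

theorem IsFellerSemigroup.isContractionSemigroup {S : Type*} [TopologicalSpace S]
    {P : ℝ≥0 → C₀(S, ℝ) →L[ℝ] C₀(S, ℝ)} (hP : IsFellerSemigroup P) :
    IsContractionSemigroup P :=
  ⟨hP.zero, hP.add, hP.contraction, hP.strong⟩

theorem tendsto_toNNReal_sub_nhdsGT (t : ℝ) :
    Tendsto (fun y : ℝ => (y - t).toNNReal) (𝓝[>] t) (𝓝[>] 0) := by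
  refine tendsto_nhdsWithin_iff.2 ⟨?_, ?_⟩
  · have : Continuous fun y : ℝ => (y - t).toNNReal := by fun_prop
    have h := (this.tendsto t).mono_left (nhdsWithin_le_nhds (s := Ioi t))
    simpa using h
  · filter_upwards [self_mem_nhdsWithin] with y hy
    simpa using hy

theorem tendsto_coe_nhdsGT_zero :
    Tendsto (fun t : ℝ≥0 => (t : ℝ)) (𝓝[>] 0) (𝓝[>] 0) := by
  refine tendsto_nhdsWithin_iff.2 ⟨?_, ?_⟩
  · exact (NNReal.continuous_coe.tendsto 0).mono_left nhdsWithin_le_nhds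
  · filter_upwards [self_mem_nhdsWithin] with y hy
    simpa using hy

/-- Averages over small intervals converge to the value at a point of right continuity. -/
theorem tendsto_average_nhdsGT {E : Type*} [NormedAddCommGroup E] [NormedSpace ℝ E]
    [CompleteSpace E] {φ : ℝ → E} {a : ℝ} (hφ : ContinuousOn φ (Ici a)) :
    Tendsto (fun t : ℝ≥0 => (t : ℝ)⁻¹ • ∫ r in a..(a + t), φ r) (𝓝[>] 0) (𝓝 (φ a)) := by
  have hd : HasDerivWithinAt (fun u => ∫ r in a..u, φ r) (φ a) (Ici a) a := by
    refine intervalIntegral.integral_hasDerivWithinAt_right (t := Ioi a) (by simp) ?_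
      ((hφ a self_mem_Ici).mono Ioi_subset_Ici_self)
    exact ⟨Ioi a, self_mem_nhdsWithin,
      (hφ.mono Ioi_subset_Ici_self).aestronglyMeasurable measurableSet_Ioi⟩
  have h1 : Tendsto (fun t : ℝ≥0 => a + (t : ℝ)) (𝓝[>] 0) (𝓝[>] a) := by
    refine tendsto_nhdsWithin_iff.2 ⟨?_, ?_⟩
    · have : Continuous fun t : ℝ≥0 => a + (t : ℝ) := by fun_prop
      simpa using (this.tendsto 0).mono_left (nhdsWithin_le_nhds (s := Ioi 0))
    · filter_upwards [self_mem_nhdsWithin] with y hy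
      simpa using hy
  have h2 := ((hasDerivWithinAt_iff_tendsto_slope' (by simp)).1
    (hasDerivWithinAt_Ioi_iff_Ici.2 hd)).comp h1
  simpa [slope_def_module, Function.comp_def] using h2

namespace IsContractionSemigroup

variable {E : Type*} [NormedAddCommGroup E] [NormedSpace ℝ E] {P : ℝ≥0 → E →L[ℝ] E}

theorem add_apply (hP : IsContractionSemigroup P) (s t : ℝ≥0) (e : E) :
    P (s + t) e = P s (P t e) := by
  rw [hP.add]; rfl

theorem zero_apply (hP : IsContractionSemigroup P) (e : E) : P 0 e = e := by
  rw [hP.zero]; rfl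

theorem norm_apply_add_sub_le (hP : IsContractionSemigroup P) (s d : ℝ≥0) (e : E) :
    ‖P (s + d) e - P s e‖ ≤ ‖P d e - e‖ := by
  rw [hP.add_apply, ← map_sub]
  exact hP.contraction _ _

/-- By contractivity the modulus of continuity of an orbit is controlled by its behaviour at time
`0`, with the same bound whichever of the two times is larger. -/
theorem norm_apply_sub_apply_le (hP : IsContractionSemigroup P) (s t : ℝ≥0) (e : E) :
    ‖P t e - P s e‖ ≤ ‖P (nndist t s) e - e‖ := by
  rcases le_total s t with h | h
  · obtain ⟨d, rfl⟩ := exists_add_of_le h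
    have : nndist (s + d) s = d := by
      rw [NNReal.nndist_eq, add_tsub_cancel_left, tsub_eq_zero_of_le h, max_eq_left zero_le]
    rw [this]
    exact hP.norm_apply_add_sub_le s d e
  · obtain ⟨d, rfl⟩ := exists_add_of_le h
    have : nndist t (t + d) = d := by
      rw [NNReal.nndist_eq, add_tsub_cancel_left, tsub_eq_zero_of_le h, max_eq_right zero_le]
    rw [this, norm_sub_rev]
    exact hP.norm_apply_add_sub_le t d e

theorem tendsto_zero (hP : IsContractionSemigroup P) (e : E) :
    Tendsto (fun t => P t e) (𝓝 0) (𝓝 e) := by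
  have h : ContinuousWithinAt (fun t => P t e) (Ioi 0) 0 := by
    rw [ContinuousWithinAt, hP.zero_apply]
    exact hP.strong e
  have h2 := continuousWithinAt_Ioi_iff_Ici.1 h
  have : Ici (0 : ℝ≥0) = univ := by ext; simp
  rw [this, continuousWithinAt_univ, ContinuousAt, hP.zero_apply] at h2
  exact h2

/-- A contraction semigroup is jointly continuous. -/
theorem continuous_uncurry (hP : IsContractionSemigroup P) :
    Continuous fun q : ℝ≥0 × E => P q.1 q.2 := by
  refine continuous_iff_continuousAt.2 fun ⟨s, e⟩ => ?_
  rw [ContinuousAt, tendsto_iff_norm_sub_tendsto_zero]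
  have h1 : Tendsto (fun q : ℝ≥0 × E => ‖q.2 - e‖ + ‖P (nndist q.1 s) e - e‖) (𝓝 (s, e))
      (𝓝 0) := by
    have ha : Tendsto (fun q : ℝ≥0 × E => ‖q.2 - e‖) (𝓝 (s, e)) (𝓝 0) := by
      have : Continuous fun q : ℝ≥0 × E => ‖q.2 - e‖ := by fun_prop
      simpa using this.tendsto (s, e)
    have hb : Tendsto (fun q : ℝ≥0 × E => nndist q.1 s) (𝓝 (s, e)) (𝓝 0) := by
      have : Continuous fun q : ℝ≥0 × E => nndist q.1 s := by fun_prop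
      simpa using this.tendsto (s, e)
    have hc := tendsto_iff_norm_sub_tendsto_zero.1 ((hP.tendsto_zero e).comp hb)
    simpa using ha.add hc
  refine squeeze_zero (fun _ => norm_nonneg _) (fun q => ?_) h1
  calc ‖P q.1 q.2 - P s e‖ = ‖P q.1 (q.2 - e) + (P q.1 e - P s e)‖ := by
        rw [map_sub]; congr 1; abel
    _ ≤ _ := (norm_add_le _ _).trans
        (add_le_add (hP.contraction _ _) (hP.norm_apply_sub_apply_le _ _ _))

theorem continuous_comp (hP : IsContractionSemigroup P) {T : Type*} [TopologicalSpace T]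
    {τ : T → ℝ≥0} {f : T → E} (hτ : Continuous τ) (hf : Continuous f) :
    Continuous fun x => P (τ x) (f x) :=
  hP.continuous_uncurry.comp (hτ.prodMk hf)

theorem continuous_apply (hP : IsContractionSemigroup P) (e : E) : Continuous fun t => P t e :=
  hP.continuous_comp continuous_id continuous_const

theorem continuous_toNNReal (hP : IsContractionSemigroup P) (e : E) :
    Continuous fun r : ℝ => P r.toNNReal e :=
  hP.continuous_comp continuous_real_toNNReal continuous_const

/-- Only the right derivative is read off, since the generator is a limit as `t ↓ 0`. A continuous
function with zero right derivative is constant, so this suffices for the fundamental theorem of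
calculus. -/
theorem hasDerivWithinAt_orbit (hP : IsContractionSemigroup P) {e k : E}
    (hk : GeneratorMaps P e k) {t : ℝ} (ht : 0 ≤ t) :
    HasDerivWithinAt (fun r : ℝ => P r.toNNReal e) (P t.toNNReal k) (Ici t) t := by
  rw [← hasDerivWithinAt_Ioi_iff_Ici, hasDerivWithinAt_iff_tendsto_slope' (by simp)]
  have h1 := ((P t.toNNReal).continuous.tendsto k).comp
    (hk.comp (tendsto_toNNReal_sub_nhdsGT t))
  refine h1.congr' ?_
  filter_upwards [self_mem_nhdsWithin] with y hy
  have hy' : t < y := hy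
  have : y.toNNReal = t.toNNReal + (y - t).toNNReal := by
    rw [← Real.toNNReal_add ht (by linarith)]; congr 1; ring
  simp only [Function.comp_apply, slope_def_module]
  rw [this, hP.add_apply, Real.coe_toNNReal _ (by linarith), map_smul, map_sub]

theorem norm_apply_sub_le_two_mul (hP : IsContractionSemigroup P) (e : E) (t : ℝ≥0) :
    ‖P t e - e‖ ≤ 2 * ‖e‖ := by
  calc ‖P t e - e‖ ≤ ‖P t e‖ + ‖e‖ := norm_sub_le _ _
    _ ≤ _ := by linarith [hP.contraction t e]

/-- The average `h⁻¹ ∫_0^h P_r e dr` of an orbit. -/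
def average (hP : IsContractionSemigroup P) (h : ℝ≥0) : E →L[ℝ] E :=
  LinearMap.mkContinuous
    { toFun := fun e => (h : ℝ)⁻¹ • ∫ r in (0 : ℝ)..h, P r.toNNReal e
      map_add' := fun e e' => by
        simp only [map_add]
        rw [intervalIntegral.integral_add ((hP.continuous_toNNReal e).intervalIntegrable _ _)
          ((hP.continuous_toNNReal e').intervalIntegrable _ _), smul_add]
      map_smul' := fun c e => by
        simp only [map_smul, intervalIntegral.integral_smul, RingHom.id_apply]
        rw [smul_comm] } 1 (by
    intro e
    simp only [LinearMap.coe_mk, AddHom.coe_mk, norm_smul, norm_inv]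
    have := intervalIntegral.norm_integral_le_of_norm_le_const (a := (0 : ℝ)) (b := h)
      (f := fun r : ℝ => P r.toNNReal e) (C := ‖e‖) fun r _ => hP.contraction _ _
    -- For `h = 0` the inverse takes its default value `0`, so the average is then the zero operator
    -- and not the identity.
    rcases eq_or_ne h 0 with rfl | hh
    · simp
    · have hpos : 0 < (h : ℝ) := by positivity
      rw [one_mul, inv_mul_le_iff₀ (by simpa using hpos)]
      simpa [mul_comm] using this)

theorem average_apply (hP : IsContractionSemigroup P) (h : ℝ≥0) (e : E) :
    hP.average h e = (h : ℝ)⁻¹ • ∫ r in (0 : ℝ)..h, P r.toNNReal e := rfl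

variable [CompleteSpace E]

/-- The fundamental theorem of calculus along an orbit. -/
theorem apply_sub_eq_integral (hP : IsContractionSemigroup P) {e k : E}
    (hk : GeneratorMaps P e k) (t : ℝ≥0) :
    P t e - e = ∫ r in (0 : ℝ)..t, P r.toNNReal k := by
  have hc := hP.continuous_toNNReal k
  have h := constant_of_has_deriv_right_zero (a := 0) (b := t)
    (f := fun u : ℝ => P u.toNNReal e - ∫ r in (0 : ℝ)..u, P r.toNNReal k) ?_ ?_ t
    (by simp)
  · simp only [Real.toNNReal_coe, Real.toNNReal_zero, hP.zero_apply,
      intervalIntegral.integral_same, sub_zero] at h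
    rw [sub_eq_iff_eq_add] at h ⊢
    rw [h, add_comm]
  · refine ((hP.continuous_toNNReal e).sub ?_).continuousOn
    exact intervalIntegral.continuous_primitive (fun a b => hc.intervalIntegrable a b) 0
  · intro x hx
    have h1 := hP.hasDerivWithinAt_orbit hk hx.1
    have h2 : HasDerivWithinAt (fun u => ∫ r in (0 : ℝ)..u, P r.toNNReal k)
        (P x.toNNReal k) (Ici x) x :=
      (intervalIntegral.integral_hasDerivAt_right (hc.intervalIntegrable _ _)
        (hc.stronglyMeasurableAtFilter _ _) hc.continuousAt).hasDerivWithinAt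
    exact sub_self (P x.toNNReal k) ▸ h1.sub h2

theorem norm_apply_sub_le_mul (hP : IsContractionSemigroup P) {e k : E}
    (hk : GeneratorMaps P e k) (t : ℝ≥0) : ‖P t e - e‖ ≤ t * ‖k‖ := by
  rw [hP.apply_sub_eq_integral hk]
  refine (intervalIntegral.norm_integral_le_of_norm_le_const
    (C := ‖k‖) fun r _ => hP.contraction _ _).trans ?_
  simp [mul_comm]

/-- The two bounds `2‖e‖` and `t‖k‖` combine into a multiple of `1 ∧ t`, the weight against which
`g(s,·)` is integrable. -/
theorem norm_apply_sub_le_min (hP : IsContractionSemigroup P) {e k : E}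
    (hk : GeneratorMaps P e k) (t : ℝ≥0) :
    ‖P t e - e‖ ≤ (2 * ‖e‖ + ‖k‖) * min 1 (t : ℝ) := by
  have h1 := hP.norm_apply_sub_le_mul hk t
  have h2 := hP.norm_apply_sub_le_two_mul e t
  have h3 := norm_nonneg e
  have h4 := norm_nonneg k
  have h5 := t.2
  rcases min_cases 1 (t : ℝ) with ⟨h, _⟩ | ⟨h, _⟩ <;> rw [h]
  · linarith
  · have : 0 ≤ ‖e‖ * t := mul_nonneg h3 t.2
    nlinarith

theorem tendsto_average (hP : IsContractionSemigroup P) (e : E) :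
    Tendsto (fun h => hP.average h e) (𝓝[>] 0) (𝓝 e) := by
  have := tendsto_average_nhdsGT (a := 0) (hP.continuous_toNNReal e).continuousOn
  simpa [average_apply, hP.zero_apply] using this

/-- Shifting the window `[0,h]` by `t` cancels everything but two boundary integrals of length `t`,
at `h` and at `0`; divided by `t` they converge to the endpoint values of the orbit. -/
theorem generatorMaps_average (hP : IsContractionSemigroup P) (h : ℝ≥0) (e : E) :
    GeneratorMaps P (hP.average h e) ((h : ℝ)⁻¹ • (P h e - e)) := by
  have hc := hP.continuous_toNNReal e
  have hi := fun a b : ℝ => hc.intervalIntegrable (μ := volume) a b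
  have key : ∀ t : ℝ≥0, P t (hP.average h e) - hP.average h e =
      (h : ℝ)⁻¹ • ((∫ r in (h : ℝ)..(h + t), P r.toNNReal e)
        - ∫ r in (0 : ℝ)..(0 + t), P r.toNNReal e) := by
    intro t
    rw [average_apply, map_smul, ← smul_sub]
    congr 1
    rw [← ContinuousLinearMap.intervalIntegral_comp_comm _ (hi _ _)]
    have : ∫ r in (0 : ℝ)..h, P t (P r.toNNReal e) = ∫ r in (t : ℝ)..(h + t), P r.toNNReal e := by
      have h0 := intervalIntegral.integral_comp_add_right (a := 0) (b := h)
        (fun r : ℝ => P r.toNNReal e) (t : ℝ)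
      rw [zero_add] at h0
      rw [← h0]
      refine intervalIntegral.integral_congr fun r hr => ?_
      rw [uIcc_of_le h.coe_nonneg] at hr
      rw [Real.toNNReal_add hr.1 t.coe_nonneg, add_comm, hP.add_apply, Real.toNNReal_coe]
    rw [this]
    have h1 := intervalIntegral.integral_add_adjacent_intervals (hi 0 t) (hi t (h + t))
    have h2 := intervalIntegral.integral_add_adjacent_intervals (hi 0 h) (hi h (h + t))
    rw [zero_add, sub_eq_sub_iff_add_eq_add, add_comm, h1, ← h2, add_comm]
  have hlim := ((tendsto_average_nhdsGT (a := (h : ℝ)) hc.continuousOn).sub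
    (tendsto_average_nhdsGT (a := (0 : ℝ)) hc.continuousOn)).const_smul (h : ℝ)⁻¹
  simp only [Real.toNNReal_coe, Real.toNNReal_zero, hP.zero_apply] at hlim
  refine hlim.congr fun t => ?_
  rw [key, smul_comm, smul_sub (t : ℝ)⁻¹]

/-- The generator of a contraction semigroup is densely defined. -/
theorem dense_generator_domain (hP : IsContractionSemigroup P) :
    Dense {e | ∃ k, GeneratorMaps P e k} := fun e =>
  mem_closure_of_tendsto (hP.tendsto_average e)
    (Eventually.of_forall fun h => ⟨_, hP.generatorMaps_average h e⟩)

end IsContractionSemigroup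

/-! ### Functions on space-time and their slices -/

section ZeroAtInfty

variable {S : Type*} [TopologicalSpace S]

theorem norm_zeroAtInfty_le {f : C₀(S, ℝ)} {C : ℝ} (hC : 0 ≤ C) :
    ‖f‖ ≤ C ↔ ∀ x, ‖f x‖ ≤ C := by
  rw [← ZeroAtInftyContinuousMap.norm_toBCF_eq_norm]
  exact BoundedContinuousFunction.norm_le hC

theorem norm_zeroAtInfty_apply_le (f : C₀(S, ℝ)) (x : S) : ‖f x‖ ≤ ‖f‖ :=
  (norm_zeroAtInfty_le (norm_nonneg f)).1 le_rfl x

/-- Evaluation at a point, as a continuous linear functional. -/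
def evalCLM (x : S) : C₀(S, ℝ) →L[ℝ] ℝ :=
  LinearMap.mkContinuous
    { toFun := fun f => f x
      map_add' := fun _ _ => rfl
      map_smul' := fun _ _ => rfl } 1
    fun f => by simpa using norm_zeroAtInfty_apply_le f x

@[simp]
theorem evalCLM_apply (x : S) (f : C₀(S, ℝ)) : evalCLM x f = f x := rfl

@[simp]
theorem slice_apply (f : C₀(ℝ≥0 × S, ℝ)) (s : ℝ≥0) (x : S) : slice f s x = f (s, x) := rfl

theorem slice_add (f h : C₀(ℝ≥0 × S, ℝ)) (s : ℝ≥0) :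
    slice (f + h) s = slice f s + slice h s := rfl

theorem slice_sub (f h : C₀(ℝ≥0 × S, ℝ)) (s : ℝ≥0) :
    slice (f - h) s = slice f s - slice h s := rfl

theorem slice_smul (c : ℝ) (f : C₀(ℝ≥0 × S, ℝ)) (s : ℝ≥0) :
    slice (c • f) s = c • slice f s := rfl

theorem ext_slice {f h : C₀(ℝ≥0 × S, ℝ)} (H : ∀ s, slice f s = slice h s) : f = h := by
  ext ⟨s, x⟩
  exact DFunLike.congr_fun (H s) x

theorem norm_slice_le (f : C₀(ℝ≥0 × S, ℝ)) (s : ℝ≥0) : ‖slice f s‖ ≤ ‖f‖ :=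
  (norm_zeroAtInfty_le (norm_nonneg f)).2 fun x => norm_zeroAtInfty_apply_le f (s, x)

theorem norm_le_of_norm_slice_le {f : C₀(ℝ≥0 × S, ℝ)} {C : ℝ} (hC : ∀ s, ‖slice f s‖ ≤ C) :
    ‖f‖ ≤ C :=
  (norm_zeroAtInfty_le ((norm_nonneg _).trans (hC 0))).2 fun ⟨s, x⟩ =>
    (norm_zeroAtInfty_apply_le (slice f s) x).trans (hC s)

theorem tendsto_slice_cocompact (f : C₀(ℝ≥0 × S, ℝ)) :
    Tendsto (slice f) (cocompact ℝ≥0) (𝓝 0) := by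
  refine Metric.nhds_basis_closedBall.tendsto_right_iff.2 fun ε hε => ?_
  have hf := Metric.nhds_basis_ball.tendsto_right_iff.1 f.zero_at_infty' ε hε
  obtain ⟨K, hK, hKf⟩ := mem_cocompact.1 hf
  filter_upwards [(hK.image continuous_fst).compl_mem_cocompact] with s hs
  rw [mem_closedBall_zero_iff]
  refine (norm_zeroAtInfty_le hε.le).2 fun x => ?_
  have : (s, x) ∈ Kᶜ := fun hx => hs ⟨_, hx, rfl⟩
  have h := hKf this
  simp only [mem_ofPred_eq, Metric.mem_ball, dist_zero_right] at h
  exact h.le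

/-- A continuous family of functions in `C₀(S)` that vanishes at infinity in time defines a
function in `C₀(ℝ≥0 × S)`. -/
def ofSlices (F : ℝ≥0 → C₀(S, ℝ)) (hF : Continuous F)
    (h0 : Tendsto F (cocompact ℝ≥0) (𝓝 0)) : C₀(ℝ≥0 × S, ℝ) where
  toFun p := F p.1 p.2
  continuous_toFun := by
    have h1 : Continuous fun p : ℝ≥0 × S => (F p.1).toBCF :=
      (ZeroAtInftyContinuousMap.isometry_toBCF.continuous.comp hF).comp continuous_fst
    exact h1.eval continuous_snd
  zero_at_infty' := by
    refine Metric.nhds_basis_ball.tendsto_right_iff.2 fun ε hε => ?_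
    obtain ⟨K, hK, hKF⟩ := mem_cocompact.1
      (Metric.nhds_basis_ball.tendsto_right_iff.1 h0 ε hε)
    -- `F` maps the compact set `K` of times to a compact set of functions. A finite `ε/2`-net of it
    -- consists of finitely many functions vanishing at infinity, which are all small off one
    -- compact `K'`.
    obtain ⟨T, hT, hTF⟩ := Metric.totallyBounded_iff.1 (hK.image hF).totallyBounded (ε / 2)
      (half_pos hε)
    have hx : ∀ᶠ x in cocompact S, ∀ e ∈ T, e x ∈ Metric.ball (0 : ℝ) (ε / 2) :=
      (hT.eventually_all).2 fun e _ =>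
        Metric.nhds_basis_ball.tendsto_right_iff.1 e.zero_at_infty' _ (half_pos hε)
    obtain ⟨K', hK', hKT⟩ := mem_cocompact.1 hx
    refine mem_cocompact.2 ⟨K ×ˢ K', hK.prod hK', ?_⟩
    rintro ⟨s, x⟩ hsx
    simp only [mem_ofPred_eq, Metric.mem_ball, dist_zero_right]
    by_cases hs : s ∈ K
    · have hx' : x ∈ K'ᶜ := fun h => hsx ⟨hs, h⟩
      obtain ⟨e, he, hse⟩ := mem_iUnion₂.1 (hTF ⟨s, hs, rfl⟩)
      have h1 := hKT hx' e he
      rw [mem_ball_iff_norm] at hse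
      rw [mem_ball_zero_iff] at h1
      have h2 := norm_zeroAtInfty_apply_le (F s - e) x
      calc ‖F s x‖ = ‖(F s - e) x + e x‖ := by simp
        _ ≤ ‖(F s - e) x‖ + ‖e x‖ := norm_add_le _ _
        _ < ε := by linarith
    · have h := hKF hs
      simp only [mem_ofPred_eq, Metric.mem_ball, dist_zero_right] at h
      exact (norm_zeroAtInfty_apply_le _ _).trans_lt h

@[simp]
theorem slice_ofSlices (F : ℝ≥0 → C₀(S, ℝ)) (hF : Continuous F)
    (h0 : Tendsto F (cocompact ℝ≥0) (𝓝 0)) (s : ℝ≥0) : slice (ofSlices F hF h0) s = F s := rfl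

@[simp]
theorem ofSlices_apply (F : ℝ≥0 → C₀(S, ℝ)) (hF : Continuous F)
    (h0 : Tendsto F (cocompact ℝ≥0) (𝓝 0)) (s : ℝ≥0) (x : S) :
    ofSlices F hF h0 (s, x) = F s x := rfl

/-- A norm bound by a family vanishing at infinity gives vanishing at infinity. -/
theorem tendsto_zero_of_norm_le {ι E F : Type*} [NormedAddCommGroup E] [NormedAddCommGroup F]
    {l : Filter ι} {u : ι → E} {v : ι → F} (C : ℝ) (hv : Tendsto v l (𝓝 0))
    (h : ∀ i, ‖u i‖ ≤ C * ‖v i‖) : Tendsto u l (𝓝 0) := by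
  refine squeeze_zero_norm h ?_
  simpa using (hv.norm).const_mul C

end ZeroAtInfty

/-- Functions in `C₀` of a metric space are uniformly continuous, and moving only the time
coordinate moves `(s,x)` by the same distance for every `x`. -/
theorem uniformContinuous_slice {S : Type*} [PseudoMetricSpace S] (f : C₀(ℝ≥0 × S, ℝ)) :
    UniformContinuous (slice f) := by
  have hf := Metric.uniformContinuous_iff.1 (ZeroAtInftyContinuousMap.uniformContinuous f)
  refine Metric.uniformContinuous_iff.2 fun ε hε => ?_
  obtain ⟨δ, hδ, h⟩ := hf (ε / 2) (half_pos hε)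
  refine ⟨δ, hδ, fun {s t} hst => ?_⟩
  rw [dist_eq_norm]
  refine ((norm_zeroAtInfty_le (half_pos hε).le).2 fun x => ?_).trans_lt (half_lt_self hε)
  have : dist (s, x) (t, x) < δ := by simpa [Prod.dist_eq, hδ] using hst
  simpa [dist_eq_norm] using (h this).le

/-! ### Primitives of integrable functions -/

/-- A function whose increments over short intervals are arbitrarily small relative to those of
a fixed function has equal values at the end points. -/
theorem eq_of_increments_small {E : Type*} [NormedAddCommGroup E] {Φ : ℝ → E} {M : ℝ → ℝ}
    {a b : ℝ} (hab : a ≤ b)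
    (h : ∀ ε > 0, ∃ δ > 0, ∀ c d, a ≤ c → c ≤ d → d ≤ b → d - c < δ →
      ‖Φ d - Φ c‖ ≤ ε * (M d - M c)) : Φ b = Φ a := by
  -- Summing over an equal partition of mesh below `δ`, the increments of `M` telescope; the factor
  -- `ε` then tends to `0`.
  have key : ∀ ε > 0, ‖Φ b - Φ a‖ ≤ ε * (M b - M a) := by
    intro ε hε
    obtain ⟨δ, hδ, hs⟩ := h ε hε
    obtain ⟨N, hN⟩ := exists_nat_gt ((b - a) / δ)
    have hN0 : (0 : ℝ) < N := lt_of_le_of_lt (div_nonneg (by linarith) hδ.le) hN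
    have hstep : (b - a) / N < δ := by
      rw [div_lt_iff₀ hδ] at hN
      rw [div_lt_iff₀ hN0]; linarith
    have hnn : 0 ≤ (b - a) / N := div_nonneg (by linarith) hN0.le
    have ind : ∀ i : ℕ, i ≤ N →
        ‖Φ (a + i * ((b - a) / N)) - Φ a‖ ≤ ε * (M (a + i * ((b - a) / N)) - M a) := by
      intro i
      induction i with
      | zero => simp
      | succ i ih =>
        intro hi
        have h1 := ih (by omega)
        have hi' : ((i : ℝ) + 1) * ((b - a) / N) ≤ b - a := by
          have : ((i : ℝ) + 1) ≤ N := by exact_mod_cast hi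
          calc ((i : ℝ) + 1) * ((b - a) / N) ≤ N * ((b - a) / N) := by gcongr
            _ = b - a := by field_simp
        have h2 := hs (a + i * ((b - a) / N)) (a + (i + 1 : ℕ) * ((b - a) / N))
          (by have : 0 ≤ (i : ℝ) * ((b - a) / N) := by positivity
              linarith)
          (by push_cast; nlinarith) (by push_cast; linarith) (by push_cast; nlinarith)
        calc _ = ‖(Φ (a + (i + 1 : ℕ) * ((b - a) / N)) - Φ (a + i * ((b - a) / N)))
              + (Φ (a + i * ((b - a) / N)) - Φ a)‖ := by congr 1; abel
          _ ≤ _ := norm_add_le _ _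
          _ ≤ _ := add_le_add h2 h1
          _ = _ := by ring
    have := ind N le_rfl
    have e : a + N * ((b - a) / N) = b := by field_simp; ring
    rwa [e] at this
  have h0 : ‖Φ b - Φ a‖ ≤ 0 := by
    have ht : Tendsto (fun ε : ℝ => ε * (M b - M a)) (𝓝[>] 0) (𝓝 0) := by
      have : Continuous fun ε : ℝ => ε * (M b - M a) := by fun_prop
      simpa using (this.tendsto 0).mono_left (nhdsWithin_le_nhds (s := Ioi 0))
    refine ge_of_tendsto ht ?_
    filter_upwards [self_mem_nhdsWithin] with ε hε using key ε hε
  exact sub_eq_zero.1 (norm_le_zero_iff.1 h0)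

/-- The chain rule for the exponential of a primitive, in integrated form. -/
theorem integral_mul_exp_primitive {ψ : ℝ → ℂ} {a b : ℝ} (hab : a ≤ b)
    (hψ : IntervalIntegrable ψ volume a b) :
    ∫ v in a..b, ψ v * Complex.exp (∫ w in a..v, ψ w) = Complex.exp (∫ w in a..b, ψ w) - 1 := by
  have hI : ∀ c d, a ≤ c → c ≤ d → d ≤ b → IntervalIntegrable ψ volume c d := fun c d hc hcd hd =>
    hψ.mono_set (by rw [uIcc_of_le hcd, uIcc_of_le hab]; exact Icc_subset_Icc hc hd)
  set Ψ : ℝ → ℂ := fun v => ∫ w in a..v, ψ w with hΨ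
  have hΨc : ContinuousOn Ψ (Icc a b) := by
    have := intervalIntegral.continuousOn_primitive_interval (μ := volume) (f := ψ) (a := a) (b := b)
      (by rw [uIcc_of_le hab]; exact (intervalIntegrable_iff_integrableOn_Icc_of_le hab).1 hψ)
    rwa [uIcc_of_le hab] at this
  set e : ℝ → ℂ := fun v => Complex.exp (Ψ v) with he
  have hec : ContinuousOn e (Icc a b) := Complex.continuous_exp.comp_continuousOn hΨc
  have heI : ∀ c d, a ≤ c → c ≤ d → d ≤ b →
      IntervalIntegrable (fun v => ψ v * e v) volume c d := fun c d hc hcd hd =>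
    (hI c d hc hcd hd).mul_continuousOn
      (hec.mono (by rw [uIcc_of_le hcd]; exact Icc_subset_Icc hc hd))
  obtain ⟨C, hC⟩ := isCompact_Icc.exists_bound_of_continuousOn hec
  have hC0 : 0 ≤ C := (norm_nonneg _).trans (hC a ⟨le_rfl, hab⟩)
  have hΨu := Metric.uniformContinuousOn_iff.1 (isCompact_Icc.uniformContinuousOn_of_continuous hΨc)
  have heu := Metric.uniformContinuousOn_iff.1 (isCompact_Icc.uniformContinuousOn_of_continuous hec)
  -- As `ψ` is merely integrable, the increment of `e - ∫ ψ e` is compared with that of `∫ ‖ψ‖`. On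
  -- a short interval it splits into a second-order remainder of `exp` and the oscillation of `e`.
  have main := eq_of_increments_small (Φ := fun v => e v - ∫ w in a..v, ψ w * e w)
    (M := fun v => ∫ w in a..v, ‖ψ w‖) hab ?_
  · simp only [intervalIntegral.integral_same, he, hΨ, Complex.exp_zero, sub_zero] at main
    rw [← main]; ring
  intro ε hε
  -- The bound `1` allows the quadratic estimate for `exp Δ - 1 - Δ`; the quotient gives `C η + η ≤
  -- ε`, with `C` bounding `e` on `[a,b]`.
  set η : ℝ := min 1 (ε / (C + 1)) with hη
  have hη0 : 0 < η := lt_min one_pos (by positivity)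
  obtain ⟨δ₁, hδ₁, h₁⟩ := hΨu η hη0
  obtain ⟨δ₂, hδ₂, h₂⟩ := heu η hη0
  refine ⟨min δ₁ δ₂, lt_min hδ₁ hδ₂, fun c d hc hcd hd hdc => ?_⟩
  have hcm : c ∈ Icc a b := ⟨hc, hcd.trans hd⟩
  have hdm : d ∈ Icc a b := ⟨hc.trans hcd, hd⟩
  set Δ : ℂ := ∫ w in c..d, ψ w with hΔ
  have hΔΨ : Ψ d - Ψ c = Δ := intervalIntegral.integral_interval_sub_left
    (hI a d le_rfl hdm.1 hd) (hI a c le_rfl hc hcm.2)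
  have hMM : (∫ w in a..d, ‖ψ w‖) - ∫ w in a..c, ‖ψ w‖ = ∫ w in c..d, ‖ψ w‖ :=
    intervalIntegral.integral_interval_sub_left
    (hI a d le_rfl hdm.1 hd).norm (hI a c le_rfl hc hcm.2).norm
  have hee : (∫ w in a..d, ψ w * e w) - ∫ w in a..c, ψ w * e w = ∫ w in c..d, ψ w * e w :=
    intervalIntegral.integral_interval_sub_left
    (heI a d le_rfl hdm.1 hd) (heI a c le_rfl hc hcm.2)
  have hΔM : ‖Δ‖ ≤ ∫ w in c..d, ‖ψ w‖ := intervalIntegral.norm_integral_le_integral_norm hcd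
  have hΔη : ‖Δ‖ ≤ η := by
    rw [← hΔΨ, ← dist_eq_norm]
    refine (h₁ d hdm c hcm ?_).le
    rw [Real.dist_eq, abs_of_nonneg (by linarith)]
    exact hdc.trans_le (min_le_left _ _)
  have hed : e d = e c * Complex.exp Δ := by
    simp only [he, ← Complex.exp_add, ← hΔΨ]; congr 1; ring
  have hsplit : (e d - ∫ w in a..d, ψ w * e w) - (e c - ∫ w in a..c, ψ w * e w)
      = e c * (Complex.exp Δ - 1 - Δ) + ∫ w in c..d, ψ w * (e c - e w) := by
    have : ∫ w in c..d, ψ w * (e c - e w) = Δ * e c - ∫ w in c..d, ψ w * e w := by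
      simp only [mul_sub]
      rw [intervalIntegral.integral_sub ((hI c d hc hcd hd).mul_const _) (heI c d hc hcd hd),
        intervalIntegral.integral_mul_const]
    rw [this, ← hee, hed]; ring
  rw [hsplit, hMM]
  have hn0 : 0 ≤ ∫ w in c..d, ‖ψ w‖ := (norm_nonneg _).trans hΔM
  have b1 : ‖e c * (Complex.exp Δ - 1 - Δ)‖ ≤ C * η * ∫ w in c..d, ‖ψ w‖ := by
    rw [norm_mul]
    have := Complex.norm_exp_sub_one_sub_id_le (x := Δ) (hΔη.trans (min_le_left _ _))
    calc ‖e c‖ * ‖Complex.exp Δ - 1 - Δ‖ ≤ C * ‖Δ‖ ^ 2 := by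
          gcongr; exact hC c hcm
      _ = C * (‖Δ‖ * ‖Δ‖) := by ring
      _ ≤ C * (η * ∫ w in c..d, ‖ψ w‖) := by gcongr
      _ = _ := by ring
  have b2 : ‖∫ w in c..d, ψ w * (e c - e w)‖ ≤ η * ∫ w in c..d, ‖ψ w‖ := by
    rw [← intervalIntegral.integral_const_mul]
    refine intervalIntegral.norm_integral_le_of_norm_le hcd ?_ ((hI c d hc hcd hd).norm.const_mul _)
    refine Eventually.of_forall fun w hw => ?_
    rw [norm_mul, mul_comm]
    gcongr
    rw [← dist_eq_norm]
    refine (h₂ c hcm w ⟨hc.trans hw.1.le, hw.2.trans hd⟩ ?_).le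
    rw [Real.dist_eq, abs_sub_comm, abs_of_nonneg (by linarith [hw.1])]
    exact lt_of_le_of_lt (by linarith [hw.2]) (hdc.trans_le (min_le_right _ _))
  have hCη : C * η + η ≤ ε := by
    have : η ≤ ε / (C + 1) := min_le_right _ _
    rw [le_div_iff₀ (by positivity)] at this
    linarith
  calc _ ≤ _ := norm_add_le _ _
    _ ≤ C * η * (∫ w in c..d, ‖ψ w‖) + η * ∫ w in c..d, ‖ψ w‖ := add_le_add b1 b2
    _ = (C * η + η) * ∫ w in c..d, ‖ψ w‖ := by ring
    _ ≤ _ := by gcongr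

/-! ### Additive subordinators -/

/-- A finite set of times before `s` is covered by a monotone sequence from `0` that is
eventually equal to `s`. -/
theorem exists_monotone_seq_covering (I : Finset ℝ≥0) : ∀ s, (∀ l ∈ I, l ≤ s) →
    ∃ (τ : ℕ → ℝ≥0) (k : ℕ), Monotone τ ∧ τ 0 = 0 ∧ (∀ j, k ≤ j → τ j = s) ∧
      ∀ l ∈ I, ∃ j ≤ k, τ j = l := by
  induction I using Finset.induction_on_max with
  | empty =>
    intro s _
    refine ⟨fun j => if j = 0 then 0 else s, 1, ?_, by simp, ?_, by simp⟩
    · intro i j hij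
      by_cases hi : i = 0
      · simp [hi]
      · have : j ≠ 0 := by omega
        simp [hi, this]
    · intro j hj
      have : j ≠ 0 := by omega
      simp [this]
  | insert a I hmax ih =>
    intro s hs
    obtain ⟨τ, k, hτ, h0, hk, hI⟩ := ih a (fun l hl => (hmax l hl).le)
    have has : a ≤ s := hs a (Finset.mem_insert_self _ _)
    have hle : ∀ j, τ j ≤ a := fun j => by
      rw [← hk (max j k) (le_max_right _ _)]
      exact hτ (le_max_left _ _)
    refine ⟨fun j => if j ≤ k then τ j else s, k + 1, ?_, by simp [h0], ?_, ?_⟩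
    · intro i j hij
      by_cases hj : j ≤ k
      · have : i ≤ k := hij.trans hj
        simpa [hj, this] using hτ hij
      · by_cases hi : i ≤ k
        · simpa [hj, hi] using (hle i).trans has
        · simp [hj, hi]
    · intro j hj
      have : ¬ j ≤ k := by omega
      simp [this]
    · intro l hl
      rcases Finset.mem_insert.1 hl with rfl | hl
      · exact ⟨k, by omega, by simp [hk k le_rfl]⟩
      · obtain ⟨j, hj, rfl⟩ := hI l hl
        exact ⟨j, by omega, by simp [hj]⟩

namespace IsAdditiveSubordinator

variable {Ω : Type*} [MeasurableSpace Ω] {μ : Measure Ω}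
  {Z : ℝ≥0 → Ω → ℝ≥0} {β : ℝ → ℝ} {g : ℝ → ℝ → ℝ}

theorem coe_increment (hZ : IsAdditiveSubordinator μ Z β g) {a b : ℝ≥0} (hab : a ≤ b) (ω : Ω) :
    ((Z b ω - Z a ω : ℝ≥0) : ℝ) = (Z b ω : ℝ) - Z a ω :=
  NNReal.coe_sub (hZ.mono ω hab)

theorem measurable_increment (hZ : IsAdditiveSubordinator μ Z β g) (a b : ℝ≥0) :
    Measurable fun ω => Z b ω - Z a ω :=
  (hZ.measurable b).sub (hZ.measurable a)

theorem integral_exp_neg (hZ : IsAdditiveSubordinator μ Z β g) (t : ℝ≥0) :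
    ((∫ ω, Real.exp (-(Z t ω : ℝ)) ∂μ : ℝ) : ℂ) =
      Complex.exp (∫ s in (0 : ℝ)..t, laplaceDensity β g s 1) := by
  rw [← hZ.laplace 1 (by simp) t, ← integral_complex_ofReal]
  congr 1; ext ω; push_cast; simp

theorem intervalIntegrable_exponent (hZ : IsAdditiveSubordinator μ Z β g) {u : ℂ} (hu : 0 ≤ u.re)
    (a b : ℝ≥0) : IntervalIntegrable (fun s => laplaceDensity β g s u) volume a b :=
  (hZ.exponent_int u hu a).symm.trans (hZ.exponent_int u hu b)

variable [IsProbabilityMeasure μ]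

theorem integrable_exp_neg (Y : Ω → ℝ≥0) (hY : Measurable Y) :
    Integrable (fun ω => Real.exp (-(Y ω : ℝ))) μ := by
  refine Integrable.of_bound (C := 1) (by fun_prop) (Eventually.of_forall fun ω => ?_)
  rw [Real.norm_eq_abs, Real.abs_exp]
  exact Real.exp_le_one_iff.2 (by simp)

/-- The transform at time `0` equals `1`, while `e^{-Z_0} ≤ 1`; hence `e^{-Z_0} = 1` almost surely.
-/
theorem ae_zero (hZ : IsAdditiveSubordinator μ Z β g) : ∀ᵐ ω ∂μ, Z 0 ω = 0 := by
  have h := hZ.integral_exp_neg 0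
  simp only [NNReal.coe_zero, intervalIntegral.integral_same, Complex.exp_zero] at h
  have h1 : ∫ ω, Real.exp (-(Z 0 ω : ℝ)) ∂μ = 1 := by exact_mod_cast h
  have hi := integrable_exp_neg (μ := μ) (Z 0) (hZ.measurable 0)
  have h2 : ∫ ω, (1 - Real.exp (-(Z 0 ω : ℝ))) ∂μ = 0 := by
    rw [integral_sub (integrable_const _) hi, h1]; simp
  have h3 := (integral_eq_zero_iff_of_nonneg (fun ω => ?_) ((integrable_const _).sub hi)).1 h2
  · filter_upwards [h3] with ω hω
    have : Real.exp (-(Z 0 ω : ℝ)) = 1 := by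
      simp only [Pi.zero_apply, Pi.sub_apply] at hω; linarith
    simpa using this
  · simp

/-- The increment over `[a, b]` is independent of the path up to time `a`. -/
theorem indepFun_past_increment (hZ : IsAdditiveSubordinator μ Z β g) {a b : ℝ≥0} (hab : a ≤ b) :
    IndepFun (fun ω (l : {l : ℝ≥0 // l ≤ a}) => Z l ω) (fun ω => Z b ω - Z a ω) μ := by
  refine IndepFun.process_indepFun (fun i => hZ.measurable _) (hZ.measurable_increment a b) ?_
  intro I
  obtain ⟨τ, k, hτ, h0, hk, hI⟩ := exists_monotone_seq_covering (I.map (Function.Embedding.subtype _))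
    a (by simp only [Finset.mem_map]; rintro l ⟨⟨x, hx⟩, _, rfl⟩; exact hx)
  -- The covering sequence reaches `a` at index `k` and is then sent to `b`. Increment number `k` is
  -- thus `Z_b - Z_a`, and the earlier ones determine `Z` at the times in `I`.
  set τ' : ℕ → ℝ≥0 := fun j => if j ≤ k then τ j else b with hτ'
  have hle : ∀ j, τ j ≤ a := fun j => by
    rw [← hk (max j k) (le_max_right _ _)]
    exact hτ (le_max_left _ _)
  have hmono : Monotone τ' := by
    intro i j hij
    by_cases hj : j ≤ k
    · have : i ≤ k := hij.trans hj
      simpa [hτ', hj, this] using hτ hij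
    · by_cases hi : i ≤ k
      · simpa [hτ', hj, hi] using (hle i).trans hab
      · simp [hτ', hj, hi]
  have hind := hZ.indep_incr.nat hmono
  have hmeas : ∀ i, Measurable fun ω => (Z (τ' (i + 1)) ω : ℝ) - Z (τ' i) ω := fun i =>
    (hZ.measurable _).coe_nnreal_real.sub (hZ.measurable _).coe_nnreal_real
  have h2 := hind.indepFun_finset (Finset.range k) {k} (by simp) hmeas
  choose! j hjk hj using hI
  have hmem : ∀ l : I, ((l : {l : ℝ≥0 // l ≤ a}) : ℝ≥0) ∈ I.map (Function.Embedding.subtype _) :=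
    fun l => Finset.mem_map_of_mem _ l.2
  -- `Z_l` is recovered as a partial sum of the earlier increments, which uses `Z_0 = 0` almost
  -- surely. The increments are real-valued, whence `toNNReal`.
  have h3 := h2.comp (φ := fun (v : Finset.range k → ℝ) (l : I) =>
      (∑ i : Finset.range k, if (i : ℕ) < j l then v i else 0).toNNReal)
    (ψ := fun v : ({k} : Finset ℕ) → ℝ => (v ⟨k, by simp⟩).toNNReal)
    (by
      refine measurable_pi_lambda _ fun l => Measurable.real_toNNReal ?_
      refine Finset.measurable_sum _ fun i _ => ?_
      split_ifs <;> fun_prop)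
    (by fun_prop)
  refine h3.congr ?_ ?_
  · filter_upwards [hZ.ae_zero] with ω hω
    funext l
    have hjl := hj l (hmem l)
    have hjkl := hjk l (hmem l)
    simp only [Function.comp_apply]
    have hsum : (∑ i : Finset.range k, if (i : ℕ) < j l then
        (Z (τ' ((i : ℕ) + 1)) ω : ℝ) - Z (τ' (i : ℕ)) ω else 0) = Z l ω := by
      rw [Finset.sum_coe_sort (Finset.range k)
        (fun i => if i < j l then (Z (τ' (i + 1)) ω : ℝ) - Z (τ' i) ω else 0),
        ← Finset.sum_filter]
      have hf : (Finset.range k).filter (fun i => i < j l) = Finset.range (j l) := by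
        ext i; simp only [Finset.mem_filter, Finset.mem_range]; omega
      rw [hf, Finset.sum_range_sub (fun i => (Z (τ' i) ω : ℝ))]
      simp [hτ', hjkl, hjl, h0, hω]
    rw [hsum, Real.toNNReal_coe]
  · refine Eventually.of_forall fun ω => ?_
    simp only [Function.comp_apply]
    have h1 : τ' (k + 1) = b := by simp [hτ']
    have h2 : τ' k = a := by simp [hτ', hk k le_rfl]
    rw [h1, h2, ← hZ.coe_increment hab, Real.toNNReal_coe]

theorem indepFun_eval_increment (hZ : IsAdditiveSubordinator μ Z β g) {a b c : ℝ≥0} (hab : a ≤ b)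
    (hbc : b ≤ c) :
    IndepFun (fun ω => Z b ω - Z a ω) (fun ω => Z c ω - Z b ω) μ := by
  have h := (hZ.indepFun_past_increment hbc).comp
    (φ := fun z : {l : ℝ≥0 // l ≤ b} → ℝ≥0 => z ⟨b, le_rfl⟩ - z ⟨a, hab⟩) (ψ := id)
    (by fun_prop) measurable_id
  exact h

/-- The Laplace transform of an increment. -/
theorem laplace_increment (hZ : IsAdditiveSubordinator μ Z β g) {u : ℂ} (hu : 0 ≤ u.re)
    {a b : ℝ≥0} (hab : a ≤ b) :
    ∫ ω, Complex.exp (-u * ((Z b ω - Z a ω : ℝ≥0) : ℝ)) ∂μ =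
      Complex.exp (∫ s in (a : ℝ)..b, laplaceDensity β g s u) := by
  have hind := (hZ.indepFun_past_increment hab).comp
    (φ := fun z : {l : ℝ≥0 // l ≤ a} → ℝ≥0 => Complex.exp (-u * ((z ⟨a, le_rfl⟩ : ℝ) : ℂ)))
    (ψ := fun y : ℝ≥0 => Complex.exp (-u * ((y : ℝ) : ℂ)))
    (by fun_prop) (by fun_prop)
  have hm := hZ.measurable
  have hprod := hind.integral_fun_mul_eq_mul_integral
    (Measurable.aestronglyMeasurable (by simp only [Function.comp_def]; fun_prop))
    (Measurable.aestronglyMeasurable (by simp only [Function.comp_def]; fun_prop))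
  simp only [Function.comp_apply] at hprod
  rw [hZ.laplace u hu a] at hprod
  have hl : ∀ ω, Complex.exp (-u * ((Z a ω : ℝ) : ℂ)) *
      Complex.exp (-u * (((Z b ω - Z a ω : ℝ≥0) : ℝ) : ℂ)) =
      Complex.exp (-u * ((Z b ω : ℝ) : ℂ)) := fun ω => by
    rw [← Complex.exp_add, hZ.coe_increment hab]; congr 1; push_cast; ring
  simp only [hl] at hprod
  rw [hZ.laplace u hu b, ← intervalIntegral.integral_add_adjacent_intervals
    (hZ.exponent_int u hu a) (hZ.intervalIntegrable_exponent hu a b), Complex.exp_add] at hprod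
  -- The transform of `Z_a` is an exponential, hence nonzero, and can be divided out.
  exact (mul_left_cancel₀ (Complex.exp_ne_zero _) hprod).symm

/-- The law of an increment is determined by the characteristics. -/
theorem map_increment_eq (hZ : IsAdditiveSubordinator μ Z β g) {Ω' : Type*} [MeasurableSpace Ω']
    {μ' : Measure Ω'} [IsProbabilityMeasure μ'] {Z' : ℝ≥0 → Ω' → ℝ≥0}
    (hZ' : IsAdditiveSubordinator μ' Z' β g) {a b : ℝ≥0} (hab : a ≤ b) :
    μ.map (fun ω => Z b ω - Z a ω) = μ'.map (fun ω => Z' b ω - Z' a ω) := by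
  have hm := hZ.measurable_increment a b
  have hm' := hZ'.measurable_increment a b
  have key : (μ.map (fun ω => Z b ω - Z a ω)).map ((↑) : ℝ≥0 → ℝ) =
      (μ'.map (fun ω => Z' b ω - Z' a ω)).map ((↑) : ℝ≥0 → ℝ) := by
    rw [Measure.map_map measurable_coe_nnreal_real hm, Measure.map_map measurable_coe_nnreal_real hm']
    refine Measure.ext_of_charFun (funext fun ξ => ?_)
    -- At `u = -iξ`, on the boundary of the admissible half-plane, the Laplace transform is the
    -- characteristic function.
    have hu : 0 ≤ (-((ξ : ℂ) * Complex.I)).re := by simp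
    have h1 := (hZ.laplace_increment hu hab).trans (hZ'.laplace_increment hu hab).symm
    have hexp : Continuous fun x : ℝ => Complex.exp (ξ * x * Complex.I) := by fun_prop
    rw [charFun_apply_real, charFun_apply_real,
      integral_map (measurable_coe_nnreal_real.comp hm).aemeasurable hexp.aestronglyMeasurable,
      integral_map (measurable_coe_nnreal_real.comp hm').aemeasurable hexp.aestronglyMeasurable]
    have hcongr : ∀ x : ℝ, Complex.exp (ξ * x * Complex.I) =
        Complex.exp (-(-((ξ : ℂ) * Complex.I)) * x) := fun x => by congr 1; ring
    simp only [hcongr, Function.comp_apply]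
    exact h1
  have hid : (Real.toNNReal ∘ ((↑) : ℝ≥0 → ℝ)) = id := by ext; simp
  have := congrArg (Measure.map Real.toNNReal) key
  rwa [Measure.map_map measurable_real_toNNReal measurable_coe_nnreal_real,
    Measure.map_map measurable_real_toNNReal measurable_coe_nnreal_real, hid, Measure.map_id,
    Measure.map_id] at this

/-- There are no fixed times of discontinuity. -/
theorem ae_continuousAt (hZ : IsAdditiveSubordinator μ Z β g) (t : ℝ≥0) :
    ∀ᵐ ω ∂μ, ContinuousAt (fun s => Z s ω) t := by
  rcases eq_or_ne t 0 with rfl | ht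
  · refine Eventually.of_forall fun ω => ?_
    have h := (hZ.cadlag ω 0).1
    have : Ici (0 : ℝ≥0) = univ := by ext; simp
    rwa [this, continuousWithinAt_univ] at h
  -- The left limit `y` satisfies `y ≤ Z_t`. The exponent is a primitive, hence continuous in time,
  -- so `E[e^{-y}] = E[e^{-Z_t}]`; the two facts force `y = Z_t` almost surely.
  choose y hy using fun ω => (hZ.cadlag ω t).2
  have ht0 : 0 < t := pos_iff_ne_zero.2 ht
  obtain ⟨u, -, hu, hut⟩ := exists_seq_strictMono_tendsto' ht0
  have hu' : Tendsto u atTop (𝓝[<] t) :=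
    tendsto_nhdsWithin_iff.2 ⟨hut, Eventually.of_forall fun n => (hu n).2⟩
  have hlim : ∀ ω, Tendsto (fun n => Z (u n) ω) atTop (𝓝 (y ω)) := fun ω => (hy ω).comp hu'
  have hym : Measurable y := measurable_of_tendsto_metrizable (fun n => hZ.measurable (u n))
    (tendsto_pi_nhds.2 hlim)
  have hyle : ∀ ω, y ω ≤ Z t ω := fun ω =>
    le_of_tendsto' (hlim ω) fun n => hZ.mono ω (hu n).2.le
  have h1 : Tendsto (fun n => ∫ ω, Real.exp (-(Z (u n) ω : ℝ)) ∂μ) atTop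
      (𝓝 (∫ ω, Real.exp (-(y ω : ℝ)) ∂μ)) := by
    refine tendsto_integral_of_dominated_convergence (fun _ => 1) (fun n => ?_)
      (integrable_const _) (fun n => Eventually.of_forall fun ω => ?_)
      (Eventually.of_forall fun ω => ?_)
    · exact (integrable_exp_neg (Z (u n)) (hZ.measurable _)).aestronglyMeasurable
    · rw [Real.norm_eq_abs, Real.abs_exp]
      exact Real.exp_le_one_iff.2 (by simp)
    · have hc : Continuous fun z : ℝ≥0 => Real.exp (-(z : ℝ)) := by fun_prop
      exact (hc.tendsto _).comp (hlim ω)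
  have h2 : Tendsto (fun n => ∫ ω, Real.exp (-(Z (u n) ω : ℝ)) ∂μ) atTop
      (𝓝 (∫ ω, Real.exp (-(Z t ω : ℝ)) ∂μ)) := by
    have hc : ContinuousOn (fun v : ℝ => ∫ s in (0 : ℝ)..v, laplaceDensity β g s 1)
        (uIcc 0 (t : ℝ)) := by
      refine intervalIntegral.continuousOn_primitive_interval ?_
      rw [uIcc_of_le t.coe_nonneg]
      exact (intervalIntegrable_iff_integrableOn_Icc_of_le t.coe_nonneg).1
        (hZ.exponent_int 1 (by simp) t)
    have hut' : Tendsto (fun n => (u n : ℝ)) atTop (𝓝[uIcc 0 (t : ℝ)] (t : ℝ)) := by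
      refine tendsto_nhdsWithin_iff.2 ⟨(NNReal.tendsto_coe.2 hut), Eventually.of_forall fun n => ?_⟩
      rw [uIcc_of_le t.coe_nonneg]
      exact ⟨(u n).coe_nonneg, (hu n).2.le⟩
    have h3 := (Complex.continuous_exp.tendsto _).comp ((hc t right_mem_uIcc).tendsto.comp hut')
    have h4 : Tendsto (fun n => ((∫ ω, Real.exp (-(Z (u n) ω : ℝ)) ∂μ : ℝ) : ℂ)) atTop
        (𝓝 ((∫ ω, Real.exp (-(Z t ω : ℝ)) ∂μ : ℝ) : ℂ)) := by
      simp only [hZ.integral_exp_neg]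
      exact h3
    exact (Complex.continuous_re.tendsto _).comp h4
  have h5 := tendsto_nhds_unique h1 h2
  have hiy := integrable_exp_neg (μ := μ) y hym
  have hit := integrable_exp_neg (μ := μ) (Z t) (hZ.measurable t)
  have h6 : ∫ ω, (Real.exp (-(y ω : ℝ)) - Real.exp (-(Z t ω : ℝ))) ∂μ = 0 := by
    rw [integral_sub hiy hit, h5, sub_self]
  have h7 := (integral_eq_zero_iff_of_nonneg (fun ω => ?_) (hiy.sub hit)).1 h6
  · filter_upwards [h7] with ω hω
    have hyZ : y ω = Z t ω := by
      simp only [Pi.zero_apply, Pi.sub_apply, sub_eq_zero] at hω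
      exact_mod_cast neg_injective (Real.exp_injective hω)
    refine continuousAt_iff_continuous_left'_right'.2 ⟨?_,
      (hZ.cadlag ω t).1.mono Ioi_subset_Ici_self⟩
    rw [ContinuousWithinAt, ← hyZ]
    exact hy ω
  · have : (y ω : ℝ) ≤ Z t ω := by exact_mod_cast hyle ω
    simpa using this

end IsAdditiveSubordinator

/-! ### The evolution system obtained by subordination -/

namespace IsAdditiveSubordinator

variable {E : Type*} [NormedAddCommGroup E] [NormedSpace ℝ E] {P : ℝ≥0 → E →L[ℝ] E}
  {Ω : Type*} [MeasurableSpace Ω] {μ : Measure Ω} [IsProbabilityMeasure μ]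
  {Z : ℝ≥0 → Ω → ℝ≥0} {β : ℝ → ℝ} {g : ℝ → ℝ → ℝ}

theorem integrable_apply_increment (hZ : IsAdditiveSubordinator μ Z β g)
    (hP : IsContractionSemigroup P) (a b : ℝ≥0) (e : E) :
    Integrable (fun ω => P (Z b ω - Z a ω) e) μ :=
  Integrable.of_bound (C := ‖e‖)
    ((hP.continuous_apply e).stronglyMeasurable.comp_measurable
      (hZ.measurable_increment a b)).aestronglyMeasurable
    (Eventually.of_forall fun _ => hP.contraction _ _)

/-- The operator `e ↦ E[P_{Z_b - Z_a} e]`. -/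
def evolution (hZ : IsAdditiveSubordinator μ Z β g) (hP : IsContractionSemigroup P)
    (a b : ℝ≥0) : E →L[ℝ] E :=
  LinearMap.mkContinuous
    { toFun := fun e => ∫ ω, P (Z b ω - Z a ω) e ∂μ
      map_add' := fun e e' => by
        simp only [map_add]
        exact integral_add (hZ.integrable_apply_increment hP a b e)
          (hZ.integrable_apply_increment hP a b e')
      map_smul' := fun c e => by
        simp only [map_smul, integral_smul, RingHom.id_apply] } 1 (by
    intro e
    refine (norm_integral_le_of_norm_le_const (C := ‖e‖)
      (Eventually.of_forall fun _ => hP.contraction _ _)).trans ?_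
    simp)

theorem evolution_apply (hZ : IsAdditiveSubordinator μ Z β g) (hP : IsContractionSemigroup P)
    (a b : ℝ≥0) (e : E) : hZ.evolution hP a b e = ∫ ω, P (Z b ω - Z a ω) e ∂μ := rfl

theorem norm_evolution_apply_le (hZ : IsAdditiveSubordinator μ Z β g)
    (hP : IsContractionSemigroup P) (a b : ℝ≥0) (e : E) : ‖hZ.evolution hP a b e‖ ≤ ‖e‖ := by
  rw [evolution_apply]
  refine (norm_integral_le_of_norm_le_const (C := ‖e‖)
    (Eventually.of_forall fun _ => hP.contraction _ _)).trans ?_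
  simp

theorem evolution_apply_eq (hZ : IsAdditiveSubordinator μ Z β g) (hP : IsContractionSemigroup P)
    {Ω' : Type*} [MeasurableSpace Ω'] {μ' : Measure Ω'} [IsProbabilityMeasure μ']
    {Z' : ℝ≥0 → Ω' → ℝ≥0} (hZ' : IsAdditiveSubordinator μ' Z' β g) {a b : ℝ≥0} (hab : a ≤ b)
    (e : E) : hZ.evolution hP a b e = hZ'.evolution hP a b e := by
  have hc := (hP.continuous_apply e).stronglyMeasurable
  rw [evolution_apply, evolution_apply,
    ← integral_map (f := fun r => P r e) (hZ.measurable_increment a b).aemeasurable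
      hc.aestronglyMeasurable,
    ← integral_map (f := fun r => P r e) (hZ'.measurable_increment a b).aemeasurable
      hc.aestronglyMeasurable, hZ.map_increment_eq hZ' hab]

/-- For fixed `(a,b)` almost every path of `Z` is continuous at `a` and at `b`, so dominated
convergence applies although the paths may jump elsewhere. -/
theorem continuous_evolution_apply (hZ : IsAdditiveSubordinator μ Z β g)
    (hP : IsContractionSemigroup P) (e : E) :
    Continuous fun q : ℝ≥0 × ℝ≥0 => hZ.evolution hP q.1 q.2 e := by
  refine continuous_iff_continuousAt.2 fun q => ?_
  refine continuousAt_of_dominated (bound := fun _ => ‖e‖)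
    (Eventually.of_forall fun q =>
      (hZ.integrable_apply_increment hP q.1 q.2 e).aestronglyMeasurable)
    (Eventually.of_forall fun q => Eventually.of_forall fun ω => hP.contraction _ _)
    (integrable_const _) ?_
  filter_upwards [hZ.ae_continuousAt q.1, hZ.ae_continuousAt q.2] with ω h1 h2
  have h1' : ContinuousAt (fun q : ℝ≥0 × ℝ≥0 => Z q.1 ω) q :=
    ContinuousAt.comp (f := Prod.fst) (g := fun s => Z s ω) h1 continuousAt_fst
  have h2' : ContinuousAt (fun q : ℝ≥0 × ℝ≥0 => Z q.2 ω) q :=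
    ContinuousAt.comp (f := Prod.snd) (g := fun s => Z s ω) h2 continuousAt_snd
  exact ((hP.continuous_apply e).continuousAt).comp (h2'.sub h1')

theorem continuous_evolution (hZ : IsAdditiveSubordinator μ Z β g)
    (hP : IsContractionSemigroup P) :
    Continuous fun q : (ℝ≥0 × ℝ≥0) × E => hZ.evolution hP q.1.1 q.1.2 q.2 := by
  refine continuous_iff_continuousAt.2 fun ⟨p, e⟩ => ?_
  rw [ContinuousAt, tendsto_iff_norm_sub_tendsto_zero]
  have h1 : Tendsto (fun q : (ℝ≥0 × ℝ≥0) × E => ‖q.2 - e‖ +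
      ‖hZ.evolution hP q.1.1 q.1.2 e - hZ.evolution hP p.1 p.2 e‖) (𝓝 (p, e)) (𝓝 0) := by
    have hc : Continuous fun q : (ℝ≥0 × ℝ≥0) × E => ‖q.2 - e‖ +
        ‖hZ.evolution hP q.1.1 q.1.2 e - hZ.evolution hP p.1 p.2 e‖ :=
      (continuous_snd.sub continuous_const).norm.add
        (((hZ.continuous_evolution_apply hP e).comp continuous_fst).sub continuous_const).norm
    simpa using hc.tendsto (p, e)
  refine squeeze_zero (fun _ => norm_nonneg _) (fun q => ?_) h1
  calc _ = ‖hZ.evolution hP q.1.1 q.1.2 (q.2 - e) +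
        (hZ.evolution hP q.1.1 q.1.2 e - hZ.evolution hP p.1 p.2 e)‖ := by
        rw [map_sub]; congr 1; abel
    _ ≤ _ := (norm_add_le _ _).trans (by gcongr; exact hZ.norm_evolution_apply_le hP _ _ _)

theorem continuous_evolution_comp (hZ : IsAdditiveSubordinator μ Z β g)
    (hP : IsContractionSemigroup P) {T : Type*} [TopologicalSpace T] {a b : T → ℝ≥0} {f : T → E}
    (ha : Continuous a) (hb : Continuous b) (hf : Continuous f) :
    Continuous fun x => hZ.evolution hP (a x) (b x) (f x) :=
  (hZ.continuous_evolution hP).comp ((ha.prodMk hb).prodMk hf)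

variable [CompleteSpace E]

theorem evolution_self (hZ : IsAdditiveSubordinator μ Z β g) (hP : IsContractionSemigroup P)
    (a : ℝ≥0) (e : E) : hZ.evolution hP a a e = e := by
  simp [evolution_apply, hP.zero_apply]

/-- The two increments are independent, so their joint law is a product; integrating `P_r P_q e`
against it one variable at a time gives the composition. -/
theorem evolution_comp (hZ : IsAdditiveSubordinator μ Z β g) (hP : IsContractionSemigroup P)
    {a b c : ℝ≥0} (hab : a ≤ b) (hbc : b ≤ c) (e : E) :
    hZ.evolution hP a b (hZ.evolution hP b c e) = hZ.evolution hP a c e := by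
  have hind := hZ.indepFun_eval_increment hab hbc
  have h1 := hZ.measurable_increment a b
  have h2 := hZ.measurable_increment b c
  have hprod := (indepFun_iff_map_prod_eq_prod_map_map h1.aemeasurable h2.aemeasurable).1 hind
  have := Measure.isProbabilityMeasure_map (μ := μ) h1.aemeasurable
  have := Measure.isProbabilityMeasure_map (μ := μ) h2.aemeasurable
  have hc : Continuous fun p : ℝ≥0 × ℝ≥0 => P p.1 (P p.2 e) :=
    hP.continuous_comp continuous_fst ((hP.continuous_apply e).comp continuous_snd)
  have hsm : StronglyMeasurable fun p : ℝ≥0 × ℝ≥0 => P p.1 (P p.2 e) := hc.stronglyMeasurable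
  have hint : Integrable (fun p : ℝ≥0 × ℝ≥0 => P p.1 (P p.2 e))
      ((μ.map fun ω => Z b ω - Z a ω).prod (μ.map fun ω => Z c ω - Z b ω)) :=
    Integrable.of_bound (C := ‖e‖) hsm.aestronglyMeasurable
      (Eventually.of_forall fun p => (hP.contraction _ _).trans (hP.contraction _ _))
  have hr : hZ.evolution hP a c e =
      ∫ ω, P (Z b ω - Z a ω) (P (Z c ω - Z b ω) e) ∂μ := by
    rw [evolution_apply]
    congr 1; ext1 ω
    rw [← hP.add_apply]
    congr 2
    rw [add_comm, tsub_add_tsub_cancel (hZ.mono ω hbc) (hZ.mono ω hab)]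
  rw [hr, ← integral_map (φ := fun ω => (Z b ω - Z a ω, Z c ω - Z b ω))
      (f := fun p : ℝ≥0 × ℝ≥0 => P p.1 (P p.2 e)) (h1.prodMk h2).aemeasurable
      hsm.aestronglyMeasurable, hprod, integral_prod _ hint]
  have hinner : ∀ r : ℝ≥0, ∫ y, P r (P y e) ∂(μ.map fun ω => Z c ω - Z b ω) =
      P r (hZ.evolution hP b c e) := by
    intro r
    have hcr : Continuous fun y => P r (P y e) := (P r).continuous.comp (hP.continuous_apply e)
    rw [integral_map h2.aemeasurable hcr.stronglyMeasurable.aestronglyMeasurable,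
      evolution_apply, ContinuousLinearMap.integral_comp_comm _
        (hZ.integrable_apply_increment hP b c e)]
  simp only [hinner]
  rw [integral_map h1.aemeasurable
    (hP.continuous_apply _).stronglyMeasurable.aestronglyMeasurable, evolution_apply]

end IsAdditiveSubordinator

/-! ### The space-time semigroup -/

namespace IsAdditiveSubordinator

variable {S : Type*} [PseudoMetricSpace S] {P : ℝ≥0 → C₀(S, ℝ) →L[ℝ] C₀(S, ℝ)}
  {Ω : Type*} [MeasurableSpace Ω] {μ : Measure Ω} [IsProbabilityMeasure μ]
  {Z : ℝ≥0 → Ω → ℝ≥0} {β : ℝ → ℝ} {g : ℝ → ℝ → ℝ}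

theorem tendsto_add_cocompact (t : ℝ≥0) :
    Tendsto (fun s : ℝ≥0 => s + t) (cocompact ℝ≥0) (cocompact ℝ≥0) := by
  rw [cocompact_eq_atTop]
  exact tendsto_atTop_mono (fun s => (le_self_add : s ≤ s + t)) tendsto_id

/-- The function `(Q_t f)_s = E[P_{Z_{s+t} - Z_s} f_{s+t}]` on space-time. -/
def spaceTimeFun (hZ : IsAdditiveSubordinator μ Z β g) (hP : IsContractionSemigroup P) (t : ℝ≥0)
    (f : C₀(ℝ≥0 × S, ℝ)) : C₀(ℝ≥0 × S, ℝ) :=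
  ofSlices (fun s => hZ.evolution hP s (s + t) (slice f (s + t)))
    (hZ.continuous_evolution_comp hP (by fun_prop) (by fun_prop)
      ((uniformContinuous_slice f).continuous.comp (by fun_prop)))
    (tendsto_zero_of_norm_le 1 ((tendsto_slice_cocompact f).comp (tendsto_add_cocompact t))
      fun s => (hZ.norm_evolution_apply_le hP _ _ _).trans (one_mul _).ge)

theorem slice_spaceTimeFun (hZ : IsAdditiveSubordinator μ Z β g) (hP : IsContractionSemigroup P)
    (t : ℝ≥0) (f : C₀(ℝ≥0 × S, ℝ)) (s : ℝ≥0) :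
    slice (hZ.spaceTimeFun hP t f) s = hZ.evolution hP s (s + t) (slice f (s + t)) := rfl

theorem norm_spaceTimeFun_le (hZ : IsAdditiveSubordinator μ Z β g)
    (hP : IsContractionSemigroup P) (t : ℝ≥0) (f : C₀(ℝ≥0 × S, ℝ)) :
    ‖hZ.spaceTimeFun hP t f‖ ≤ ‖f‖ :=
  norm_le_of_norm_slice_le fun s => by
    rw [slice_spaceTimeFun]
    exact (hZ.norm_evolution_apply_le hP _ _ _).trans (norm_slice_le f _)

/-- The operator `(Q_t f)_s = E[P_{Z_{s+t} - Z_s} f_{s+t}]` on `C₀(ℝ≥0 × S)`. -/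
def spaceTime (hZ : IsAdditiveSubordinator μ Z β g) (hP : IsContractionSemigroup P) (t : ℝ≥0) :
    C₀(ℝ≥0 × S, ℝ) →L[ℝ] C₀(ℝ≥0 × S, ℝ) :=
  LinearMap.mkContinuous
    { toFun := hZ.spaceTimeFun hP t
      map_add' := fun f f' => ext_slice fun s => by
        rw [slice_add]; simp only [slice_spaceTimeFun, slice_add, map_add]
      map_smul' := fun c f => ext_slice fun s => by
        rw [RingHom.id_apply, slice_smul]; simp only [slice_spaceTimeFun, slice_smul, map_smul] } 1
    fun f => (hZ.norm_spaceTimeFun_le hP t f).trans (one_mul _).ge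

theorem slice_spaceTime (hZ : IsAdditiveSubordinator μ Z β g) (hP : IsContractionSemigroup P)
    (t : ℝ≥0) (f : C₀(ℝ≥0 × S, ℝ)) (s : ℝ≥0) :
    slice (hZ.spaceTime hP t f) s = hZ.evolution hP s (s + t) (slice f (s + t)) :=
  hZ.slice_spaceTimeFun hP t f s

theorem spaceTime_apply (hZ : IsAdditiveSubordinator μ Z β g) (hP : IsContractionSemigroup P)
    (t : ℝ≥0) (f : C₀(ℝ≥0 × S, ℝ)) (s : ℝ≥0) (x : S) :
    hZ.spaceTime hP t f (s, x) = ∫ ω, P (Z (s + t) ω - Z s ω) (slice f (s + t)) x ∂μ := by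
  have h : hZ.spaceTime hP t f (s, x) = evalCLM x (slice (hZ.spaceTime hP t f) s) := rfl
  rw [h, slice_spaceTime, evolution_apply,
    ← ContinuousLinearMap.integral_comp_comm _ (hZ.integrable_apply_increment hP _ _ _)]
  rfl

/-- The convergence has to be uniform in `s`. On `[0,K]` it follows from joint continuity and
compactness; beyond `K` both terms are below `ε/2`, by contractivity. -/
theorem tendsto_spaceTime (hZ : IsAdditiveSubordinator μ Z β g) (hP : IsContractionSemigroup P)
    (f : C₀(ℝ≥0 × S, ℝ)) : Tendsto (fun t => hZ.spaceTime hP t f) (𝓝 0) (𝓝 f) := by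
  refine Metric.nhds_basis_closedBall.tendsto_right_iff.2 fun ε hε => ?_
  have h0 := tendsto_slice_cocompact f
  rw [cocompact_eq_atTop] at h0
  obtain ⟨K, hK⟩ := eventually_atTop.1
    (Metric.nhds_basis_ball.tendsto_right_iff.1 h0 (ε / 2) (half_pos hε))
  have hc : Continuous fun p : ℝ≥0 × ℝ≥0 =>
      ‖hZ.evolution hP p.2 (p.2 + p.1) (slice f (p.2 + p.1)) - slice f p.2‖ :=
    ((hZ.continuous_evolution_comp hP (by fun_prop) (by fun_prop)
      ((uniformContinuous_slice f).continuous.comp (by fun_prop))).sub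
        ((uniformContinuous_slice f).continuous.comp (by fun_prop))).norm
  have hcomp : ∀ᶠ t in 𝓝 (0 : ℝ≥0), ∀ s ∈ Icc 0 K,
      ‖hZ.evolution hP s (s + t) (slice f (s + t)) - slice f s‖ < ε := by
    refine (isCompact_Icc (a := (0 : ℝ≥0)) (b := K)).eventually_forall_of_forall_eventually
      (P := fun t s => ‖hZ.evolution hP s (s + t) (slice f (s + t)) - slice f s‖ < ε) ?_
    intro s _
    refine (hc.tendsto (0, s)).eventually (gt_mem_nhds ?_)
    simpa [hZ.evolution_self hP] using hε
  filter_upwards [hcomp] with t ht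
  rw [mem_closedBall_iff_norm]
  refine norm_le_of_norm_slice_le fun s => ?_
  rw [slice_sub, slice_spaceTime]
  rcases le_total s K with hs | hs
  · exact (ht s ⟨zero_le, hs⟩).le
  · have h1 := hK s hs
    have h2 := hK (s + t) (hs.trans le_self_add)
    rw [mem_ball_zero_iff] at h1 h2
    have h3 := hZ.norm_evolution_apply_le hP s (s + t) (slice f (s + t))
    exact (norm_sub_le _ _).trans (by linarith)

theorem isFellerSemigroup_spaceTime (hZ : IsAdditiveSubordinator μ Z β g)
    (hP : IsFellerSemigroup P) :
    IsFellerSemigroup (hZ.spaceTime hP.isContractionSemigroup) where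
  zero := by
    ext1 f
    refine ext_slice fun s => ?_
    rw [slice_spaceTime, add_zero, evolution_self]; rfl
  add t t' := by
    ext1 f
    refine ext_slice fun s => ?_
    rw [ContinuousLinearMap.comp_apply, slice_spaceTime, slice_spaceTime, slice_spaceTime,
      evolution_comp _ _ le_self_add le_self_add, add_assoc]
  pos t f hf := by
    rintro ⟨s, x⟩
    rw [spaceTime_apply]
    exact integral_nonneg fun ω => hP.pos _ _ (fun y => hf _) _
  contraction t f := hZ.norm_spaceTimeFun_le _ t f
  strong f := (hZ.tendsto_spaceTime _ f).mono_left nhdsWithin_le_nhds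

end IsAdditiveSubordinator

/-! ### Joint measurability of right-continuous processes -/

/-- Approximation of times from the right by countably many values. -/
theorem exists_measurable_approx_right : ∃ (σ : ℕ → ℕ → ℝ≥0) (φ : ℕ → ℝ≥0 → ℕ),
    (∀ n, Measurable (φ n)) ∧ ∀ t, Tendsto (fun n => σ n (φ n t)) atTop (𝓝[≥] t) := by
  -- Each time is rounded up to a grid point of mesh `1/(n+1)`. The approximants lie to the right of
  -- `t`, where the paths are continuous, and take countably many values.
  refine ⟨fun n m => ((m : ℝ≥0) + 1) / (n + 1), fun n t => ⌊(n + 1 : ℝ≥0) * t⌋₊,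
    fun n => Nat.measurable_floor.comp (measurable_id.const_mul _), fun t => ?_⟩
  have hle : ∀ n : ℕ, t ≤ ((⌊(n + 1 : ℝ≥0) * t⌋₊ : ℝ≥0) + 1) / (n + 1) := fun n => by
    rw [le_div_iff₀ (by positivity), mul_comm]
    exact (Nat.lt_floor_add_one _).le
  have hup : ∀ n : ℕ, ((⌊(n + 1 : ℝ≥0) * t⌋₊ : ℝ≥0) + 1) / (n + 1) ≤ t + 1 / (n + 1) := fun n => by
    rw [add_div, add_le_add_iff_right, div_le_iff₀ (by positivity), mul_comm t]
    exact Nat.floor_le zero_le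
  refine tendsto_nhdsWithin_iff.2 ⟨?_, Eventually.of_forall hle⟩
  refine tendsto_of_tendsto_of_tendsto_of_le_of_le tendsto_const_nhds ?_ hle hup
  have h1 : Tendsto (fun n : ℕ => (1 : ℝ≥0) / ((n : ℝ≥0) + 1)) atTop (𝓝 0) :=
    tendsto_one_div_add_atTop_nhds_zero_nat
  simpa using h1.const_add t

/-- A process with right-continuous paths is jointly measurable. -/
theorem measurable_uncurry_of_rightContinuous {Ω S : Type*} [MeasurableSpace Ω]
    [TopologicalSpace S] [TopologicalSpace.PseudoMetrizableSpace S] [MeasurableSpace S]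
    [BorelSpace S] {X : ℝ≥0 → Ω → S} (hX : ∀ t, Measurable (X t))
    (hr : ∀ ω t, ContinuousWithinAt (fun s => X s ω) (Ici t) t) :
    Measurable fun p : ℝ≥0 × Ω => X p.1 p.2 := by
  obtain ⟨σ, φ, hφ, hlim⟩ := exists_measurable_approx_right
  refine measurable_of_tendsto_metrizable (f := fun n (p : ℝ≥0 × Ω) => X (σ n (φ n p.1)) p.2)
    (fun n => ?_) (tendsto_pi_nhds.2 fun p => (hr p.2 p.1).tendsto.comp (hlim p.1))
  have h1 : Measurable fun p : ℕ × Ω => X (σ n p.1) p.2 :=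
    measurable_from_prod_countable_right fun m => hX (σ n m)
  exact h1.comp (((hφ n).comp measurable_fst).prodMk measurable_snd)

/-! ### Weighted laws -/

section WeightedLaw

variable {F : Type*} [NormedAddCommGroup F] [NormedSpace ℝ F]

/-- The image under `T` of the measure with density `w`. -/
def weightedLaw {α : Type*} [MeasurableSpace α] (ν : Measure α) (w : α → ℝ) (T : α → ℝ≥0) :
    Measure ℝ :=
  (ν.withDensity fun x => ENNReal.ofReal (w x)).map fun x => (T x : ℝ)

theorem isFiniteMeasure_weightedLaw {α : Type*} [MeasurableSpace α] {ν : Measure α} {w : α → ℝ}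
    (hw : Integrable w ν) (T : α → ℝ≥0) : IsFiniteMeasure (weightedLaw ν w T) := by
  have := isFiniteMeasure_withDensity_ofReal hw.2
  unfold weightedLaw
  infer_instance

theorem integral_weightedLaw {α : Type*} [MeasurableSpace α] {ν : Measure α} {w : α → ℝ}
    (hw : Integrable w ν) (hw0 : ∀ x, 0 ≤ w x) {T : α → ℝ≥0} (hT : Measurable T)
    {K : ℝ → F} (hK : StronglyMeasurable K) :
    ∫ y, K y ∂(weightedLaw ν w T) = ∫ x, w x • K (T x) ∂ν := by
  rw [weightedLaw, integral_map hT.coe_nnreal_real.aemeasurable hK.aestronglyMeasurable,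
    integral_withDensity_eq_integral_toReal_smul₀ hw.aemeasurable.ennreal_ofReal
      (Eventually.of_forall fun x => ENNReal.ofReal_lt_top)]
  congr 1; ext1 x
  rw [ENNReal.toReal_ofReal (hw0 x)]

/-- An additive relation between weighted laws can be checked on characters. -/
theorem integral_eq_add_of_characters {α₁ α₂ α₃ : Type*} [MeasurableSpace α₁]
    [MeasurableSpace α₂] [MeasurableSpace α₃] {ν₁ : Measure α₁} {ν₂ : Measure α₂} {ν₃ : Measure α₃}
    {w₁ : α₁ → ℝ} {w₂ : α₂ → ℝ} {w₃ : α₃ → ℝ} {T₁ : α₁ → ℝ≥0} {T₂ : α₂ → ℝ≥0} {T₃ : α₃ → ℝ≥0}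
    (hw₁ : Integrable w₁ ν₁) (hw₂ : Integrable w₂ ν₂) (hw₃ : Integrable w₃ ν₃)
    (h₁ : ∀ x, 0 ≤ w₁ x) (h₂ : ∀ x, 0 ≤ w₂ x) (h₃ : ∀ x, 0 ≤ w₃ x)
    (hT₁ : Measurable T₁) (hT₂ : Measurable T₂) (hT₃ : Measurable T₃)
    (hchar : ∀ ξ : ℝ, ∫ x, w₁ x • Complex.exp (ξ * (T₁ x : ℝ) * Complex.I) ∂ν₁ =
      ∫ x, w₂ x • Complex.exp (ξ * (T₂ x : ℝ) * Complex.I) ∂ν₂ +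
        ∫ x, w₃ x • Complex.exp (ξ * (T₃ x : ℝ) * Complex.I) ∂ν₃)
    {K : ℝ≥0 → F} (hK : Continuous K) {C : ℝ} (hC : ∀ y, ‖K y‖ ≤ C) :
    ∫ x, w₁ x • K (T₁ x) ∂ν₁ = ∫ x, w₂ x • K (T₂ x) ∂ν₂ + ∫ x, w₃ x • K (T₃ x) ∂ν₃ := by
  have := isFiniteMeasure_weightedLaw hw₁ T₁
  have := isFiniteMeasure_weightedLaw hw₂ T₂
  have := isFiniteMeasure_weightedLaw hw₃ T₃
  have hchc : ∀ ξ : ℝ, Continuous fun x : ℝ => Complex.exp (ξ * x * Complex.I) := fun ξ => by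
    fun_prop
  have hint : ∀ (ν : Measure ℝ) [IsFiniteMeasure ν] (ξ : ℝ),
      Integrable (fun x : ℝ => Complex.exp (ξ * x * Complex.I)) ν := fun ν _ ξ =>
    Integrable.of_bound (C := 1) (hchc ξ).aestronglyMeasurable (Eventually.of_forall fun x => by
      rw [Complex.norm_exp]; simp)
  -- The images are finite measures on `ℝ`, determined by their characteristic functions. The
  -- vector-valued `K` enters only once the measures are identified.
  have key : weightedLaw ν₁ w₁ T₁ = weightedLaw ν₂ w₂ T₂ + weightedLaw ν₃ w₃ T₃ := by
    refine Measure.ext_of_charFun (funext fun ξ => ?_)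
    rw [charFun_apply_real, charFun_apply_real, integral_add_measure (hint _ ξ) (hint _ ξ),
      integral_weightedLaw hw₁ h₁ hT₁ (hchc ξ).stronglyMeasurable,
      integral_weightedLaw hw₂ h₂ hT₂ (hchc ξ).stronglyMeasurable,
      integral_weightedLaw hw₃ h₃ hT₃ (hchc ξ).stronglyMeasurable]
    exact hchar ξ
  have hK' : Continuous fun y : ℝ => K y.toNNReal := hK.comp continuous_real_toNNReal
  have hKi : ∀ (ν : Measure ℝ) [IsFiniteMeasure ν], Integrable (fun y : ℝ => K y.toNNReal) ν :=
    fun ν _ => Integrable.of_bound (C := C) hK'.stronglyMeasurable.aestronglyMeasurable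
      (Eventually.of_forall fun x => hC _)
  have h := congrArg (fun ν => ∫ y : ℝ, K y.toNNReal ∂ν) key
  rw [integral_add_measure (hKi _) (hKi _),
      integral_weightedLaw hw₁ h₁ hT₁ hK'.stronglyMeasurable,
      integral_weightedLaw hw₂ h₂ hT₂ hK'.stronglyMeasurable,
      integral_weightedLaw hw₃ h₃ hT₃ hK'.stronglyMeasurable] at h
  simpa only [Real.toNNReal_coe] using h

end WeightedLaw

/-! ### Damped semigroups -/

/-- The semigroup `e^{-εt} P_t`. -/
def damped {F : Type*} [NormedAddCommGroup F] [NormedSpace ℝ F] (ε : ℝ) (P : ℝ≥0 → F →L[ℝ] F) :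
    ℝ≥0 → F →L[ℝ] F :=
  fun t => Real.exp (-(ε * t)) • P t

section Damped

variable {F : Type*} [NormedAddCommGroup F] [NormedSpace ℝ F] {P : ℝ≥0 → F →L[ℝ] F}

theorem damped_apply (ε : ℝ) (P : ℝ≥0 → F →L[ℝ] F) (t : ℝ≥0) (e : F) :
    damped ε P t e = Real.exp (-(ε * t)) • P t e := rfl

theorem isContractionSemigroup_damped (hP : IsContractionSemigroup P) {ε : ℝ} (hε : 0 ≤ ε) :
    IsContractionSemigroup (damped ε P) where
  zero := by ext1 e; simp [damped_apply, hP.zero_apply]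
  add s t := by
    ext1 e
    rw [ContinuousLinearMap.comp_apply, damped_apply, damped_apply, damped_apply, hP.add_apply,
      map_smul, smul_smul, ← Real.exp_add]
    congr 2; push_cast; ring
  contraction t e := by
    rw [damped_apply, norm_smul, Real.norm_eq_abs, Real.abs_exp]
    have h1 : Real.exp (-(ε * t)) ≤ 1 := Real.exp_le_one_iff.2 (by simpa using by positivity)
    calc _ ≤ 1 * ‖e‖ := mul_le_mul h1 (hP.contraction t e) (norm_nonneg _) zero_le_one
      _ = ‖e‖ := one_mul _
  strong e := by
    have hc : Continuous fun t : ℝ≥0 => damped ε P t e := by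
      simp only [damped_apply]
      exact (by fun_prop : Continuous fun t : ℝ≥0 => Real.exp (-(ε * t))).smul
        (hP.continuous_apply e)
    simpa [damped_apply, hP.zero_apply] using (hc.tendsto 0).mono_left
      (nhdsWithin_le_nhds (s := Ioi 0))

/-- Product rule: the scalar factor `e^{-εt}` contributes its derivative `-ε` at `0`. -/
theorem generatorMaps_damped {e k : F} (hk : GeneratorMaps P e k) (ε : ℝ) :
    GeneratorMaps (damped ε P) e (k - ε • e) := by
  have h1 : Tendsto (fun t : ℝ≥0 => Real.exp (-(ε * t))) (𝓝[>] 0) (𝓝 1) := by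
    have hc : Continuous fun t : ℝ≥0 => Real.exp (-(ε * t)) := by fun_prop
    simpa using (hc.tendsto 0).mono_left (nhdsWithin_le_nhds (s := Ioi 0))
  have h2 : Tendsto (fun t : ℝ≥0 => (t : ℝ)⁻¹ * (Real.exp (-(ε * t)) - 1)) (𝓝[>] 0) (𝓝 (-ε)) := by
    have hd : HasDerivAt (fun t : ℝ => Real.exp (-(ε * t))) (-ε) 0 := by
      have := ((hasDerivAt_id (0 : ℝ)).const_mul ε).neg.exp
      simpa using this
    have h3 := (hasDerivAt_iff_tendsto_slope_zero.1 hd).comp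
      (tendsto_coe_nhdsGT_zero.mono_right (nhdsWithin_mono _ fun x hx => ne_of_gt hx))
    simpa [Function.comp_def] using h3
  have h4 := (h1.smul hk).add (h2.smul_const e)
  rw [one_smul, neg_smul, ← sub_eq_add_neg] at h4
  refine h4.congr fun t => ?_
  rw [damped_apply, smul_comm, mul_smul, ← smul_add]
  congr 1
  rw [sub_smul, one_smul, smul_sub]; abel

end Damped

/-! ### Integrals of the characteristics -/

/-- The integral `∫ (1 - e^{-εr}) g(v,r) dr`. -/
def jumpExponent (g : ℝ → ℝ → ℝ) (ε v : ℝ) : ℝ :=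
  ∫ r in Ioi (0 : ℝ), (1 - Real.exp (-(ε * r))) * g v r

/-- At a real argument `ψ_v` is real. The assumed integrability of `v ↦ ψ_v(ε)` thereby passes to
`jumpExponent g ε`, the drift being continuous. -/
theorem laplaceDensity_ofReal (β : ℝ → ℝ) (g : ℝ → ℝ → ℝ) (v ε : ℝ) :
    laplaceDensity β g v ε = ((-(ε * β v) - jumpExponent g ε v : ℝ) : ℂ) := by
  have h : ∫ r in Ioi (0 : ℝ), (Complex.exp (-(ε : ℂ) * (r : ℂ)) - 1) * (g v r : ℂ) =
      ((-jumpExponent g ε v : ℝ) : ℂ) := by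
    rw [jumpExponent, ← integral_neg, ← integral_complex_ofReal]
    congr 1; ext r; push_cast; rw [neg_mul]; ring
  rw [laplaceDensity, h]; push_cast; ring

theorem one_sub_exp_neg_nonneg {x : ℝ} (hx : 0 ≤ x) : 0 ≤ 1 - Real.exp (-x) := by
  have : Real.exp (-x) ≤ 1 := Real.exp_le_one_iff.2 (by linarith)
  linarith

theorem one_sub_exp_neg_le_mul_min {ε r : ℝ} (hε : 0 ≤ ε) (hr : 0 ≤ r) :
    1 - Real.exp (-(ε * r)) ≤ (1 + ε) * min 1 r := by
  have h1 : 1 - Real.exp (-(ε * r)) ≤ ε * r := by linarith [Real.add_one_le_exp (-(ε * r))]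
  have h2 : 1 - Real.exp (-(ε * r)) ≤ 1 := by linarith [Real.exp_pos (-(ε * r))]
  rcases min_cases 1 r with ⟨h, _⟩ | ⟨h, _⟩ <;> rw [h] <;> nlinarith

theorem min_one_le_two_mul_one_sub_exp_neg {r : ℝ} (hr : 0 ≤ r) :
    min 1 r ≤ 2 * (1 - Real.exp (-r)) := by
  have h1 : (1 + r) * Real.exp (-r) ≤ 1 := by
    have := Real.add_one_le_exp r
    calc (1 + r) * Real.exp (-r) ≤ Real.exp r * Real.exp (-r) := by
          gcongr; linarith
      _ = 1 := by rw [← Real.exp_add]; simp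
  have h2 : r / (1 + r) ≤ 1 - Real.exp (-r) := by
    rw [div_le_iff₀ (by linarith)]; nlinarith
  have h3 : min 1 r ≤ 2 * (r / (1 + r)) := by
    rw [← mul_div_assoc, le_div_iff₀ (by linarith)]
    rcases min_cases 1 r with ⟨h, _⟩ | ⟨h, _⟩ <;> rw [h] <;> nlinarith
  linarith

namespace IsCharacteristics

variable {β : ℝ → ℝ} {g : ℝ → ℝ → ℝ}

theorem aestronglyMeasurable_jump (h : IsCharacteristics β g) {v : ℝ} (hv : 0 ≤ v) :
    AEStronglyMeasurable (g v) (volume.restrict (Ioi 0)) := by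
  refine ContinuousOn.aestronglyMeasurable ?_ measurableSet_Ioi
  exact h.jump_cont.comp (f := fun r : ℝ => (v, r)) (by fun_prop) fun r hr => ⟨hv, hr⟩

theorem integrableOn_one_sub_exp_mul (h : IsCharacteristics β g) {v ε : ℝ} (hv : 0 ≤ v)
    (hε : 0 ≤ ε) : IntegrableOn (fun r => (1 - Real.exp (-(ε * r))) * g v r) (Ioi 0) := by
  refine ((h.jump_int v hv).const_mul (1 + ε)).mono' ?_ ?_
  · exact (by fun_prop : Continuous fun r : ℝ => 1 - Real.exp (-(ε * r))).aestronglyMeasurable.mul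
      (h.aestronglyMeasurable_jump hv)
  · filter_upwards [ae_restrict_mem measurableSet_Ioi] with r hr
    have hr0 : 0 ≤ r := le_of_lt hr
    have hg := h.jump_nonneg v r hv hr
    rw [Real.norm_eq_abs, abs_of_nonneg
      (mul_nonneg (one_sub_exp_neg_nonneg (mul_nonneg hε hr0)) hg), ← mul_assoc]
    exact mul_le_mul_of_nonneg_right (one_sub_exp_neg_le_mul_min hε hr0) hg

theorem jumpExponent_nonneg (h : IsCharacteristics β g) {v ε : ℝ} (hv : 0 ≤ v) (hε : 0 ≤ ε) :
    0 ≤ jumpExponent g ε v :=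
  setIntegral_nonneg measurableSet_Ioi fun r hr =>
    mul_nonneg (one_sub_exp_neg_nonneg (mul_nonneg hε (le_of_lt hr))) (h.jump_nonneg v r hv hr)

theorem jumpMass_nonneg (h : IsCharacteristics β g) {v : ℝ} (hv : 0 ≤ v) : 0 ≤ jumpMass g v :=
  setIntegral_nonneg measurableSet_Ioi fun r hr =>
    mul_nonneg (le_min zero_le_one (le_of_lt hr)) (h.jump_nonneg v r hv hr)

/-- No integrability of `m` in time is assumed. The right-hand side, which comes from `ψ_v(1)`, is
locally integrable and serves as majorant wherever `m` occurs under a time integral. -/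
theorem jumpMass_le (h : IsCharacteristics β g) {v : ℝ} (hv : 0 ≤ v) :
    jumpMass g v ≤ 2 * jumpExponent g 1 v := by
  rw [jumpMass, jumpExponent, ← integral_const_mul]
  refine setIntegral_mono_on (h.jump_int v hv)
    ((h.integrableOn_one_sub_exp_mul hv zero_le_one).const_mul 2) measurableSet_Ioi fun r hr => ?_
  rw [one_mul, ← mul_assoc]
  exact mul_le_mul_of_nonneg_right (min_one_le_two_mul_one_sub_exp_neg (le_of_lt hr))
    (h.jump_nonneg v r hv hr)

theorem intervalIntegrable_drift (h : IsCharacteristics β g) (a b : ℝ≥0) :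
    IntervalIntegrable β volume a b :=
  (h.drift_cont.mono fun x hx => by
    have := (uIcc_subset_Icc (a₁ := (a : ℝ)) (b₁ := b) (a₂ := 0) (b₂ := max a b)
      ⟨a.coe_nonneg, le_max_left _ _⟩ ⟨b.coe_nonneg, le_max_right _ _⟩) hx
    exact this.1).intervalIntegrable

end IsCharacteristics

theorem IsAdditiveSubordinator.intervalIntegrable_jumpExponent {Ω : Type*} [MeasurableSpace Ω]
    {μ : Measure Ω} {Z : ℝ≥0 → Ω → ℝ≥0} {β : ℝ → ℝ} {g : ℝ → ℝ → ℝ}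
    (hZ : IsAdditiveSubordinator μ Z β g) (h : IsCharacteristics β g) {ε : ℝ} (hε : 0 ≤ ε)
    (a b : ℝ≥0) : IntervalIntegrable (jumpExponent g ε) volume a b := by
  have h1 := hZ.intervalIntegrable_exponent (u := (ε : ℂ)) (by simpa using hε) a b
  have h2 : IntervalIntegrable (fun v => -(ε * β v) - jumpExponent g ε v) volume a b := by
    have : (fun v => -(ε * β v) - jumpExponent g ε v) =
        fun v => (laplaceDensity β g v ε).re := by
      ext v; rw [laplaceDensity_ofReal, Complex.ofReal_re]
    rw [this]
    exact ⟨h1.1.re, h1.2.re⟩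
  have h3 := (((h.intervalIntegrable_drift a b).const_mul ε).neg.sub h2)
  refine h3.congr fun v _ => ?_
  simp

/-! ### The compensated jump part of the generator -/

/-- The integral `∫ g(v,r) (P_r e - e) dr`. -/
def jumpPart {E : Type*} [NormedAddCommGroup E] [NormedSpace ℝ E] (P : ℝ≥0 → E →L[ℝ] E)
    (g : ℝ → ℝ → ℝ) (v : ℝ) (e : E) : E :=
  ∫ r in Ioi (0 : ℝ), g v r • (P r.toNNReal e - e)

namespace IsCharacteristics

variable {β : ℝ → ℝ} {g : ℝ → ℝ → ℝ} {E : Type*} [NormedAddCommGroup E] [NormedSpace ℝ E]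
  [CompleteSpace E] {P : ℝ≥0 → E →L[ℝ] E}

theorem norm_jump_smul_le (h : IsCharacteristics β g) (hP : IsContractionSemigroup P) {e k : E}
    (hk : GeneratorMaps P e k) {v r : ℝ} (hv : 0 ≤ v) (hr : 0 < r) :
    ‖g v r • (P r.toNNReal e - e)‖ ≤ (2 * ‖e‖ + ‖k‖) * (min 1 r * g v r) := by
  have hg := h.jump_nonneg v r hv hr
  have h1 := hP.norm_apply_sub_le_min hk r.toNNReal
  rw [Real.coe_toNNReal r hr.le] at h1
  rw [norm_smul, Real.norm_eq_abs, abs_of_nonneg hg]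
  calc g v r * ‖P r.toNNReal e - e‖ ≤ g v r * ((2 * ‖e‖ + ‖k‖) * min 1 r) := by gcongr
    _ = _ := by ring

theorem integrableOn_jump_smul (h : IsCharacteristics β g) (hP : IsContractionSemigroup P)
    {e k : E} (hk : GeneratorMaps P e k) {v : ℝ} (hv : 0 ≤ v) :
    IntegrableOn (fun r => g v r • (P r.toNNReal e - e)) (Ioi 0) := by
  refine ((h.jump_int v hv).const_mul (2 * ‖e‖ + ‖k‖)).mono' ?_ ?_
  · exact (h.aestronglyMeasurable_jump hv).smul
      ((hP.continuous_toNNReal e).sub continuous_const).stronglyMeasurable.aestronglyMeasurable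
  · filter_upwards [ae_restrict_mem measurableSet_Ioi] with r hr
    exact h.norm_jump_smul_le hP hk hv hr

theorem norm_jumpPart_le (h : IsCharacteristics β g) (hP : IsContractionSemigroup P)
    {e k : E} (hk : GeneratorMaps P e k) {v : ℝ} (hv : 0 ≤ v) :
    ‖jumpPart P g v e‖ ≤ (2 * ‖e‖ + ‖k‖) * jumpMass g v := by
  rw [jumpPart, jumpMass, ← integral_const_mul]
  refine norm_integral_le_of_norm_le ((h.jump_int v hv).const_mul _) ?_
  filter_upwards [ae_restrict_mem measurableSet_Ioi] with r hr
  exact h.norm_jump_smul_le hP hk hv hr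

theorem jumpPart_sub (h : IsCharacteristics β g) (hP : IsContractionSemigroup P)
    {e k e' k' : E} (hk : GeneratorMaps P e k) (hk' : GeneratorMaps P e' k') {v : ℝ}
    (hv : 0 ≤ v) : jumpPart P g v (e - e') = jumpPart P g v e - jumpPart P g v e' := by
  rw [jumpPart, jumpPart, jumpPart, ← integral_sub (h.integrableOn_jump_smul hP hk hv)
    (h.integrableOn_jump_smul hP hk' hv)]
  congr 1; ext1 r
  rw [map_sub, ← smul_sub]; congr 1; abel

end IsCharacteristics

theorem GeneratorMaps.sub {E : Type*} [NormedAddCommGroup E] [NormedSpace ℝ E]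
    {P : ℝ≥0 → E →L[ℝ] E} {e k e' k' : E} (hk : GeneratorMaps P e k)
    (hk' : GeneratorMaps P e' k') : GeneratorMaps P (e - e') (k - k') := by
  refine (Tendsto.sub hk hk').congr fun t => ?_
  rw [map_sub, ← smul_sub]; congr 1; abel

/-! ### The Phillips formula for damped semigroups -/

theorem integral_Ioi_ite_lt {F : Type*} [NormedAddCommGroup F] [NormedSpace ℝ F] {y : ℝ}
    (hy : 0 ≤ y) (f : ℝ → F) :
    ∫ q in Ioi (0 : ℝ), (if q < y then f q else 0) = ∫ q in (0 : ℝ)..y, f q := by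
  have h : (fun q => if q < y then f q else 0) = (Iio y).indicator f := by
    ext q; simp [indicator]
  rw [h, setIntegral_indicator measurableSet_Iio, Ioi_inter_Iio, intervalIntegral.integral_of_le hy,
    integral_Ioc_eq_integral_Ioo]

theorem integrable_prod_of_nonneg {α α' : Type*} [MeasurableSpace α] [MeasurableSpace α']
    {ν : Measure α} {ν' : Measure α'} [SFinite ν] [SFinite ν'] {f : α × α' → ℝ}
    (hf : Measurable f) (h0 : ∀ p, 0 ≤ f p)
    (h1 : ∀ᵐ x ∂ν, Integrable (fun y => f (x, y)) ν')
    (h2 : Integrable (fun x => ∫ y, f (x, y) ∂ν') ν) : Integrable f (ν.prod ν') := by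
  refine (integrable_prod_iff hf.aestronglyMeasurable).2 ⟨h1, ?_⟩
  simpa only [Real.norm_of_nonneg (h0 _)] using h2

/-! ### The weights representing both sides of the Phillips formula as measures on `[0,∞)` -/

section Weights

variable {Ω : Type*}

/-- The weight `1_{q < Z_b - Z_a} e^{-εq}`. -/
def tailWeight (Z : ℝ≥0 → Ω → ℝ≥0) (a b : ℝ≥0) (ε : ℝ) (p : Ω × ℝ) : ℝ :=
  if p.2 < ((Z b p.1 - Z a p.1 : ℝ≥0) : ℝ) then Real.exp (-(ε * p.2.toNNReal)) else 0

/-- The weight `β(v) e^{-ε(Z_v - Z_a)}`. -/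
def driftWeight (Z : ℝ≥0 → Ω → ℝ≥0) (β : ℝ → ℝ) (a : ℝ≥0) (ε : ℝ) (p : ℝ × Ω) : ℝ :=
  β p.1 * Real.exp (-(ε * ((Z p.1.toNNReal p.2 - Z a p.2 : ℝ≥0) : ℝ)))

/-- The function `1_{q < r} g(v,r)`. -/
def jumpTail (g : ℝ → ℝ → ℝ) (p : ℝ × ℝ × ℝ) : ℝ :=
  if p.2.2 < p.2.1 then g p.1 p.2.1 else 0

/-- The weight `1_{q < r} g(v,r) e^{-ε(Z_v - Z_a + q)}`. -/
def jumpWeight (Z : ℝ≥0 → Ω → ℝ≥0) (g : ℝ → ℝ → ℝ) (a : ℝ≥0) (ε : ℝ)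
    (p : (ℝ × ℝ × ℝ) × Ω) : ℝ :=
  jumpTail g p.1 *
    Real.exp (-(ε * ((Z p.1.1.toNNReal p.2 - Z a p.2 + p.1.2.2.toNNReal : ℝ≥0) : ℝ)))

end Weights

namespace IsAdditiveSubordinator

variable {Ω : Type*} [MeasurableSpace Ω] {μ : Measure Ω} {Z : ℝ≥0 → Ω → ℝ≥0} {β : ℝ → ℝ}
  {g : ℝ → ℝ → ℝ}

theorem measurable_increment_uncurry (hZ : IsAdditiveSubordinator μ Z β g) (a : ℝ≥0) :
    Measurable fun p : ℝ × Ω => Z p.1.toNNReal p.2 - Z a p.2 := by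
  have h := measurable_uncurry_of_rightContinuous hZ.measurable fun ω t => (hZ.cadlag ω t).1
  exact (h.comp ((measurable_real_toNNReal.comp measurable_fst).prodMk measurable_snd)).sub
    ((hZ.measurable a).comp measurable_snd)

theorem integrableOn_exp_neg_toNNReal {ε : ℝ} (hε : 0 < ε) :
    IntegrableOn (fun q : ℝ => Real.exp (-(ε * q.toNNReal))) (Ioi 0) := by
  refine (exp_neg_integrableOn_Ioi 0 hε).congr_fun (fun q hq => ?_) measurableSet_Ioi
  simp only [Real.coe_toNNReal q (le_of_lt hq), neg_mul]

/-- Integrating out `q` leaves `ε⁻¹ (1 - e^{-εr}) g(v,r)`, and integrating out `r` leaves `ε⁻¹`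
times `jumpExponent g ε v`, integrable in `v`. Without damping the first step would give `r g(v,r)`,
which need not be integrable at infinity. -/
theorem integrable_jumpTail (hZ : IsAdditiveSubordinator μ Z β g) (h : IsCharacteristics β g)
    (hg : Measurable (Function.uncurry g)) (hg0 : ∀ v r, 0 ≤ g v r) {a b : ℝ≥0} (hab : a ≤ b)
    {ε : ℝ} (hε : 0 < ε) :
    Integrable (fun p : ℝ × ℝ × ℝ => jumpTail g p * Real.exp (-(ε * p.2.2.toNNReal)))
      ((volume.restrict (Ioc (a : ℝ) b)).prod
        ((volume.restrict (Ioi 0)).prod (volume.restrict (Ioi 0)))) := by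
  have hmeas : Measurable fun p : ℝ × ℝ × ℝ =>
      jumpTail g p * Real.exp (-(ε * p.2.2.toNNReal)) := by
    refine Measurable.mul ?_ (by fun_prop)
    unfold jumpTail
    refine Measurable.ite (measurableSet_lt (by fun_prop) (by fun_prop)) ?_ measurable_const
    exact hg.comp (measurable_fst.prodMk (measurable_fst.comp measurable_snd))
  have h0 : ∀ p : ℝ × ℝ × ℝ, 0 ≤ jumpTail g p * Real.exp (-(ε * p.2.2.toNNReal)) := fun p => by
    refine mul_nonneg ?_ (Real.exp_pos _).le
    unfold jumpTail
    split_ifs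
    exacts [hg0 _ _, le_rfl]
  have hq : ∀ v r : ℝ, Integrable (fun q : ℝ => jumpTail g (v, r, q) *
      Real.exp (-(ε * q.toNNReal))) (volume.restrict (Ioi 0)) := fun v r => by
    refine ((integrableOn_exp_neg_toNNReal hε).const_mul (g v r)).mono'
      (hmeas.comp (by fun_prop : Measurable fun q : ℝ => (v, r, q))).aestronglyMeasurable
      (Eventually.of_forall fun q => ?_)
    rw [Real.norm_of_nonneg (h0 _)]
    refine mul_le_mul_of_nonneg_right ?_ (Real.exp_pos _).le
    unfold jumpTail
    split_ifs
    exacts [le_rfl, hg0 _ _]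
  have hqv : ∀ v r : ℝ, 0 < r → ∫ q in Ioi (0 : ℝ), jumpTail g (v, r, q) *
      Real.exp (-(ε * q.toNNReal)) = ε⁻¹ * ((1 - Real.exp (-(ε * r))) * g v r) := fun v r hr => by
    have e1 : ∀ q : ℝ, jumpTail g (v, r, q) * Real.exp (-(ε * q.toNNReal)) =
        if q < r then g v r * Real.exp (-(ε * q.toNNReal)) else 0 := fun q => by
      simp only [jumpTail, ite_mul, zero_mul]
    simp only [e1]
    rw [integral_Ioi_ite_lt hr.le]
    have e2 : ∫ q in (0 : ℝ)..r, g v r * Real.exp (-(ε * q.toNNReal)) =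
        ∫ q in (0 : ℝ)..r, g v r * Real.exp (-ε * q) := by
      refine intervalIntegral.integral_congr fun q hq => ?_
      rw [uIcc_of_le hr.le] at hq
      simp only [Real.coe_toNNReal q hq.1, neg_mul]
    rw [e2, intervalIntegral.integral_const_mul,
      intervalIntegral.integral_comp_mul_left (fun x => Real.exp x) (neg_ne_zero.2 hε.ne'),
      integral_exp]
    simp only [mul_zero, Real.exp_zero, smul_eq_mul, inv_neg, neg_mul]
    ring
  have hle : (a : ℝ) ≤ b := NNReal.coe_le_coe.2 hab
  have hv : ∀ᵐ v ∂(volume.restrict (Ioc (a : ℝ) b)), 0 ≤ v := by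
    filter_upwards [ae_restrict_mem measurableSet_Ioc] with v hv
    exact a.coe_nonneg.trans hv.1.le
  have hin : ∀ v : ℝ, 0 ≤ v → Integrable (fun p : ℝ × ℝ => jumpTail g (v, p) *
      Real.exp (-(ε * p.2.toNNReal))) ((volume.restrict (Ioi 0)).prod (volume.restrict (Ioi 0))) := by
    intro v hv
    refine integrable_prod_of_nonneg (hmeas.comp (by fun_prop : Measurable fun p : ℝ × ℝ => (v, p)))
      (fun p => h0 (v, p)) (Eventually.of_forall fun r => hq v r) ?_
    refine Integrable.congr ((h.integrableOn_one_sub_exp_mul hv hε.le).const_mul ε⁻¹) ?_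
    filter_upwards [ae_restrict_mem measurableSet_Ioi] with r hr
    exact (hqv v r hr).symm
  refine integrable_prod_of_nonneg hmeas h0 (hv.mono hin) ?_
  have hJ := ((intervalIntegrable_iff_integrableOn_Ioc_of_le hle).1
    (hZ.intervalIntegrable_jumpExponent h hε.le a b)).const_mul ε⁻¹
  refine Integrable.congr hJ ?_
  filter_upwards [hv] with v hv
  rw [integral_prod _ (hin v hv), jumpExponent, ← integral_const_mul]
  refine setIntegral_congr_fun measurableSet_Ioi fun r hr => ?_
  exact (hqv v r hr).symm

theorem measurable_jumpTime (hZ : IsAdditiveSubordinator μ Z β g) (a : ℝ≥0) :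
    Measurable fun p : (ℝ × ℝ × ℝ) × Ω =>
      Z p.1.1.toNNReal p.2 - Z a p.2 + p.1.2.2.toNNReal := by
  refine Measurable.add ?_ (by fun_prop)
  exact (hZ.measurable_increment_uncurry a).comp
    (by fun_prop : Measurable fun p : (ℝ × ℝ × ℝ) × Ω => (p.1.1, p.2))

variable [IsProbabilityMeasure μ]

theorem integrable_tailWeight (hZ : IsAdditiveSubordinator μ Z β g) (a b : ℝ≥0) {ε : ℝ}
    (hε : 0 < ε) : Integrable (tailWeight Z a b ε) (μ.prod (volume.restrict (Ioi 0))) := by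
  have h1 := (integrableOn_exp_neg_toNNReal hε).comp_snd μ
  refine h1.mono' (Measurable.aestronglyMeasurable ?_) (Eventually.of_forall fun p => ?_)
  · unfold tailWeight
    have hm := hZ.measurable_increment a b
    refine Measurable.ite ?_ (by fun_prop) measurable_const
    exact measurableSet_lt measurable_snd (hm.comp measurable_fst).coe_nnreal_real
  · unfold tailWeight
    split_ifs
    · rw [Real.norm_eq_abs, Real.abs_exp]
    · rw [norm_zero]; positivity

theorem integrable_driftWeight (hZ : IsAdditiveSubordinator μ Z β g) (h : IsCharacteristics β g)
    (hβ : Measurable β) {a b : ℝ≥0} (hab : a ≤ b) {ε : ℝ} (hε : 0 < ε) :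
    Integrable (driftWeight Z β a ε) ((volume.restrict (Ioc (a : ℝ) b)).prod μ) := by
  have h1 := ((intervalIntegrable_iff_integrableOn_Ioc_of_le (NNReal.coe_le_coe.2 hab)).1
    (h.intervalIntegrable_drift a b)).norm.comp_fst μ
  have hm := hZ.measurable_increment_uncurry a
  refine h1.mono' (Measurable.aestronglyMeasurable ?_) (Eventually.of_forall fun p => ?_)
  · unfold driftWeight; fun_prop
  · unfold driftWeight
    rw [norm_mul, Real.norm_eq_abs (Real.exp _), Real.abs_exp]
    refine mul_le_of_le_one_right (norm_nonneg _) (Real.exp_le_one_iff.2 ?_)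
    have : 0 ≤ ε * ((Z p.1.toNNReal p.2 - Z a p.2 : ℝ≥0) : ℝ) := by positivity
    linarith

theorem integrable_jumpWeight (hZ : IsAdditiveSubordinator μ Z β g) (h : IsCharacteristics β g)
    (hg : Measurable (Function.uncurry g)) (hg0 : ∀ v r, 0 ≤ g v r) {a b : ℝ≥0} (hab : a ≤ b)
    {ε : ℝ} (hε : 0 < ε) :
    Integrable (jumpWeight Z g a ε) (((volume.restrict (Ioc (a : ℝ) b)).prod
        ((volume.restrict (Ioi 0)).prod (volume.restrict (Ioi 0)))).prod μ) := by
  have h1 := (hZ.integrable_jumpTail h hg hg0 hab hε).comp_fst μ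
  refine h1.mono' (Measurable.aestronglyMeasurable ?_) (Eventually.of_forall fun p => ?_)
  · unfold jumpWeight
    have hm := hZ.measurable_jumpTime a
    refine Measurable.mul ?_ (by fun_prop)
    unfold jumpTail
    refine Measurable.ite (measurableSet_lt (by fun_prop) (by fun_prop)) ?_ measurable_const
    exact hg.comp (by fun_prop : Measurable fun p : (ℝ × ℝ × ℝ) × Ω => (p.1.1, p.1.2.1))
  · have hj : 0 ≤ jumpTail g p.1 := by
      unfold jumpTail
      split_ifs
      exacts [hg0 _ _, le_rfl]
    unfold jumpWeight
    rw [Real.norm_of_nonneg (mul_nonneg hj (Real.exp_pos _).le)]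
    refine mul_le_mul_of_nonneg_left (Real.exp_le_exp.2 ?_) hj
    rw [neg_le_neg_iff]
    refine mul_le_mul_of_nonneg_left ?_ hε.le
    exact_mod_cast le_add_self

theorem integrable_smul_semigroup {F α : Type*} [NormedAddCommGroup F] [NormedSpace ℝ F]
    {P : ℝ≥0 → F →L[ℝ] F} (hP : IsContractionSemigroup P) [MeasurableSpace α] {ν : Measure α}
    {w : α → ℝ} (hw : Integrable w ν) {T : α → ℝ≥0} (hT : Measurable T) (x : F) :
    Integrable (fun y => w y • P (T y) x) ν := by
  refine (hw.norm.mul_const ‖x‖).mono' (hw.aestronglyMeasurable.smul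
    ((hP.continuous_apply x).stronglyMeasurable.comp_measurable hT).aestronglyMeasurable)
    (Eventually.of_forall fun y => ?_)
  rw [norm_smul]
  exact mul_le_mul_of_nonneg_left (hP.contraction _ _) (norm_nonneg _)

/-! ### The weighted integrals evaluated by Fubini's theorem -/

section Values

variable {F : Type*} [NormedAddCommGroup F] [NormedSpace ℝ F] {P : ℝ≥0 → F →L[ℝ] F}

/-- For fixed `ω` the integral over `q < Z_b - Z_a` is the fundamental theorem of calculus along the
damped orbit, whose generator value is `k - ε • e`. -/
theorem integral_tailWeight [CompleteSpace F] (hZ : IsAdditiveSubordinator μ Z β g) (hP : IsContractionSemigroup P)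
    {e k : F} (hk : GeneratorMaps P e k) {a b : ℝ≥0} {ε : ℝ} (hε : 0 < ε) :
    ∫ p, tailWeight Z a b ε p • P p.2.toNNReal (k - ε • e) ∂(μ.prod (volume.restrict (Ioi 0))) =
      hZ.evolution (isContractionSemigroup_damped hP hε.le) a b e - e := by
  have hi := integrable_smul_semigroup hP (hZ.integrable_tailWeight a b hε)
    (measurable_real_toNNReal.comp measurable_snd) (k - ε • e)
  simp only [Function.comp_apply] at hi
  have hd := isContractionSemigroup_damped hP hε.le
  rw [integral_prod _ hi, evolution_apply]
  have : ∀ ω, ∫ q in Ioi (0 : ℝ), tailWeight Z a b ε (ω, q) • P q.toNNReal (k - ε • e) =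
      damped ε P (Z b ω - Z a ω) e - e := fun ω => by
    rw [hd.apply_sub_eq_integral (generatorMaps_damped hk ε),
      ← integral_Ioi_ite_lt (NNReal.coe_nonneg _)]
    congr 1; ext1 q
    simp only [tailWeight, ite_smul, zero_smul, damped_apply]
  simp only [this]
  rw [integral_sub (hZ.integrable_apply_increment hd a b e) (integrable_const _)]
  simp

/-- The exponential in the weight turns `P` into the damped semigroup at the random time.
Integrability on the product space yields both the time integrability and the value. -/
theorem integral_driftWeight (hZ : IsAdditiveSubordinator μ Z β g) (h : IsCharacteristics β g)
    (hβ : Measurable β) (hP : IsContractionSemigroup P) (x : F) {a b : ℝ≥0} (hab : a ≤ b)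
    {ε : ℝ} (hε : 0 < ε) :
    IntervalIntegrable (fun v => β v •
        hZ.evolution (isContractionSemigroup_damped hP hε.le) a v.toNNReal x) volume a b ∧
    ∫ p, driftWeight Z β a ε p • P (Z p.1.toNNReal p.2 - Z a p.2) x
      ∂((volume.restrict (Ioc (a : ℝ) b)).prod μ) =
      ∫ v in (a : ℝ)..b, β v •
        hZ.evolution (isContractionSemigroup_damped hP hε.le) a v.toNNReal x := by
  have hi := integrable_smul_semigroup hP (hZ.integrable_driftWeight h hβ hab hε)
    (hZ.measurable_increment_uncurry a) x
  have hv : ∀ v, ∫ ω, driftWeight Z β a ε (v, ω) • P (Z v.toNNReal ω - Z a ω) x ∂μ =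
      β v • hZ.evolution (isContractionSemigroup_damped hP hε.le) a v.toNNReal x := fun v => by
    rw [evolution_apply, ← integral_smul]
    congr 1; ext1 ω
    simp only [driftWeight, mul_smul, damped_apply]
  have h1 := hi.integral_prod_left
  have h2 := integral_prod _ hi
  simp only [hv] at h1 h2
  rw [intervalIntegrable_iff_integrableOn_Ioc_of_le (NNReal.coe_le_coe.2 hab),
    intervalIntegral.integral_of_le (NNReal.coe_le_coe.2 hab)]
  exact ⟨h1, h2⟩

/-- Integrating over `ω` gives the damped evolution applied to the damped orbit at time `q`; over `q
< r`, the increment of that orbit up to time `r`; over `r`, the jump part. The evolution, being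
continuous and linear, is moved outside the last two integrals. -/
theorem integral_jumpWeight [CompleteSpace F] (hZ : IsAdditiveSubordinator μ Z β g) (h : IsCharacteristics β g)
    (hg : Measurable (Function.uncurry g)) (hg0 : ∀ v r, 0 ≤ g v r)
    (hP : IsContractionSemigroup P) {e k : F} (hk : GeneratorMaps P e k) {a b : ℝ≥0} (hab : a ≤ b)
    {ε : ℝ} (hε : 0 < ε) :
    IntervalIntegrable (fun v => hZ.evolution (isContractionSemigroup_damped hP hε.le) a
        v.toNNReal (jumpPart (damped ε P) g v e)) volume a b ∧
    ∫ p, jumpWeight Z g a ε p •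
        P (Z p.1.1.toNNReal p.2 - Z a p.2 + p.1.2.2.toNNReal) (k - ε • e)
      ∂(((volume.restrict (Ioc (a : ℝ) b)).prod
        ((volume.restrict (Ioi 0)).prod (volume.restrict (Ioi 0)))).prod μ) =
      ∫ v in (a : ℝ)..b, hZ.evolution (isContractionSemigroup_damped hP hε.le) a
        v.toNNReal (jumpPart (damped ε P) g v e) := by
  have hd := isContractionSemigroup_damped hP hε.le
  have hkd := generatorMaps_damped hk ε
  have hi := integrable_smul_semigroup hP (hZ.integrable_jumpWeight h hg hg0 hab hε)
    (hZ.measurable_jumpTime a) (k - ε • e)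
  have hω : ∀ c : ℝ × ℝ × ℝ, ∫ ω, jumpWeight Z g a ε (c, ω) •
      P (Z c.1.toNNReal ω - Z a ω + c.2.2.toNNReal) (k - ε • e) ∂μ =
      jumpTail g c • hZ.evolution hd a c.1.toNNReal (damped ε P c.2.2.toNNReal (k - ε • e)) := by
    intro c
    rw [evolution_apply, ← integral_smul]
    congr 1; ext1 ω
    rw [← hd.add_apply, damped_apply, jumpWeight, mul_smul]
  have h1 := hi.integral_prod_left
  have h2 := integral_prod _ hi
  simp only [hω] at h1 h2
  have h3 := h1.integral_prod_left
  have h4 := integral_prod _ h1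
  have hv : ∀ᵐ v ∂(volume.restrict (Ioc (a : ℝ) b)),
      ∫ c, jumpTail g (v, c) • hZ.evolution hd a v.toNNReal
          (damped ε P c.2.toNNReal (k - ε • e))
        ∂((volume.restrict (Ioi (0 : ℝ))).prod (volume.restrict (Ioi (0 : ℝ)))) =
      hZ.evolution hd a v.toNNReal (jumpPart (damped ε P) g v e) := by
    filter_upwards [h1.prod_right_ae, ae_restrict_mem measurableSet_Ioc] with v hv hvm
    have hv0 : 0 ≤ v := a.coe_nonneg.trans hvm.1.le
    rw [integral_prod _ hv, jumpPart, ← ContinuousLinearMap.integral_comp_comm _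
      (h.integrableOn_jump_smul hd hkd hv0)]
    refine setIntegral_congr_fun measurableSet_Ioi fun r hr => ?_
    have hr0 : (0 : ℝ) ≤ r := le_of_lt hr
    simp only [jumpTail, ite_smul, zero_smul]
    rw [integral_Ioi_ite_lt hr0, intervalIntegral.integral_smul, map_smul,
      hd.apply_sub_eq_integral hkd, Real.coe_toNNReal r hr0,
      ContinuousLinearMap.intervalIntegral_comp_comm _
        ((hd.continuous_toNNReal _).intervalIntegrable _ _)]
  rw [intervalIntegrable_iff_integrableOn_Ioc_of_le (NNReal.coe_le_coe.2 hab),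
    intervalIntegral.integral_of_le (NNReal.coe_le_coe.2 hab)]
  refine ⟨h3.congr hv, ?_⟩
  rw [h2, h4]
  exact integral_congr_ae hv

end Values

end IsAdditiveSubordinator

/-! ### The Phillips formula on characters -/

/-- Multiplication by `e^{iξt}`, as a semigroup on `ℂ`. -/
def characterSemigroup (ξ : ℝ) (t : ℝ≥0) : ℂ →L[ℝ] ℂ :=
  ContinuousLinearMap.mul ℝ ℂ (Complex.exp (ξ * (t : ℝ) * Complex.I))

theorem characterSemigroup_apply (ξ : ℝ) (t : ℝ≥0) (z : ℂ) :
    characterSemigroup ξ t z = Complex.exp (ξ * (t : ℝ) * Complex.I) * z := rfl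

theorem isContractionSemigroup_character (ξ : ℝ) :
    IsContractionSemigroup (characterSemigroup ξ) where
  zero := by ext1; simp [characterSemigroup_apply]
  add s t := by
    ext1
    simp only [characterSemigroup_apply, ContinuousLinearMap.comp_apply, ← mul_assoc,
      ← Complex.exp_add]
    congr 2; push_cast; ring
  contraction t z := by
    rw [characterSemigroup_apply, norm_mul, Complex.norm_exp]
    simp
  strong z := by
    have hc : Continuous fun t : ℝ≥0 => Complex.exp (ξ * (t : ℝ) * Complex.I) * z := by fun_prop
    simpa [characterSemigroup_apply] using (hc.tendsto 0).mono_left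
      (nhdsWithin_le_nhds (s := Ioi 0))

theorem generatorMaps_character (ξ : ℝ) :
    GeneratorMaps (characterSemigroup ξ) 1 (ξ * Complex.I) := by
  have hd : HasDerivAt (fun t : ℝ => Complex.exp (ξ * t * Complex.I)) (ξ * Complex.I) 0 := by
    have h1 : HasDerivAt (fun t : ℝ => (ξ * t * Complex.I : ℂ)) (ξ * Complex.I) 0 := by
      have := ((Complex.ofRealCLM.hasDerivAt (x := (0 : ℝ))).const_mul (ξ : ℂ)).mul_const Complex.I
      simpa using this
    simpa using h1.cexp
  have h3 := (hasDerivAt_iff_tendsto_slope_zero.1 hd).comp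
    (tendsto_coe_nhdsGT_zero.mono_right (nhdsWithin_mono _ fun x hx => ne_of_gt hx))
  simpa [Function.comp_def, GeneratorMaps, characterSemigroup_apply] using h3

theorem damped_character_apply (ε ξ : ℝ) (t : ℝ≥0) (z : ℂ) :
    damped ε (characterSemigroup ξ) t z = Complex.exp (-(ε - ξ * Complex.I) * (t : ℝ)) * z := by
  rw [damped_apply, characterSemigroup_apply, Complex.real_smul, Complex.ofReal_exp, ← mul_assoc,
    ← Complex.exp_add]
  congr 2; push_cast; ring

namespace IsAdditiveSubordinator

variable {Ω : Type*} [MeasurableSpace Ω] {μ : Measure Ω} [IsProbabilityMeasure μ]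
  {Z : ℝ≥0 → Ω → ℝ≥0} {β : ℝ → ℝ} {g : ℝ → ℝ → ℝ}

theorem evolution_damped_character (hZ : IsAdditiveSubordinator μ Z β g) {ε : ℝ} (hε : 0 ≤ ε)
    (ξ : ℝ) {a b : ℝ≥0} (hab : a ≤ b) (z : ℂ) :
    hZ.evolution (isContractionSemigroup_damped (isContractionSemigroup_character ξ) hε) a b z =
      Complex.exp (∫ s in (a : ℝ)..b, laplaceDensity β g s (ε - ξ * Complex.I)) * z := by
  rw [evolution_apply, ← hZ.laplace_increment (by simpa using hε) hab, ← integral_mul_const]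
  simp only [damped_character_apply]

/-- With `u = ε - iξ` this is `ψ_v(u) + u β(v)`. Added to the drift term `-u β(v)` it leaves exactly
`ψ_v(u)`. -/
theorem jumpPart_damped_character (β : ℝ → ℝ) (g : ℝ → ℝ → ℝ) (ε ξ v : ℝ) :
    jumpPart (damped ε (characterSemigroup ξ)) g v 1 =
      laplaceDensity β g v (ε - ξ * Complex.I) + (ε - ξ * Complex.I) * β v := by
  have h : jumpPart (damped ε (characterSemigroup ξ)) g v 1 =
      ∫ r in Ioi (0 : ℝ), (Complex.exp (-(ε - ξ * Complex.I) * r) - 1) * (g v r : ℂ) := by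
    refine setIntegral_congr_fun measurableSet_Ioi fun r hr => ?_
    simp only [damped_character_apply, Complex.real_smul, mul_one,
      Real.coe_toNNReal r (le_of_lt hr)]
    ring
  rw [h, laplaceDensity]; ring

/-- This is the Phillips formula on `ℂ` with `e = 1` and `k = iξ`. There `k - ε` is `-u` with `u = ε
- iξ`, nonzero because `ε > 0`; after multiplication by it the identity is the chain rule for the
exponential of a primitive. -/
theorem integral_weights_character (hZ : IsAdditiveSubordinator μ Z β g)
    (h : IsCharacteristics β g) (hβ : Measurable β) (hg : Measurable (Function.uncurry g))
    (hg0 : ∀ v r, 0 ≤ g v r) {a b : ℝ≥0} (hab : a ≤ b) {ε : ℝ} (hε : 0 < ε) (ξ : ℝ) :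
    ∫ p, tailWeight Z a b ε p • Complex.exp (ξ * (p.2.toNNReal : ℝ) * Complex.I)
      ∂(μ.prod (volume.restrict (Ioi 0))) =
    ∫ p, driftWeight Z β a ε p •
        Complex.exp (ξ * ((Z p.1.toNNReal p.2 - Z a p.2 : ℝ≥0) : ℝ) * Complex.I)
      ∂((volume.restrict (Ioc (a : ℝ) b)).prod μ) +
    ∫ p, jumpWeight Z g a ε p • Complex.exp
        (ξ * ((Z p.1.1.toNNReal p.2 - Z a p.2 + p.1.2.2.toNNReal : ℝ≥0) : ℝ) * Complex.I)
      ∂(((volume.restrict (Ioc (a : ℝ) b)).prod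
        ((volume.restrict (Ioi 0)).prod (volume.restrict (Ioi 0)))).prod μ) := by
  have hP := isContractionSemigroup_character ξ
  have hk := generatorMaps_character ξ
  set u : ℂ := ε - ξ * Complex.I with hu
  have hx : (ξ * Complex.I - ε • (1 : ℂ) : ℂ) = -u := by
    rw [hu, Complex.real_smul]; ring
  have hu0 : -u ≠ 0 := by
    intro h0
    have := congrArg Complex.re h0
    simp [hu] at this
    exact hε.ne' this
  have h1 := hZ.integral_tailWeight hP hk (a := a) (b := b) hε
  obtain ⟨hi2, h2⟩ := hZ.integral_driftWeight h hβ hP (ξ * Complex.I - ε • (1 : ℂ)) hab hε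
  obtain ⟨hi3, h3⟩ := hZ.integral_jumpWeight h hg hg0 hP hk hab hε
  rw [hx] at h1 h2 h3 hi2
  simp only [characterSemigroup_apply, ← smul_mul_assoc] at h1 h2 h3
  rw [integral_mul_const] at h1 h2 h3
  refine mul_right_cancel₀ hu0 ?_
  rw [add_mul, h1, h2, h3, ← intervalIntegral.integral_add hi2 hi3,
    hZ.evolution_damped_character hε.le ξ hab, mul_one,
    ← integral_mul_exp_primitive (NNReal.coe_le_coe.2 hab)
      (hZ.intervalIntegrable_exponent (by simpa [hu] using hε.le) a b)]
  refine intervalIntegral.integral_congr fun v hv => ?_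
  rw [uIcc_of_le (NNReal.coe_le_coe.2 hab)] at hv
  have hv0 : 0 ≤ v := a.coe_nonneg.trans hv.1
  have hav : a ≤ v.toNNReal := NNReal.le_toNNReal_of_coe_le hv.1
  rw [hZ.evolution_damped_character hε.le ξ hav, hZ.evolution_damped_character hε.le ξ hav,
    Real.coe_toNNReal v hv0, jumpPart_damped_character β, Complex.real_smul]
  ring

theorem tendsto_damped_apply {F : Type*} [NormedAddCommGroup F] [NormedSpace ℝ F]
    (P : ℝ≥0 → F →L[ℝ] F) {ε : ℕ → ℝ} (hε : Tendsto ε atTop (𝓝 0))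
    (t : ℝ≥0) (x : F) : Tendsto (fun n => damped (ε n) P t x) atTop (𝓝 (P t x)) := by
  have hc : Continuous fun c : ℝ => Real.exp (-(c * t)) • P t x := by fun_prop
  simpa [damped_apply, Function.comp_def] using (hc.tendsto 0).comp hε

theorem tendsto_evolution_damped {F : Type*} [NormedAddCommGroup F] [NormedSpace ℝ F]
    {P : ℝ≥0 → F →L[ℝ] F} (hZ : IsAdditiveSubordinator μ Z β g)
    (hP : IsContractionSemigroup P) {ε : ℕ → ℝ} (hε0 : ∀ n, 0 ≤ ε n)
    (hε : Tendsto ε atTop (𝓝 0)) (a b : ℝ≥0) {x : ℕ → F} {y : F} (hx : Tendsto x atTop (𝓝 y)) :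
    Tendsto (fun n => hZ.evolution (isContractionSemigroup_damped hP (hε0 n)) a b (x n)) atTop
      (𝓝 (hZ.evolution hP a b y)) := by
  have h1 : Tendsto (fun n => hZ.evolution (isContractionSemigroup_damped hP (hε0 n)) a b y) atTop
      (𝓝 (hZ.evolution hP a b y)) := by
    simp only [evolution_apply]
    refine tendsto_integral_of_dominated_convergence (fun _ => ‖y‖) (fun n => ?_)
      (integrable_const _) (fun n => Eventually.of_forall fun ω => ?_)
      (Eventually.of_forall fun ω => ?_)
    · exact (hZ.integrable_apply_increment
        (isContractionSemigroup_damped hP (hε0 n)) a b y).aestronglyMeasurable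
    · exact (isContractionSemigroup_damped hP (hε0 n)).contraction _ _
    · exact tendsto_damped_apply P hε _ _
  have h2 : Tendsto (fun n => hZ.evolution (isContractionSemigroup_damped hP (hε0 n)) a b
      (x n - y)) atTop (𝓝 0) := by
    refine tendsto_zero_of_norm_le 1 (v := fun n => x n - y) ?_ fun n => ?_
    · simpa using hx.sub_const y
    · rw [one_mul]; exact hZ.norm_evolution_apply_le _ _ _ _
  have h3 := h2.add h1
  rw [zero_add] at h3
  refine h3.congr fun n => ?_
  rw [map_sub, sub_add_cancel]

/-! ### The Phillips formula in a Banach space and removal of the damping -/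

section Phillips

variable {F : Type*} [NormedAddCommGroup F] [NormedSpace ℝ F] [CompleteSpace F]
  {P : ℝ≥0 → F →L[ℝ] F}

/-- The integrated Phillips formula for a damped semigroup. -/
theorem evolution_damped_sub_eq_integral (hZ : IsAdditiveSubordinator μ Z β g)
    (h : IsCharacteristics β g) (hβ : Measurable β) (hβ0 : ∀ v, 0 ≤ β v)
    (hg : Measurable (Function.uncurry g)) (hg0 : ∀ v r, 0 ≤ g v r)
    (hP : IsContractionSemigroup P) {e k : F} (hk : GeneratorMaps P e k) {a b : ℝ≥0} (hab : a ≤ b)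
    {ε : ℝ} (hε : 0 < ε) :
    IntervalIntegrable (fun v => hZ.evolution (isContractionSemigroup_damped hP hε.le) a
        v.toNNReal (β v • (k - ε • e) + jumpPart (damped ε P) g v e)) volume a b ∧
    hZ.evolution (isContractionSemigroup_damped hP hε.le) a b e - e =
      ∫ v in (a : ℝ)..b, hZ.evolution (isContractionSemigroup_damped hP hε.le) a
        v.toNNReal (β v • (k - ε • e) + jumpPart (damped ε P) g v e) := by
  have hw₁ : ∀ p, 0 ≤ tailWeight Z a b ε p := fun p => by
    unfold tailWeight
    split_ifs
    exacts [(Real.exp_pos _).le, le_rfl]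
  have hw₂ : ∀ p, 0 ≤ driftWeight Z β a ε p := fun p => mul_nonneg (hβ0 _) (Real.exp_pos _).le
  have hw₃ : ∀ p, 0 ≤ jumpWeight Z g a ε p := fun p => by
    refine mul_nonneg ?_ (Real.exp_pos _).le
    unfold jumpTail
    split_ifs
    exacts [hg0 _ _, le_rfl]
  have h1 := hZ.integral_tailWeight hP hk (a := a) (b := b) hε
  obtain ⟨hi2, h2⟩ := hZ.integral_driftWeight h hβ hP (k - ε • e) hab hε
  obtain ⟨hi3, h3⟩ := hZ.integral_jumpWeight h hg hg0 hP hk hab hε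
  simp only [map_add, map_smul]
  refine ⟨hi2.add hi3, ?_⟩
  rw [intervalIntegral.integral_add hi2 hi3, ← h1, ← h2, ← h3]
  refine integral_eq_add_of_characters (hZ.integrable_tailWeight a b hε)
    (hZ.integrable_driftWeight h hβ hab hε) (hZ.integrable_jumpWeight h hg hg0 hab hε)
    hw₁ hw₂ hw₃ (T₁ := fun p : Ω × ℝ => p.2.toNNReal)
    (T₂ := fun p : ℝ × Ω => Z p.1.toNNReal p.2 - Z a p.2)
    (T₃ := fun p : (ℝ × ℝ × ℝ) × Ω => Z p.1.1.toNNReal p.2 - Z a p.2 + p.1.2.2.toNNReal)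
    (measurable_real_toNNReal.comp measurable_snd) (hZ.measurable_increment_uncurry a)
    (hZ.measurable_jumpTime a) (hZ.integral_weights_character h hβ hg hg0 hab hε)
    (K := fun y => P y (k - ε • e)) (hP.continuous_apply (k - ε • e))
    (C := ‖k - ε • e‖) (fun y => hP.contraction y _)

theorem tendsto_jumpPart_damped (h : IsCharacteristics β g) (hP : IsContractionSemigroup P)
    {e k : F} (hk : GeneratorMaps P e k) {ε : ℕ → ℝ} (hε0 : ∀ n, 0 ≤ ε n) (hε1 : ∀ n, ε n ≤ 1)
    (hε : Tendsto ε atTop (𝓝 0)) {v : ℝ} (hv : 0 ≤ v) :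
    Tendsto (fun n => jumpPart (damped (ε n) P) g v e) atTop (𝓝 (jumpPart P g v e)) := by
  refine tendsto_integral_of_dominated_convergence
    (fun r => (3 * ‖e‖ + ‖k‖) * (min 1 r * g v r)) (fun n => ?_)
    ((h.jump_int v hv).const_mul _) (fun n => ?_) (Eventually.of_forall fun r => ?_)
  · exact (h.integrableOn_jump_smul (isContractionSemigroup_damped hP (hε0 n))
      (generatorMaps_damped hk _) hv).aestronglyMeasurable
  · filter_upwards [ae_restrict_mem measurableSet_Ioi] with r hr
    refine (h.norm_jump_smul_le (isContractionSemigroup_damped hP (hε0 n))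
      (generatorMaps_damped hk _) hv hr).trans ?_
    have hr0 : (0 : ℝ) < r := hr
    have hg := h.jump_nonneg v r hv hr
    have hn : ‖k - ε n • e‖ ≤ ‖k‖ + ‖e‖ := by
      refine (norm_sub_le _ _).trans ?_
      rw [norm_smul, Real.norm_of_nonneg (hε0 n)]
      have := mul_le_of_le_one_left (norm_nonneg e) (hε1 n)
      linarith
    have : 0 ≤ min 1 r * g v r := by positivity
    exact mul_le_mul_of_nonneg_right (by linarith) this
  · exact ((tendsto_damped_apply P hε _ _).sub_const e).const_smul (g v r)

/-- The integrated Phillips formula, for measurable characteristics. -/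
theorem evolution_sub_eq_integral_of_measurable (hZ : IsAdditiveSubordinator μ Z β g)
    (h : IsCharacteristics β g) (hβ : Measurable β) (hβ0 : ∀ v, 0 ≤ β v)
    (hg : Measurable (Function.uncurry g)) (hg0 : ∀ v r, 0 ≤ g v r)
    (hP : IsContractionSemigroup P) {e k : F} (hk : GeneratorMaps P e k) {a b : ℝ≥0}
    (hab : a ≤ b) :
    hZ.evolution hP a b e - e =
      ∫ v in (a : ℝ)..b, hZ.evolution hP a v.toNNReal (β v • k + jumpPart P g v e) := by
  set ε : ℕ → ℝ := fun n => 1 / ((n : ℝ) + 1) with hεdef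
  have hεpos : ∀ n, 0 < ε n := fun n => by positivity
  have hε1 : ∀ n, ε n ≤ 1 := fun n => by
    rw [hεdef]; simp only
    rw [div_le_one (by positivity)]
    linarith [n.cast_nonneg (α := ℝ)]
  have hε : Tendsto ε atTop (𝓝 0) := tendsto_one_div_add_atTop_nhds_zero_nat
  have hle : (a : ℝ) ≤ b := NNReal.coe_le_coe.2 hab
  have hL := (hZ.tendsto_evolution_damped hP (fun n => (hεpos n).le) hε a b
    (tendsto_const_nhds (x := e))).sub_const e
  refine tendsto_nhds_unique hL ?_
  simp only [fun n => (hZ.evolution_damped_sub_eq_integral h hβ hβ0 hg hg0 hP hk hab (hεpos n)).2]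
  have hknorm : ∀ n, ‖k - ε n • e‖ ≤ ‖k‖ + ‖e‖ := fun n => by
    refine (norm_sub_le _ _).trans ?_
    rw [norm_smul, Real.norm_of_nonneg (hεpos n).le]
    have := mul_le_of_le_one_left (norm_nonneg e) (hε1 n)
    linarith
  -- The constant `3‖e‖ + ‖k‖` is `2‖e‖` plus the bound `‖k‖ + ‖e‖` for the damped generator value,
  -- valid since `ε n ≤ 1`. The jump mass is replaced by its integrable majorant.
  refine intervalIntegral.tendsto_integral_filter_of_dominated_convergence
    (fun v => β v * (‖k‖ + ‖e‖) + (3 * ‖e‖ + ‖k‖) * (2 * jumpExponent g 1 v))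
    (Eventually.of_forall fun n => ?_) (Eventually.of_forall fun n => ?_) ?_ ?_
  · have := (hZ.evolution_damped_sub_eq_integral h hβ hβ0 hg hg0 hP hk hab (hεpos n)).1
    rw [uIoc_of_le hle]
    exact this.1.aestronglyMeasurable
  · refine Eventually.of_forall fun v hv => ?_
    rw [uIoc_of_le hle] at hv
    have hv0 : 0 ≤ v := a.coe_nonneg.trans hv.1.le
    refine (hZ.norm_evolution_apply_le _ _ _ _).trans ((norm_add_le _ _).trans ?_)
    rw [norm_smul, Real.norm_of_nonneg (hβ0 v)]
    refine add_le_add (mul_le_mul_of_nonneg_left (hknorm n) (hβ0 v)) ?_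
    refine (h.norm_jumpPart_le (isContractionSemigroup_damped hP (hεpos n).le)
      (generatorMaps_damped hk _) hv0).trans ?_
    refine mul_le_mul ?_ (h.jumpMass_le hv0) (h.jumpMass_nonneg hv0) (by positivity)
    linarith [hknorm n]
  · exact ((h.intervalIntegrable_drift a b).mul_const _).add
      (((hZ.intervalIntegrable_jumpExponent h zero_le_one a b).const_mul 2).const_mul _)
  · refine Eventually.of_forall fun v hv => ?_
    rw [uIoc_of_le hle] at hv
    have hv0 : 0 ≤ v := a.coe_nonneg.trans hv.1.le
    refine hZ.tendsto_evolution_damped hP (fun n => (hεpos n).le) hε _ _ ?_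
    refine Tendsto.add ?_ (tendsto_jumpPart_damped h hP hk (fun n => (hεpos n).le) hε1 hε hv0)
    have : Tendsto (fun n => k - ε n • e) atTop (𝓝 k) := by
      simpa using (hε.smul_const e).const_sub k
    exact this.const_smul _

end Phillips

end IsAdditiveSubordinator

/-! ### The Phillips formula along time-dependent functions -/

section Restriction

variable {β : ℝ → ℝ} {g : ℝ → ℝ → ℝ}

/-- The drift set to zero at negative times. -/
def driftExt (β : ℝ → ℝ) : ℝ → ℝ := (Ici 0).indicator β

/-- The jump density set to zero outside of its domain. -/
def jumpExt (g : ℝ → ℝ → ℝ) (v r : ℝ) : ℝ :=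
  (Ici (0 : ℝ) ×ˢ Ioi (0 : ℝ)).indicator (Function.uncurry g) (v, r)

theorem driftExt_of_nonneg (β : ℝ → ℝ) {v : ℝ} (hv : 0 ≤ v) : driftExt β v = β v :=
  indicator_of_mem (mem_Ici.2 hv) _

theorem jumpExt_of_nonneg (g : ℝ → ℝ → ℝ) {v r : ℝ} (hv : 0 ≤ v) (hr : 0 < r) :
    jumpExt g v r = g v r :=
  indicator_of_mem (show (v, r) ∈ Ici (0 : ℝ) ×ˢ Ioi (0 : ℝ) from ⟨hv, hr⟩) _

theorem IsCharacteristics.measurable_driftExt (h : IsCharacteristics β g) :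
    Measurable (driftExt β) := by
  have : driftExt β = (Ici 0).piecewise β 0 := (piecewise_eq_indicator).symm
  rw [this]
  exact h.drift_cont.measurable_piecewise continuousOn_const measurableSet_Ici

theorem IsCharacteristics.measurable_jumpExt (h : IsCharacteristics β g) :
    Measurable (Function.uncurry (jumpExt g)) := by
  have : Function.uncurry (jumpExt g) =
      (Ici (0 : ℝ) ×ˢ Ioi (0 : ℝ)).piecewise (Function.uncurry g) 0 :=
    (piecewise_eq_indicator).symm
  rw [this]
  exact h.jump_cont.measurable_piecewise continuousOn_const
    (measurableSet_Ici.prod measurableSet_Ioi)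

theorem IsCharacteristics.driftExt_nonneg (h : IsCharacteristics β g) (v : ℝ) :
    0 ≤ driftExt β v :=
  indicator_nonneg (fun v hv => h.drift_nonneg v hv) v

theorem IsCharacteristics.jumpExt_nonneg (h : IsCharacteristics β g) (v r : ℝ) :
    0 ≤ jumpExt g v r :=
  indicator_nonneg (fun p hp => h.jump_nonneg p.1 p.2 hp.1 hp.2) (v, r)

/-- Nothing is known of `β` and `g` outside their domains. Extension by zero supplies the global
measurability and positivity that the product-space integrals require, without changing any quantity
at nonnegative times. -/
theorem IsCharacteristics.extend (h : IsCharacteristics β g) :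
    IsCharacteristics (driftExt β) (jumpExt g) where
  drift_nonneg v _ := h.driftExt_nonneg v
  drift_cont := h.drift_cont.congr fun v hv => driftExt_of_nonneg β hv
  jump_nonneg v r _ _ := h.jumpExt_nonneg v r
  jump_cont := h.jump_cont.congr fun p hp => jumpExt_of_nonneg g hp.1 hp.2
  jump_int v hv := (h.jump_int v hv).congr_fun
    (fun r hr => by simp only [jumpExt_of_nonneg g hv hr]) measurableSet_Ioi

theorem laplaceDensity_extend (β : ℝ → ℝ) (g : ℝ → ℝ → ℝ) {v : ℝ} (hv : 0 ≤ v) (u : ℂ) :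
    laplaceDensity (driftExt β) (jumpExt g) v u = laplaceDensity β g v u := by
  rw [laplaceDensity, laplaceDensity, driftExt_of_nonneg β hv]
  congr 1
  exact setIntegral_congr_fun measurableSet_Ioi fun r hr => by
    simp only [jumpExt_of_nonneg g hv hr]

theorem jumpPart_jumpExt {E : Type*} [NormedAddCommGroup E] [NormedSpace ℝ E]
    (P : ℝ≥0 → E →L[ℝ] E) (g : ℝ → ℝ → ℝ) {v : ℝ} (hv : 0 ≤ v) (e : E) :
    jumpPart P (jumpExt g) v e = jumpPart P g v e :=
  setIntegral_congr_fun measurableSet_Ioi fun r hr => by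
    simp only [jumpExt_of_nonneg g hv hr]

theorem IsAdditiveSubordinator.extend {Ω : Type*} [MeasurableSpace Ω] {μ : Measure Ω}
    {Z : ℝ≥0 → Ω → ℝ≥0} (hZ : IsAdditiveSubordinator μ Z β g) :
    IsAdditiveSubordinator μ Z (driftExt β) (jumpExt g) where
  measurable := hZ.measurable
  mono := hZ.mono
  cadlag := hZ.cadlag
  indep_incr := hZ.indep_incr
  exponent_int u hu t := by
    refine (hZ.exponent_int u hu t).congr fun v hv => ?_
    rw [uIoc_of_le t.coe_nonneg] at hv
    exact (laplaceDensity_extend β g hv.1.le u).symm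
  laplace u hu t := by
    rw [hZ.laplace u hu t]
    congr 1
    refine intervalIntegral.integral_congr fun v hv => ?_
    rw [uIcc_of_le t.coe_nonneg] at hv
    exact (laplaceDensity_extend β g hv.1 u).symm

end Restriction

/-- The generator at time `v` of the subordinated evolution. -/
def timeGenerator {E : Type*} [NormedAddCommGroup E] [NormedSpace ℝ E] (P : ℝ≥0 → E →L[ℝ] E)
    (β : ℝ → ℝ) (g : ℝ → ℝ → ℝ) (v : ℝ) (e k : E) : E :=
  β v • k + jumpPart P g v e

section TimeGenerator

variable {β : ℝ → ℝ} {g : ℝ → ℝ → ℝ} {E : Type*} [NormedAddCommGroup E] [NormedSpace ℝ E]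
  {P : ℝ≥0 → E →L[ℝ] E}

/-- When `m` is not assumed continuous, continuity in `v` is not available. Measurability still
holds, as the jump part is a parameter integral of a jointly measurable integrand. -/
theorem IsCharacteristics.aestronglyMeasurable_timeGenerator (h : IsCharacteristics β g)
    (hP : IsContractionSemigroup P) {F L : ℝ → E} (hF : Continuous F) (hL : Continuous L)
    {a b : ℝ} (ha : 0 ≤ a) :
    AEStronglyMeasurable (fun v => timeGenerator P β g v (F v) (L v))
      (volume.restrict (Ioc a b)) := by
  have h1 : StronglyMeasurable fun v => driftExt β v • L v :=
    h.measurable_driftExt.stronglyMeasurable.smul hL.stronglyMeasurable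
  have h2 : StronglyMeasurable fun p : ℝ × ℝ =>
      jumpExt g p.1 p.2 • (P p.2.toNNReal (F p.1) - F p.1) := by
    refine h.measurable_jumpExt.stronglyMeasurable.smul (Continuous.stronglyMeasurable ?_)
    exact (hP.continuous_comp (by fun_prop) (hF.comp continuous_fst)).sub (hF.comp continuous_fst)
  have h3 : StronglyMeasurable fun v => jumpPart P (jumpExt g) v (F v) :=
    h2.integral_prod_right' (ν := volume.restrict (Ioi (0 : ℝ)))
  refine (h1.add h3).aestronglyMeasurable.congr ?_
  filter_upwards [ae_restrict_mem measurableSet_Ioc] with v hv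
  have hv0 : 0 ≤ v := ha.trans hv.1.le
  simp only [Pi.add_apply, timeGenerator, driftExt_of_nonneg β hv0, jumpPart_jumpExt P g hv0]

variable [CompleteSpace E]

theorem IsCharacteristics.norm_timeGenerator_le (h : IsCharacteristics β g)
    (hP : IsContractionSemigroup P) {e k : E} (hk : GeneratorMaps P e k) {v : ℝ} (hv : 0 ≤ v) :
    ‖timeGenerator P β g v e k‖ ≤ (2 * ‖e‖ + ‖k‖) * (β v + jumpMass g v) := by
  have hβ := h.drift_nonneg v hv
  refine (norm_add_le _ _).trans ?_
  rw [norm_smul, Real.norm_of_nonneg hβ, mul_add]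
  refine add_le_add ?_ (h.norm_jumpPart_le hP hk hv)
  rw [mul_comm]
  exact mul_le_mul_of_nonneg_right (by linarith [norm_nonneg e]) hβ

theorem IsCharacteristics.timeGenerator_sub (h : IsCharacteristics β g)
    (hP : IsContractionSemigroup P) {e k e' k' : E} (hk : GeneratorMaps P e k)
    (hk' : GeneratorMaps P e' k') {v : ℝ} (hv : 0 ≤ v) :
    timeGenerator P β g v (e - e') (k - k') =
      timeGenerator P β g v e k - timeGenerator P β g v e' k' := by
  rw [timeGenerator, timeGenerator, timeGenerator, h.jumpPart_sub hP hk hk' hv, smul_sub]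
  abel

end TimeGenerator

namespace IsAdditiveSubordinator

variable {Ω : Type*} [MeasurableSpace Ω] {μ : Measure Ω} [IsProbabilityMeasure μ]
  {Z : ℝ≥0 → Ω → ℝ≥0} {β : ℝ → ℝ} {g : ℝ → ℝ → ℝ} {E : Type*} [NormedAddCommGroup E]
  [NormedSpace ℝ E] {P : ℝ≥0 → E →L[ℝ] E}

theorem aestronglyMeasurable_evolution (hZ : IsAdditiveSubordinator μ Z β g)
    (hP : IsContractionSemigroup P) (s : ℝ≥0) {ν : Measure ℝ} {B : ℝ → E}
    (hB : AEStronglyMeasurable B ν) :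
    AEStronglyMeasurable (fun v : ℝ => hZ.evolution hP s v.toNNReal (B v)) ν := by
  have hs : Continuous fun v : ℝ => (s, v.toNNReal) :=
    continuous_const.prodMk continuous_real_toNNReal
  exact Continuous.comp_aestronglyMeasurable (hZ.continuous_evolution hP)
    (f := fun v : ℝ => ((s, v.toNNReal), B v))
    (hs.stronglyMeasurable.aestronglyMeasurable.prodMk hB)

variable [CompleteSpace E]

/-- The integrated Phillips formula. -/
theorem evolution_sub_eq_integral (hZ : IsAdditiveSubordinator μ Z β g)
    (h : IsCharacteristics β g) (hP : IsContractionSemigroup P) {e k : E}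
    (hk : GeneratorMaps P e k) {a b : ℝ≥0} (hab : a ≤ b) :
    hZ.evolution hP a b e - e =
      ∫ v in (a : ℝ)..b, hZ.evolution hP a v.toNNReal (timeGenerator P β g v e k) := by
  have h1 := hZ.extend.evolution_sub_eq_integral_of_measurable h.extend h.measurable_driftExt
    h.driftExt_nonneg h.measurable_jumpExt h.jumpExt_nonneg hP hk hab
  refine h1.trans (intervalIntegral.integral_congr fun v hv => ?_)
  rw [uIcc_of_le (NNReal.coe_le_coe.2 hab)] at hv
  have hv0 : 0 ≤ v := a.coe_nonneg.trans hv.1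
  simp only [timeGenerator, driftExt_of_nonneg β hv0, jumpPart_jumpExt P g hv0]
  rfl

theorem intervalIntegrable_evolution_timeGenerator (hZ : IsAdditiveSubordinator μ Z β g)
    (h : IsCharacteristics β g) (hP : IsContractionSemigroup P) {F L : ℝ → E} (hF : Continuous F)
    (hL : Continuous L) (hFL : ∀ v, GeneratorMaps P (F v) (L v)) (s : ℝ≥0) {a b : ℝ≥0}
    (hab : a ≤ b) :
    IntervalIntegrable (fun v => hZ.evolution hP s v.toNNReal (timeGenerator P β g v (F v) (L v)))
      volume a b := by
  have hle : (a : ℝ) ≤ b := NNReal.coe_le_coe.2 hab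
  obtain ⟨C, hC⟩ := (isCompact_Icc (a := (a : ℝ)) (b := b)).exists_bound_of_continuousOn
    (f := fun v => 2 * ‖F v‖ + ‖L v‖) (by fun_prop)
  rw [intervalIntegrable_iff_integrableOn_Ioc_of_le hle]
  have hdom : IntegrableOn (fun v => C * (β v + 2 * jumpExponent g 1 v)) (Ioc (a : ℝ) b) := by
    rw [← intervalIntegrable_iff_integrableOn_Ioc_of_le hle]
    exact ((h.intervalIntegrable_drift a b).add
      ((hZ.intervalIntegrable_jumpExponent h zero_le_one a b).const_mul 2)).const_mul C
  refine hdom.mono' ?_ ?_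
  · have h1 := h.aestronglyMeasurable_timeGenerator hP hF hL (a := a) (b := b) a.coe_nonneg
    exact hZ.aestronglyMeasurable_evolution hP s h1
  · filter_upwards [ae_restrict_mem measurableSet_Ioc] with v hv
    have hv0 : 0 ≤ v := a.coe_nonneg.trans hv.1.le
    refine (hZ.norm_evolution_apply_le _ _ _ _).trans
      ((h.norm_timeGenerator_le hP (hFL v) hv0).trans ?_)
    have h1 := hC v ⟨hv.1.le, hv.2⟩
    rw [Real.norm_of_nonneg (by positivity)] at h1
    have h2 := h.jumpMass_nonneg hv0
    have h3 := h.drift_nonneg v hv0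
    exact mul_le_mul h1 (by linarith [h.jumpMass_le hv0]) (by linarith)
      ((by positivity : (0 : ℝ) ≤ 2 * ‖F v‖ + ‖L v‖).trans h1)

/-- The integrated Phillips formula along a differentiable family. -/
theorem evolution_family_sub_eq_integral (hZ : IsAdditiveSubordinator μ Z β g)
    (h : IsCharacteristics β g) (hP : IsContractionSemigroup P) {F D L : ℝ → E}
    (hF : Continuous F) (hD : Continuous D) (hL : Continuous L)
    (hFL : ∀ v, GeneratorMaps P (F v) (L v))
    (hFD : ∀ c d, 0 ≤ c → c ≤ d → F d - F c = ∫ v in c..d, D v) {a b : ℝ≥0} (hab : a ≤ b) :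
    hZ.evolution hP a b (F b) - F a = ∫ v in (a : ℝ)..b,
      hZ.evolution hP a v.toNNReal (D v + timeGenerator P β g v (F v) (L v)) := by
  have hle : (a : ℝ) ≤ b := NNReal.coe_le_coe.2 hab
  set R := hZ.evolution hP with hR
  set A : ℝ → E → E → E := timeGenerator P β g with hA
  have hRD : ∀ c : ℝ≥0, Continuous fun w : ℝ => R c w.toNNReal (D w) := fun c =>
    hZ.continuous_evolution_comp hP continuous_const continuous_real_toNNReal hD
  have hiA : ∀ c d : ℝ≥0, c ≤ d → IntervalIntegrable
      (fun w => R a w.toNNReal (A w (F w) (L w))) volume c d := fun c d hcd =>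
    hZ.intervalIntegrable_evolution_timeGenerator h hP hF hL hFL a hcd
  have hiB : ∀ c d : ℝ≥0, c ≤ d → IntervalIntegrable
      (fun w => R a w.toNNReal (D w + A w (F w) (L w))) volume c d := fun c d hcd => by
    simp only [map_add]
    exact ((hRD a).intervalIntegrable _ _).add (hiA c d hcd)
  have hρ : ∀ c d : ℝ≥0, IntervalIntegrable
      (fun v => 1 + (β v + 2 * jumpExponent g 1 v)) volume c d := fun c d =>
    intervalIntegrable_const.add ((h.intervalIntegrable_drift c d).add
      ((hZ.intervalIntegrable_jumpExponent h zero_le_one c d).const_mul 2))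
  -- In the density of `M`, the constant `1` absorbs the error in `D` and `β + 2 * jumpExponent g 1`
  -- the error in the generator.
  have main := eq_of_increments_small
    (Φ := fun v : ℝ => R a v.toNNReal (F v) -
      ∫ w in (a : ℝ)..v, R a w.toNNReal (D w + A w (F w) (L w)))
    (M := fun v => ∫ w in (a : ℝ)..v, (1 + (β w + 2 * jumpExponent g 1 w))) hle ?_
  · simp only [Real.toNNReal_coe, intervalIntegral.integral_same, sub_zero] at main
    rw [hR, hZ.evolution_self hP] at main
    rw [sub_eq_iff_eq_add] at main ⊢
    rw [hR, main, add_comm]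
  intro ε hε
  -- One quarter is spent on `D`; the other three come from the factor `2‖F d - F w‖ + ‖L d - L w‖`
  -- in the generator bound.
  have hη : 0 < ε / 4 := by positivity
  have hK : IsCompact (Icc (a : ℝ) b) := isCompact_Icc
  obtain ⟨δ₁, hδ₁, h₁⟩ := Metric.uniformContinuousOn_iff.1
    (hK.uniformContinuousOn_of_continuous hF.continuousOn) _ hη
  obtain ⟨δ₂, hδ₂, h₂⟩ := Metric.uniformContinuousOn_iff.1
    (hK.uniformContinuousOn_of_continuous hL.continuousOn) _ hη
  have hRc : Continuous fun q : ℝ × ℝ => R a q.1.toNNReal (D q.2) :=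
    hZ.continuous_evolution_comp hP continuous_const
      (continuous_real_toNNReal.comp continuous_fst) (hD.comp continuous_snd)
  obtain ⟨δ₃, hδ₃, h₃⟩ := Metric.uniformContinuousOn_iff.1
    ((hK.prod hK).uniformContinuousOn_of_continuous hRc.continuousOn) _ hη
  refine ⟨min δ₁ (min δ₂ δ₃), lt_min hδ₁ (lt_min hδ₂ hδ₃), fun c' d' hc' hcd' hd' hdc' => ?_⟩
  have hc0 : 0 ≤ c' := a.coe_nonneg.trans hc'
  lift c' to ℝ≥0 using hc0 with c
  lift d' to ℝ≥0 using (c.coe_nonneg.trans hcd') with d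
  have hac : a ≤ c := NNReal.coe_le_coe.1 hc'
  have hcd : c ≤ d := NNReal.coe_le_coe.1 hcd'
  have hdb : d ≤ b := NNReal.coe_le_coe.1 hd'
  have hcm : (c : ℝ) ∈ Icc (a : ℝ) b := ⟨hc', hcd'.trans hd'⟩
  have hdm : (d : ℝ) ∈ Icc (a : ℝ) b := ⟨hc'.trans hcd', hd'⟩
  simp only [Real.toNNReal_coe]
  -- The family is frozen at the right endpoint: `F d - F c` is moved by `R a c`, and the Phillips
  -- formula is applied to the constant vector `F d` over `[c,d]`.
  have e1 : R a d (F d) - R a c (F c) =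
      (∫ w in (c : ℝ)..d, R a c (D w)) +
        ∫ w in (c : ℝ)..d, R a w.toNNReal (A w (F d) (L d)) := by
    have p1 : R a c (∫ w in (c : ℝ)..d, D w) = ∫ w in (c : ℝ)..d, R a c (D w) :=
      ((R a c).intervalIntegral_comp_comm (hD.intervalIntegrable _ _)).symm
    have p2 : R a c (R c d (F d) - F d) =
        ∫ w in (c : ℝ)..d, R a w.toNNReal (A w (F d) (L d)) := by
      rw [hR, hZ.evolution_sub_eq_integral h hP (hFL d) hcd,
        ← ContinuousLinearMap.intervalIntegral_comp_comm _
          (hZ.intervalIntegrable_evolution_timeGenerator h hP continuous_const continuous_const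
            (fun _ => hFL d) c hcd)]
      refine intervalIntegral.integral_congr fun w hw => ?_
      rw [uIcc_of_le hcd'] at hw
      exact hZ.evolution_comp hP hac (NNReal.le_toNNReal_of_coe_le hw.1) _
    rw [← p1, ← p2, ← hFD c d c.coe_nonneg hcd', ← map_add, ← hZ.evolution_comp hP hac hcd,
      ← map_sub]
    congr 1; abel
  have e2 : (∫ w in (a : ℝ)..d, R a w.toNNReal (D w + A w (F w) (L w))) -
      ∫ w in (a : ℝ)..c, R a w.toNNReal (D w + A w (F w) (L w)) =
      ∫ w in (c : ℝ)..d, R a w.toNNReal (D w + A w (F w) (L w)) :=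
    intervalIntegral.integral_interval_sub_left (hiB a d (hac.trans hcd)) (hiB a c hac)
  have e3 : (∫ w in (a : ℝ)..d, (1 + (β w + 2 * jumpExponent g 1 w))) -
      ∫ w in (a : ℝ)..c, (1 + (β w + 2 * jumpExponent g 1 w)) =
      ∫ w in (c : ℝ)..d, (1 + (β w + 2 * jumpExponent g 1 w)) :=
    intervalIntegral.integral_interval_sub_left (hρ a d) (hρ a c)
  have hiC : IntervalIntegrable (fun w => R a w.toNNReal (A w (F d) (L d))) volume c d :=
    hZ.intervalIntegrable_evolution_timeGenerator h hP continuous_const continuous_const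
      (fun _ => hFL d) a hcd
  have hiD : IntervalIntegrable (fun w => R a c (D w)) volume c d :=
    ((R a c).continuous.comp hD).intervalIntegrable _ _
  have e4 : (R a d (F d) - ∫ w in (a : ℝ)..d, R a w.toNNReal (D w + A w (F w) (L w))) -
      (R a c (F c) - ∫ w in (a : ℝ)..c, R a w.toNNReal (D w + A w (F w) (L w))) =
      ∫ w in (c : ℝ)..d, (R a c (D w) + R a w.toNNReal (A w (F d) (L d)) -
        R a w.toNNReal (D w + A w (F w) (L w))) := by
    rw [intervalIntegral.integral_sub (hiD.add hiC) (hiB c d hcd),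
      intervalIntegral.integral_add hiD hiC, ← e1, ← e2]
    abel
  rw [e4, e3, ← intervalIntegral.integral_const_mul]
  refine intervalIntegral.norm_integral_le_of_norm_le hcd' ?_ ((hρ c d).const_mul ε)
  refine Eventually.of_forall fun w hw => ?_
  have hw0 : 0 ≤ w := c.coe_nonneg.trans hw.1.le
  have hwm : w ∈ Icc (a : ℝ) b := ⟨hc'.trans hw.1.le, hw.2.trans hd'⟩
  have hdw : dist (d : ℝ) w < min δ₁ (min δ₂ δ₃) := by
    rw [Real.dist_eq, abs_of_nonneg (by linarith [hw.2])]
    linarith [hw.1]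
  have hcw : dist (c : ℝ) w < min δ₁ (min δ₂ δ₃) := by
    rw [Real.dist_eq, abs_sub_comm, abs_of_nonneg (by linarith [hw.1])]
    linarith [hw.2]
  have n1 : ‖F d - F w‖ ≤ ε / 4 := by
    rw [← dist_eq_norm]
    exact (h₁ d hdm w hwm (hdw.trans_le (min_le_left _ _))).le
  have n2 : ‖L d - L w‖ ≤ ε / 4 := by
    rw [← dist_eq_norm]
    exact (h₂ d hdm w hwm (hdw.trans_le ((min_le_right _ _).trans (min_le_left _ _)))).le
  have n3 : ‖R a c (D w) - R a w.toNNReal (D w)‖ ≤ ε / 4 := by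
    rw [← dist_eq_norm]
    have := h₃ (c, w) ⟨hcm, hwm⟩ (w, w) ⟨hwm, hwm⟩ (by
      rw [Prod.dist_eq, dist_self, max_eq_left dist_nonneg]
      exact hcw.trans_le ((min_le_right _ _).trans (min_le_right _ _)))
    simp only [Real.toNNReal_coe] at this
    exact this.le
  have n4 : ‖R a w.toNNReal (A w (F d - F w) (L d - L w))‖ ≤
      (3 * (ε / 4)) * (β w + 2 * jumpExponent g 1 w) := by
    refine (hZ.norm_evolution_apply_le hP _ _ _).trans
      ((h.norm_timeGenerator_le hP ((hFL d).sub (hFL w)) hw0).trans ?_)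
    have h2 := h.jumpMass_nonneg hw0
    have h3 := h.drift_nonneg w hw0
    exact mul_le_mul (by linarith) (by linarith [h.jumpMass_le hw0]) (by linarith) (by positivity)
  have e5 : R a c (D w) + R a w.toNNReal (A w (F d) (L d)) -
      R a w.toNNReal (D w + A w (F w) (L w)) =
      (R a c (D w) - R a w.toNNReal (D w)) +
        R a w.toNNReal (A w (F d - F w) (L d - L w)) := by
    rw [hA, h.timeGenerator_sub hP (hFL d) (hFL w) hw0, map_sub, map_add]; abel
  rw [e5]
  refine (norm_add_le _ _).trans ((add_le_add n3 n4).trans ?_)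
  have h2 := h.jumpExponent_nonneg (ε := 1) hw0 zero_le_one
  have h3 := h.drift_nonneg w hw0
  have h4 : 0 ≤ ε * (β w + 2 * jumpExponent g 1 w) := by positivity
  nlinarith

end IsAdditiveSubordinator

/-! ### The generator of the space-time semigroup -/

/-- Scheffé's lemma along a filter. -/
theorem tendsto_integral_abs_sub_of_tendsto {α ι : Type*} [MeasurableSpace α] {ν : Measure α}
    {l : Filter ι} [l.IsCountablyGenerated] {p : ι → α → ℝ} {q : α → ℝ}
    (hp : ∀ᶠ i in l, Integrable (p i) ν) (hq : Integrable q ν)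
    (hp0 : ∀ᶠ i in l, ∀ᵐ x ∂ν, 0 ≤ p i x) (hq0 : ∀ᵐ x ∂ν, 0 ≤ q x)
    (hlim : ∀ᵐ x ∂ν, Tendsto (fun i => p i x) l (𝓝 (q x)))
    (hint : Tendsto (fun i => ∫ x, p i x ∂ν) l (𝓝 (∫ x, q x ∂ν))) :
    Tendsto (fun i => ∫ x, |p i x - q x| ∂ν) l (𝓝 0) := by
  -- `|p - q| = (p - q) + 2 (q - p)⁺`. The first term is handled by convergence of the integrals,
  -- the second by dominated convergence, since `0 ≤ (q - p)⁺ ≤ q`.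
  have h1 : Tendsto (fun i => ∫ x, max (q x - p i x) 0 ∂ν) l (𝓝 (∫ _, (0 : ℝ) ∂ν)) := by
    refine tendsto_integral_filter_of_dominated_convergence q ?_ ?_ hq ?_
    · filter_upwards [hp] with i hi
      exact (hq.sub hi).pos_part.aestronglyMeasurable
    · filter_upwards [hp0] with i hi
      filter_upwards [hi, hq0] with x h1 h2
      rw [Real.norm_of_nonneg (le_max_right _ _)]
      exact max_le (by linarith) h2
    · filter_upwards [hlim] with x hx
      have := (hx.const_sub (q x)).max (tendsto_const_nhds (x := (0 : ℝ)))
      simpa using this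
  have h2 := (hint.sub_const (∫ x, q x ∂ν)).add (h1.const_mul 2)
  simp only [integral_zero, sub_self, mul_zero, add_zero] at h2
  refine h2.congr' ?_
  filter_upwards [hp] with i hi
  have hA : Integrable (fun x => p i x - q x) ν := hi.sub hq
  have hB : Integrable (fun x => 2 * max (q x - p i x) 0) ν :=
    (hq.sub hi).pos_part.const_mul 2
  rw [← integral_sub hi hq, ← integral_const_mul, ← integral_add hA hB]
  congr 1; ext1 x
  rcases le_total (p i x) (q x) with h | h
  · rw [abs_of_nonpos (by linarith), max_eq_left (by linarith)]; ring
  · rw [abs_of_nonneg (by linarith), max_eq_right (by linarith)]; ring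

theorem norm_average_sub_le {E : Type*} [NormedAddCommGroup E] [NormedSpace ℝ E]
    [CompleteSpace E] {A : ℝ → E} {s t : ℝ} (hA : IntervalIntegrable A volume s (s + t))
    (ht : 0 < t) {c : E} {ε : ℝ} (h : ∀ v ∈ Ioc s (s + t), ‖A v - c‖ ≤ ε) :
    ‖t⁻¹ • (∫ v in s..(s + t), A v) - c‖ ≤ ε := by
  have e : t⁻¹ • (∫ v in s..(s + t), A v) - c = t⁻¹ • ∫ v in s..(s + t), (A v - c) := by
    rw [intervalIntegral.integral_sub hA intervalIntegrable_const,
      intervalIntegral.integral_const, smul_sub, smul_smul, add_sub_cancel_left,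
      inv_mul_cancel₀ ht.ne', one_smul]
  have hb := intervalIntegral.norm_integral_le_of_norm_le_const (a := s) (b := s + t)
    (f := fun v => A v - c) (C := ε) (by rwa [uIoc_of_le (by linarith)])
  rw [add_sub_cancel_left, abs_of_pos ht, mul_comm] at hb
  rwa [e, norm_smul, norm_inv, Real.norm_of_nonneg ht.le, inv_mul_le_iff₀ ht]

theorem IsAdditiveSubordinator.continuousOn_evolution_comp {E : Type*} [NormedAddCommGroup E]
    [NormedSpace ℝ E] {P : ℝ≥0 → E →L[ℝ] E} {Ω : Type*} [MeasurableSpace Ω] {μ : Measure Ω}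
    [IsProbabilityMeasure μ] {Z : ℝ≥0 → Ω → ℝ≥0} {β : ℝ → ℝ} {g : ℝ → ℝ → ℝ}
    (hZ : IsAdditiveSubordinator μ Z β g) (hP : IsContractionSemigroup P) {s : ℝ≥0} {A : ℝ → E}
    {U : Set ℝ} (hA : ContinuousOn A U) :
    ContinuousOn (fun v : ℝ => hZ.evolution hP s v.toNNReal (A v)) U :=
  (hZ.continuous_evolution hP).comp_continuousOn (f := fun v : ℝ => ((s, v.toNNReal), A v))
    ((continuous_const.prodMk continuous_real_toNNReal).continuousOn.prodMk hA)

/-! ### Norm continuity in time of the generators -/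

section Continuity

variable {β : ℝ → ℝ} {g : ℝ → ℝ → ℝ} {E : Type*} [NormedAddCommGroup E] [NormedSpace ℝ E]
  [CompleteSpace E] {P : ℝ≥0 → E →L[ℝ] E}

theorem IsCharacteristics.norm_jumpPart_sub_le (h : IsCharacteristics β g)
    (hP : IsContractionSemigroup P) {e k : E} (hk : GeneratorMaps P e k) {v w : ℝ} (hv : 0 ≤ v)
    (hw : 0 ≤ w) : ‖jumpPart P g v e - jumpPart P g w e‖ ≤
      (2 * ‖e‖ + ‖k‖) * ∫ r in Ioi (0 : ℝ), |min 1 r * g v r - min 1 r * g w r| := by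
  rw [jumpPart, jumpPart, ← integral_sub (h.integrableOn_jump_smul hP hk hv)
    (h.integrableOn_jump_smul hP hk hw), ← integral_const_mul]
  refine norm_integral_le_of_norm_le
    (((h.jump_int v hv).sub (h.jump_int w hw)).abs.const_mul _) ?_
  filter_upwards [ae_restrict_mem measurableSet_Ioi] with r hr
  have hr0 : (0 : ℝ) < r := hr
  have h1 := hP.norm_apply_sub_le_min hk r.toNNReal
  rw [Real.coe_toNNReal r hr0.le] at h1
  rw [← sub_smul, norm_smul, Real.norm_eq_abs, ← mul_sub, abs_mul,
    abs_of_nonneg (le_min zero_le_one hr0.le)]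
  calc |g v r - g w r| * ‖P r.toNNReal e - e‖
      ≤ |g v r - g w r| * ((2 * ‖e‖ + ‖k‖) * min 1 r) := by gcongr
    _ = _ := by ring

/-- Here the continuity of `m` enters: with pointwise continuity of `g` in time, Scheffé's lemma
makes `(1 ∧ r) g(v,r)` continuous in `L¹(dr)` as a function of `v`. -/
theorem IsCharacteristics.continuousOn_timeGenerator (h : IsCharacteristics β g)
    (hm : ContinuousOn (jumpMass g) (Ici 0)) (hP : IsContractionSemigroup P) {F L : ℝ → E}
    (hF : Continuous F) (hL : Continuous L) (hFL : ∀ v, GeneratorMaps P (F v) (L v)) :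
    ContinuousOn (fun v => timeGenerator P β g v (F v) (L v)) (Ici 0) := by
  refine (h.drift_cont.smul hL.continuousOn).add ?_
  intro v₀ hv₀
  have hv₀' : (0 : ℝ) ≤ v₀ := hv₀
  have hS : Tendsto (fun v => ∫ r in Ioi (0 : ℝ), |min 1 r * g v r - min 1 r * g v₀ r|)
      (𝓝[Ici 0] v₀) (𝓝 0) := by
    refine tendsto_integral_abs_sub_of_tendsto ?_ (h.jump_int v₀ hv₀') ?_ ?_ ?_ (hm v₀ hv₀)
    · filter_upwards [self_mem_nhdsWithin] with v hv using h.jump_int v hv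
    · filter_upwards [self_mem_nhdsWithin] with v hv
      filter_upwards [ae_restrict_mem measurableSet_Ioi] with r hr
      exact mul_nonneg (le_min zero_le_one (le_of_lt hr)) (h.jump_nonneg v r hv hr)
    · filter_upwards [ae_restrict_mem measurableSet_Ioi] with r hr
      exact mul_nonneg (le_min zero_le_one (le_of_lt hr)) (h.jump_nonneg v₀ r hv₀' hr)
    · filter_upwards [ae_restrict_mem measurableSet_Ioi] with r hr
      have hc : ContinuousOn (fun v => g v r) (Ici 0) :=
        h.jump_cont.comp (f := fun v : ℝ => (v, r)) (by fun_prop) fun v hv => ⟨hv, hr⟩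
      exact (hc v₀ hv₀).tendsto.const_mul _
  rw [ContinuousWithinAt, tendsto_iff_norm_sub_tendsto_zero]
  have hN : Tendsto (fun v => (2 * ‖F v - F v₀‖ + ‖L v - L v₀‖) * jumpMass g v +
      (2 * ‖F v₀‖ + ‖L v₀‖) * ∫ r in Ioi (0 : ℝ), |min 1 r * g v r - min 1 r * g v₀ r|)
      (𝓝[Ici 0] v₀) (𝓝 0) := by
    have h1 : Tendsto (fun v => 2 * ‖F v - F v₀‖ + ‖L v - L v₀‖) (𝓝[Ici 0] v₀) (𝓝 0) := by
      have hc : Continuous fun v => 2 * ‖F v - F v₀‖ + ‖L v - L v₀‖ := by fun_prop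
      simpa using (hc.tendsto v₀).mono_left (nhdsWithin_le_nhds (s := Ici 0))
    simpa using (h1.mul (hm v₀ hv₀).tendsto).add (hS.const_mul (2 * ‖F v₀‖ + ‖L v₀‖))
  refine squeeze_zero' (Eventually.of_forall fun _ => norm_nonneg _) ?_ hN
  filter_upwards [self_mem_nhdsWithin] with v hv
  have e1 : jumpPart P g v (F v) - jumpPart P g v₀ (F v₀) =
      jumpPart P g v (F v - F v₀) + (jumpPart P g v (F v₀) - jumpPart P g v₀ (F v₀)) := by
    rw [h.jumpPart_sub hP (hFL v) (hFL v₀) hv]; abel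
  rw [e1]
  exact (norm_add_le _ _).trans (add_le_add (h.norm_jumpPart_le hP ((hFL v).sub (hFL v₀)) hv)
    (h.norm_jumpPart_sub_le hP (hFL v₀) hv hv₀'))

end Continuity

/-! ### Regular functions and the formula as a family of slices -/

section Regular

variable {S : Type*} [PseudoMetricSpace S] {P : ℝ≥0 → C₀(S, ℝ) →L[ℝ] C₀(S, ℝ)}
  {β : ℝ → ℝ} {g : ℝ → ℝ → ℝ} {f df Lf : C₀(ℝ≥0 × S, ℝ)}

theorem continuous_slice_toNNReal (f : C₀(ℝ≥0 × S, ℝ)) :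
    Continuous fun v : ℝ => slice f v.toNNReal :=
  (uniformContinuous_slice f).continuous.comp continuous_real_toNNReal

/-- The time derivative is only given pointwise in `x`. Because the slices of `df` are continuous in
norm, the fundamental theorem of calculus holds in `C₀(S)`; it is checked by evaluation at each
point. -/
theorem IsRegularFunction.slice_sub_eq_integral (hf : IsRegularFunction P f df Lf) {c d : ℝ}
    (hc : 0 ≤ c) (hcd : c ≤ d) :
    slice f d.toNNReal - slice f c.toNNReal = ∫ v in c..d, slice df v.toNNReal := by
  ext x
  have hcont := continuous_slice_toNNReal df
  have h1 : (∫ v in c..d, slice df v.toNNReal) x = ∫ v in c..d, df (v.toNNReal, x) :=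
    ((evalCLM x).intervalIntegral_comp_comm (hcont.intervalIntegrable c d)).symm
  rw [h1]
  have h2 := intervalIntegral.integral_eq_sub_of_hasDeriv_right_of_le
    (f := fun v : ℝ => f (v.toNNReal, x)) (f' := fun v : ℝ => df (v.toNNReal, x)) hcd
    (by fun_prop) (fun v hv => ?_) (Continuous.intervalIntegrable (by fun_prop) _ _)
  · exact h2.symm
  · have hv0 : 0 ≤ v := hc.trans hv.1.le
    have h3 := hf.deriv v.toNNReal x
    rw [Real.coe_toNNReal v hv0] at h3
    exact h3.mono fun w hw => hv0.trans (le_of_lt hw)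

/-- The value of the generator on a regular function, as a function of time. -/
def formulaSlice (P : ℝ≥0 → C₀(S, ℝ) →L[ℝ] C₀(S, ℝ)) (β : ℝ → ℝ) (g : ℝ → ℝ → ℝ)
    (f df Lf : C₀(ℝ≥0 × S, ℝ)) (v : ℝ) : C₀(S, ℝ) :=
  slice df v.toNNReal + timeGenerator P β g v (slice f v.toNNReal) (slice Lf v.toNNReal)

theorem IsRegularFunction.integrableOn_jumpIntegrand (hf : IsRegularFunction P f df Lf)
    (h : IsCharacteristics β g) (hP : IsContractionSemigroup P) (s : ℝ≥0) (x : S) :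
    IntegrableOn (jumpIntegrand P g f s x) (Ioi 0) := by
  have h1 := (evalCLM x).integrable_comp (h.integrableOn_jump_smul hP (hf.gen s) s.coe_nonneg)
  refine h1.congr (Eventually.of_forall fun r => ?_)
  simp [jumpIntegrand, mul_comm]

theorem IsRegularFunction.phillipsFormula_eq (hf : IsRegularFunction P f df Lf)
    (h : IsCharacteristics β g) (hP : IsContractionSemigroup P) (s : ℝ≥0) (x : S) :
    phillipsFormula P β g f df Lf s x = formulaSlice P β g f df Lf s x := by
  have h1 : jumpPart P g s (slice f s) x = ∫ r in Ioi (0 : ℝ), jumpIntegrand P g f s x r := by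
    refine ((evalCLM x).integral_comp_comm
      (h.integrableOn_jump_smul hP (hf.gen s) s.coe_nonneg)).symm.trans ?_
    refine integral_congr_ae (Eventually.of_forall fun r => ?_)
    simp [jumpIntegrand, mul_comm]
  rw [phillipsFormula, ← h1, add_assoc, formulaSlice, Real.toNNReal_coe]
  rfl

theorem IsRegularFunction.continuousOn_formulaSlice (hf : IsRegularFunction P f df Lf)
    (h : IsCharacteristics β g) (hm : ContinuousOn (jumpMass g) (Ici 0))
    (hP : IsContractionSemigroup P) : ContinuousOn (formulaSlice P β g f df Lf) (Ici 0) :=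
  (continuous_slice_toNNReal df).continuousOn.add
    (h.continuousOn_timeGenerator hm hP (continuous_slice_toNNReal f)
      (continuous_slice_toNNReal Lf) fun v => hf.gen v.toNNReal)

/-- If the formula vanishes at infinity in time, it is a function in `C₀`. -/
theorem IsRegularFunction.exists_formula (hf : IsRegularFunction P f df Lf)
    (h : IsCharacteristics β g) (hm : ContinuousOn (jumpMass g) (Ici 0))
    (hP : IsContractionSemigroup P)
    (h0 : Tendsto (fun s : ℝ≥0 => formulaSlice P β g f df Lf s) (cocompact ℝ≥0) (𝓝 0)) :
    ∃ G : C₀(ℝ≥0 × S, ℝ), ∀ s x, G (s, x) = phillipsFormula P β g f df Lf s x := by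
  have hc : Continuous fun s : ℝ≥0 => formulaSlice P β g f df Lf s :=
    (hf.continuousOn_formulaSlice h hm hP).comp_continuous NNReal.continuous_coe
      fun s => s.coe_nonneg
  exact ⟨ofSlices _ hc h0, fun s x => by rw [hf.phillipsFormula_eq h hP, ofSlices_apply]⟩

theorem IsRegularFunction.norm_formulaSlice_le (hf : IsRegularFunction P f df Lf)
    (h : IsCharacteristics β g) (hP : IsContractionSemigroup P) (s : ℝ≥0) :
    ‖formulaSlice P β g f df Lf s‖ ≤ ‖slice df s‖ +
      (2 * ‖slice f s‖ + ‖slice Lf s‖) * (β s + jumpMass g s) := by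
  rw [formulaSlice, Real.toNNReal_coe]
  exact (norm_add_le _ _).trans
    (add_le_add le_rfl (h.norm_timeGenerator_le hP (hf.gen s) s.coe_nonneg))

theorem IsRegularFunction.exists_formula_of_bounded (hf : IsRegularFunction P f df Lf)
    (h : IsCharacteristics β g) (hm : ContinuousOn (jumpMass g) (Ici 0))
    (hP : IsContractionSemigroup P) {C : ℝ} (hC : ∀ s, 0 ≤ s → β s ≤ C ∧ jumpMass g s ≤ C) :
    ∃ G : C₀(ℝ≥0 × S, ℝ), ∀ s x, G (s, x) = phillipsFormula P β g f df Lf s x := by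
  refine hf.exists_formula h hm hP (squeeze_zero_norm
    (a := fun s => ‖slice df s‖ + (2 * ‖slice f s‖ + ‖slice Lf s‖) * (C + C)) (fun s => ?_) ?_)
  · refine (hf.norm_formulaSlice_le h hP s).trans ?_
    obtain ⟨h1, h2⟩ := hC s s.coe_nonneg
    gcongr
  · have h1 := (tendsto_slice_cocompact f).norm
    have h2 := (tendsto_slice_cocompact df).norm
    have h3 := (tendsto_slice_cocompact Lf).norm
    simpa using h2.add (((h1.const_mul 2).add h3).mul_const (C + C))

end Regular

namespace IsAdditiveSubordinator

variable {S : Type*} [PseudoMetricSpace S] {P : ℝ≥0 → C₀(S, ℝ) →L[ℝ] C₀(S, ℝ)}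
  {β : ℝ → ℝ} {g : ℝ → ℝ → ℝ} {f df Lf : C₀(ℝ≥0 × S, ℝ)}
  {Ω : Type*} [MeasurableSpace Ω] {μ : Measure Ω} [IsProbabilityMeasure μ] {Z : ℝ≥0 → Ω → ℝ≥0}

theorem slice_spaceTime_sub (hZ : IsAdditiveSubordinator μ Z β g) (h : IsCharacteristics β g)
    (hP : IsContractionSemigroup P) (hf : IsRegularFunction P f df Lf) (t s : ℝ≥0) :
    slice (hZ.spaceTime hP t f - f) s = ∫ v in (s : ℝ)..(s + t),
      hZ.evolution hP s v.toNNReal (formulaSlice P β g f df Lf v) := by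
  have h1 := hZ.evolution_family_sub_eq_integral h hP (continuous_slice_toNNReal f)
    (continuous_slice_toNNReal df) (continuous_slice_toNNReal Lf) (fun v => hf.gen v.toNNReal)
    (fun c d hc hcd => hf.slice_sub_eq_integral hc hcd) (le_self_add : s ≤ s + t)
  simp only [Real.toNNReal_coe] at h1
  rw [slice_sub, slice_spaceTime, h1]
  push_cast
  rfl

/-- The difference quotient at `s` is an average over `v` of `(Q_{v-s} G)_s`. Strong continuity of
`Q` at the single function `G` bounds its distance to `G_s` uniformly in `s`, so no continuity of
`m` is needed. -/
theorem hasGenerator_spaceTime (hZ : IsAdditiveSubordinator μ Z β g) (h : IsCharacteristics β g)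
    (hP : IsContractionSemigroup P) (hf : IsRegularFunction P f df Lf) {G : C₀(ℝ≥0 × S, ℝ)}
    (hG : ∀ s x, G (s, x) = phillipsFormula P β g f df Lf s x) :
    HasGenerator (hZ.spaceTime hP) f G := by
  have hGs : ∀ v : ℝ, 0 ≤ v → formulaSlice P β g f df Lf v = slice G v.toNNReal := by
    intro v hv
    ext x
    rw [slice_apply, hG, hf.phillipsFormula_eq h hP, Real.coe_toNNReal v hv]
  refine Metric.nhds_basis_closedBall.tendsto_right_iff.2 fun ε hε => ?_
  obtain ⟨δ, hδ, hball⟩ := Metric.mem_nhds_iff.1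
    (hZ.tendsto_spaceTime hP G (Metric.closedBall_mem_nhds G hε))
  have hδ' : ∀ᶠ t : ℝ≥0 in 𝓝[>] 0, t ∈ Metric.ball (0 : ℝ≥0) δ ∧ 0 < t := by
    filter_upwards [nhdsWithin_le_nhds (Metric.ball_mem_nhds (0 : ℝ≥0) hδ),
      self_mem_nhdsWithin] with t h1 h2 using ⟨h1, h2⟩
  filter_upwards [hδ'] with t ⟨htδ, ht⟩
  rw [mem_closedBall_iff_norm]
  refine norm_le_of_norm_slice_le fun s => ?_
  have ht' : (0 : ℝ) < t := ht
  have hle : (s : ℝ) ≤ s + t := by linarith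
  rw [slice_sub, slice_smul, hZ.slice_spaceTime_sub h hP hf]
  have hcont : Continuous fun v : ℝ => hZ.evolution hP s v.toNNReal (slice G v.toNNReal) :=
    hZ.continuous_evolution_comp hP continuous_const continuous_real_toNNReal
      (continuous_slice_toNNReal G)
  have e1 : ∫ v in (s : ℝ)..(s + t), hZ.evolution hP s v.toNNReal (formulaSlice P β g f df Lf v) =
      ∫ v in (s : ℝ)..(s + t), hZ.evolution hP s v.toNNReal (slice G v.toNNReal) := by
    refine intervalIntegral.integral_congr fun v hv => ?_
    rw [uIcc_of_le hle] at hv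
    exact congrArg _ (hGs v (s.coe_nonneg.trans hv.1))
  rw [e1]
  refine norm_average_sub_le (hcont.intervalIntegrable _ _) ht' ?_
  · intro v hv
    have hv0 : 0 ≤ v := s.coe_nonneg.trans hv.1.le
    lift v to ℝ≥0 using hv0
    obtain ⟨w, rfl⟩ := exists_add_of_le (NNReal.coe_le_coe.1 hv.1.le)
    have hw : w ≤ t := by
      have := hv.2; push_cast at this
      exact NNReal.coe_le_coe.1 (by linarith)
    rw [Real.toNNReal_coe, ← hZ.slice_spaceTime hP w G s, ← slice_sub]
    refine (norm_slice_le _ _).trans ?_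
    rw [← mem_closedBall_iff_norm]
    refine hball ?_
    rw [Metric.mem_ball, NNReal.dist_eq] at htδ ⊢
    simp only [NNReal.coe_zero, sub_zero, NNReal.abs_eq] at htδ ⊢
    exact lt_of_le_of_lt (NNReal.coe_le_coe.2 hw) htδ

/-- For fixed `s` the integrand is continuous in norm on `[s,∞)`, and its averages converge to the
value at `s`. The convergence need not be uniform in `s`. -/
theorem tendsto_spaceTime_apply (hZ : IsAdditiveSubordinator μ Z β g) (h : IsCharacteristics β g)
    (hm : ContinuousOn (jumpMass g) (Ici 0)) (hP : IsContractionSemigroup P)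
    (hf : IsRegularFunction P f df Lf) (s : ℝ≥0) (x : S) :
    Tendsto (fun t : ℝ≥0 => (t : ℝ)⁻¹ * (hZ.spaceTime hP t f (s, x) - f (s, x))) (𝓝[>] 0)
      (𝓝 (phillipsFormula P β g f df Lf s x)) := by
  have hc : ContinuousOn (fun v : ℝ => hZ.evolution hP s v.toNNReal
      (formulaSlice P β g f df Lf v)) (Ici (s : ℝ)) :=
    hZ.continuousOn_evolution_comp hP
      ((hf.continuousOn_formulaSlice h hm hP).mono (Ici_subset_Ici.2 s.coe_nonneg))
  have h1 := ((evalCLM x).continuous.tendsto _).comp (tendsto_average_nhdsGT hc)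
  rw [Real.toNNReal_coe, hZ.evolution_self hP, evalCLM_apply,
    ← hf.phillipsFormula_eq h hP] at h1
  refine h1.congr fun t => ?_
  rw [Function.comp_apply, ← hZ.slice_spaceTime_sub h hP hf]
  rfl

end IsAdditiveSubordinator

/-! ### Density of the regular functions -/

section Density

theorem tendsto_cocompact_of_eq_zero {E : Type*} [NormedAddCommGroup E] {F : ℝ≥0 → E} {T : ℝ≥0}
    (h : ∀ s, T ≤ s → F s = 0) : Tendsto F (cocompact ℝ≥0) (𝓝 0) := by
  rw [cocompact_eq_atTop]
  refine tendsto_const_nhds.congr' ?_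
  filter_upwards [eventually_ge_atTop T] with s hs using (h s hs).symm

theorem norm_smul_sub_self_le {E : Type*} [NormedAddCommGroup E] [NormedSpace ℝ E] {c : ℝ}
    (h0 : 0 ≤ c) (h1 : c ≤ 1) (e : E) : ‖c • e - e‖ ≤ ‖e‖ := by
  have h2 : c • e - e = (c - 1) • e := by rw [sub_smul, one_smul]
  rw [h2, norm_smul]
  refine mul_le_of_le_one_left (norm_nonneg e) ?_
  rw [Real.norm_eq_abs, abs_le]
  constructor <;> linarith

theorem continuous_smul_apply_sub {T E : Type*} [TopologicalSpace T] [NormedAddCommGroup E]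
    [NormedSpace ℝ E] (A : E →L[ℝ] E) (c : ℝ) {F : T → E} (hF : Continuous F) :
    Continuous fun s => c • (A (F s) - F s) := by fun_prop

/-- Forward averages in time of a continuous function are differentiable. -/
theorem hasDerivAt_forward_average {E : Type*} [NormedAddCommGroup E] [NormedSpace ℝ E]
    [CompleteSpace E] {φ : ℝ → E} (hφ : Continuous φ) (k v : ℝ) :
    HasDerivAt (fun v => k⁻¹ • ∫ w in v..(v + k), φ w) (k⁻¹ • (φ (v + k) - φ v)) v := by
  have h1 : ∀ v, HasDerivAt (fun v => ∫ w in (0 : ℝ)..v, φ w) (φ v) v := fun v =>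
    hφ.integral_hasStrictDerivAt 0 v |>.hasDerivAt
  have h2 := (((h1 (v + k)).comp_add_const v k).sub (h1 v)).const_smul k⁻¹
  convert h2 using 1
  ext1 u
  rw [← intervalIntegral.integral_interval_sub_left (hφ.intervalIntegrable 0 (u + k))
    (hφ.intervalIntegrable 0 u)]
  rfl

variable {S : Type*} [PseudoMetricSpace S] {P : ℝ≥0 → C₀(S, ℝ) →L[ℝ] C₀(S, ℝ)}
  {β : ℝ → ℝ} {g : ℝ → ℝ → ℝ}

/-- Smoothing in space a function that is differentiable in time, with compact support in time,
gives a regular function for which the formula is in `C₀`. -/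
theorem IsCharacteristics.exists_regular_of_hasDerivAt (hc : IsCharacteristics β g)
    (hm : ContinuousOn (jumpMass g) (Ici 0)) (hP : IsContractionSemigroup P)
    {F F' : ℝ → C₀(S, ℝ)} (hF : ∀ v, HasDerivAt F (F' v) v) (hF' : Continuous F') {T : ℝ≥0}
    (hFT : ∀ s : ℝ≥0, T ≤ s → F s = 0) (hFT' : ∀ s : ℝ≥0, T ≤ s → F' s = 0) (h : ℝ≥0) :
    ∃ f : C₀(ℝ≥0 × S, ℝ), (∀ s : ℝ≥0, slice f s = hP.average h (F s)) ∧
      ∃ df Lf G : C₀(ℝ≥0 × S, ℝ), IsRegularFunction P f df Lf ∧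
        ∀ s x, G (s, x) = phillipsFormula P β g f df Lf s x := by
  have hFc : Continuous F := continuous_iff_continuousAt.2 fun v => (hF v).continuousAt
  have hFc' : Continuous fun s : ℝ≥0 => F s := hFc.comp NNReal.continuous_coe
  have z1 : ∀ s : ℝ≥0, T ≤ s → hP.average h (F s) = 0 := fun s hs => by
    rw [hFT s hs, map_zero]
  have z2 : ∀ s : ℝ≥0, T ≤ s → hP.average h (F' s) = 0 := fun s hs => by
    rw [hFT' s hs, map_zero]
  have z3 : ∀ s : ℝ≥0, T ≤ s → (h : ℝ)⁻¹ • (P h (F s) - F s) = 0 := fun s hs => by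
    rw [hFT s hs, map_zero, sub_zero, smul_zero]
  let f : C₀(ℝ≥0 × S, ℝ) := ofSlices (fun s => hP.average h (F s))
    ((hP.average h).continuous.comp hFc') (tendsto_cocompact_of_eq_zero z1)
  let df : C₀(ℝ≥0 × S, ℝ) := ofSlices (fun s => hP.average h (F' s))
    ((hP.average h).continuous.comp (hF'.comp NNReal.continuous_coe))
    (tendsto_cocompact_of_eq_zero z2)
  let Lf : C₀(ℝ≥0 × S, ℝ) := ofSlices (fun s => (h : ℝ)⁻¹ • (P h (F s) - F s))
    (continuous_smul_apply_sub (P h) _ hFc') (tendsto_cocompact_of_eq_zero z3)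
  have hreg : IsRegularFunction P f df Lf := by
    refine ⟨fun s => hP.generatorMaps_average h (F s), fun s x => ?_⟩
    have h1 : HasDerivAt (fun v => evalCLM x (hP.average h (F v)))
        (evalCLM x (hP.average h (F' s))) (s : ℝ) :=
      ((evalCLM x).comp (hP.average h)).hasFDerivAt.comp_hasDerivAt (s : ℝ) (hF s)
    refine h1.hasDerivWithinAt.congr_of_mem (fun v hv => ?_) s.coe_nonneg
    change hP.average h (F (v.toNNReal : ℝ)) x = _
    rw [Real.coe_toNNReal v hv, evalCLM_apply]
  refine ⟨f, fun s => rfl, df, Lf, ?_⟩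
  have hz : ∀ s : ℝ≥0, T ≤ s → formulaSlice P β g f df Lf s = 0 := by
    intro s hs
    have e1 : slice f s = 0 := z1 s hs
    have e2 : slice df s = 0 := z2 s hs
    have e3 : slice Lf s = 0 := z3 s hs
    refine norm_le_zero_iff.1 ((hreg.norm_formulaSlice_le hc hP s).trans ?_)
    rw [e1, e2, e3]
    simp
  obtain ⟨G, hG⟩ := hreg.exists_formula hc hm hP (tendsto_cocompact_of_eq_zero hz)
  exact ⟨G, hreg, hG⟩

/-- Functions with compact support in time are dense. -/
theorem exists_compactSupport_approx (f : C₀(ℝ≥0 × S, ℝ)) {ε : ℝ} (hε : 0 < ε) :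
    ∃ (f₁ : C₀(ℝ≥0 × S, ℝ)) (T : ℝ≥0), ‖f₁ - f‖ ≤ ε ∧ ∀ s, T ≤ s → slice f₁ s = 0 := by
  have h0 := tendsto_slice_cocompact f
  rw [cocompact_eq_atTop] at h0
  obtain ⟨K, hK⟩ := eventually_atTop.1
    (Metric.nhds_basis_closedBall.tendsto_right_iff.1 h0 ε hε)
  -- A piecewise linear cut-off, equal to `1` on `[0,K]` and to `0` from `K + 1` on.
  let χ : ℝ≥0 → ℝ := fun s => max 0 (min 1 (K + 1 - s))
  have hχ : Continuous χ := by fun_prop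
  have hT : ∀ s, K + 1 ≤ s → χ s • slice f s = 0 := by
    intro s hs
    have hs' : (K : ℝ) + 1 ≤ s := by exact_mod_cast hs
    have : χ s = 0 := max_eq_left ((min_le_right _ _).trans (by linarith))
    rw [this, zero_smul]
  refine ⟨ofSlices (fun s => χ s • slice f s)
    (hχ.smul (uniformContinuous_slice f).continuous) (tendsto_cocompact_of_eq_zero hT), K + 1,
    norm_le_of_norm_slice_le fun s => ?_, hT⟩
  rw [slice_sub, slice_ofSlices]
  rcases le_total s K with hs | hs
  · have hs' : (s : ℝ) ≤ K := by exact_mod_cast hs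
    have : χ s = 1 := by
      simp only [χ]
      rw [min_eq_left (by linarith), max_eq_right zero_le_one]
    rw [this, one_smul, sub_self, norm_zero]
    exact hε.le
  · have h1 := hK s hs
    rw [mem_closedBall_zero_iff] at h1
    exact (norm_smul_sub_self_le (le_max_left _ _)
      (max_le zero_le_one (min_le_left _ _)) _).trans h1

/-- Averaging over short orbits is close to the identity, uniformly on compact sets. -/
theorem IsContractionSemigroup.exists_norm_average_sub_le {E : Type*} [NormedAddCommGroup E]
    [NormedSpace ℝ E] [CompleteSpace E] {P : ℝ≥0 → E →L[ℝ] E} (hP : IsContractionSemigroup P)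
    {U : Set E} (hU : IsCompact U) {ε : ℝ} (hε : 0 < ε) :
    ∃ h : ℝ≥0, ∀ e ∈ U, ‖hP.average h e - e‖ ≤ ε := by
  have hc : Continuous fun p : ℝ≥0 × E => ‖P p.1 p.2 - p.2‖ :=
    (hP.continuous_uncurry.sub continuous_snd).norm
  have hev : ∀ᶠ r in 𝓝 (0 : ℝ≥0), ∀ e ∈ U, ‖P r e - e‖ < ε := by
    refine hU.eventually_forall_of_forall_eventually (P := fun r e => ‖P r e - e‖ < ε) ?_
    intro e _
    refine (hc.tendsto (0, e)).eventually (gt_mem_nhds ?_)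
    simpa [hP.zero_apply] using hε
  obtain ⟨δ, hδ, hball⟩ := Metric.eventually_nhds_iff.1 hev
  refine ⟨(δ / 2).toNNReal, fun e he => ?_⟩
  have hδ2 : 0 < δ / 2 := half_pos hδ
  have h1 := norm_average_sub_le (A := fun r : ℝ => P r.toNNReal e) (s := 0) (t := δ / 2)
    ((hP.continuous_toNNReal e).intervalIntegrable _ _) hδ2 (c := e) (ε := ε) ?_
  · rw [zero_add] at h1
    rwa [hP.average_apply, Real.coe_toNNReal _ hδ2.le]
  · intro v hv
    refine (hball ?_ e he).le
    rw [NNReal.dist_eq, Real.coe_toNNReal v hv.1.le, NNReal.coe_zero, sub_zero,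
      abs_of_pos hv.1]
    linarith [hv.2]

/-- A cut-off in time, an average in time and an average along the orbits of `P` produce functions
smooth in both variables. Compact support in time makes one orbit length `h` work for all `s`, and
makes the formula vanish at large times however fast `β` and `m` grow. -/
theorem IsCharacteristics.dense_regular (hc : IsCharacteristics β g)
    (hm : ContinuousOn (jumpMass g) (Ici 0)) (hP : IsContractionSemigroup P) :
    Dense {f : C₀(ℝ≥0 × S, ℝ) | ∃ df Lf G : C₀(ℝ≥0 × S, ℝ), IsRegularFunction P f df Lf ∧
      ∀ s x, G (s, x) = phillipsFormula P β g f df Lf s x} := by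
  refine Metric.dense_iff.2 fun f₀ ε hε => ?_
  have hε4 : 0 < ε / 4 := by positivity
  obtain ⟨f₁, T, hf₁, hT⟩ := exists_compactSupport_approx f₀ hε4
  obtain ⟨δ, hδ, hunif⟩ := Metric.uniformContinuous_iff.1 (uniformContinuous_slice f₁) _ hε4
  let k := δ / 2
  have hk : 0 < k := half_pos hδ
  let φ : ℝ → C₀(S, ℝ) := fun w => slice f₁ w.toNNReal
  have hφ : Continuous φ := continuous_slice_toNNReal f₁
  have hφT : ∀ w : ℝ, (T : ℝ) ≤ w → φ w = 0 := fun w hw =>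
    hT _ (NNReal.le_toNNReal_of_coe_le hw)
  -- Averaging forward keeps the support in `[0,T]` and, for `s ≥ 0`, never looks at negative times.
  let F : ℝ → C₀(S, ℝ) := fun v => k⁻¹ • ∫ w in v..(v + k), φ w
  have hF : ∀ v, HasDerivAt F (k⁻¹ • (φ (v + k) - φ v)) v :=
    hasDerivAt_forward_average hφ k
  have hFc : Continuous F := continuous_iff_continuousAt.2 fun v => (hF v).continuousAt
  have hFT : ∀ s : ℝ≥0, T ≤ s → F s = 0 := by
    intro s hs
    have hs' : (T : ℝ) ≤ s := by exact_mod_cast hs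
    have : ∫ w in (s : ℝ)..(s + k), φ w = ∫ w in (s : ℝ)..(s + k), (0 : C₀(S, ℝ)) :=
      intervalIntegral.integral_congr fun w hw => by
        rw [uIcc_of_le (by linarith)] at hw
        exact hφT w (hs'.trans hw.1)
    simp only [F]
    rw [this, intervalIntegral.integral_zero, smul_zero]
  have hFT' : ∀ s : ℝ≥0, T ≤ s → k⁻¹ • (φ (s + k) - φ s) = 0 := by
    intro s hs
    have hs' : (T : ℝ) ≤ s := by exact_mod_cast hs
    rw [hφT _ hs', hφT _ (by linarith), sub_zero, smul_zero]
  have hFφ : ∀ s : ℝ≥0, ‖F s - slice f₁ s‖ ≤ ε / 4 := by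
    intro s
    refine norm_average_sub_le (hφ.intervalIntegrable _ _) hk fun v hv => ?_
    have hv0 : 0 ≤ v := s.coe_nonneg.trans hv.1.le
    rw [← dist_eq_norm]
    refine (hunif ?_).le
    rw [NNReal.dist_eq, Real.coe_toNNReal v hv0, abs_of_pos (by linarith [hv.1])]
    have : v ≤ s + δ / 2 := hv.2
    linarith
  obtain ⟨h, hh⟩ := hP.exists_norm_average_sub_le
    ((isCompact_Icc (a := (0 : ℝ)) (b := T)).image hFc) hε4
  obtain ⟨f, hf, hreg⟩ := hc.exists_regular_of_hasDerivAt hm hP hF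
    (((hφ.comp (continuous_add_const k)).sub hφ).const_smul k⁻¹) hFT hFT' h
  refine ⟨f, ?_, hreg⟩
  have hff₁ : ‖f - f₁‖ ≤ ε / 4 + ε / 4 := by
    refine norm_le_of_norm_slice_le fun s => ?_
    have e : slice (f - f₁) s = (hP.average h (F s) - F s) + (F s - slice f₁ s) := by
      rw [slice_sub, hf]; abel
    rw [e]
    refine (norm_add_le _ _).trans (add_le_add ?_ (hFφ s))
    rcases le_total s T with hs | hs
    · exact hh _ ⟨s, ⟨s.coe_nonneg, by exact_mod_cast hs⟩, rfl⟩
    · rw [hFT s hs, map_zero, sub_zero, norm_zero]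
      exact hε4.le
  rw [mem_ball_iff_norm]
  calc ‖f - f₀‖ = ‖(f - f₁) + (f₁ - f₀)‖ := by rw [sub_add_sub_cancel]
    _ ≤ (ε / 4 + ε / 4) + ε / 4 := (norm_add_le _ _).trans (add_le_add hff₁ hf₁)
    _ < ε := by linarith

end Density

/-! ### Paths of the time-changed process -/

section Cadlag

variable {S : Type*} [TopologicalSpace S]

theorem IsCadlag.comp_add {γ : ℝ≥0 → S} (h : IsCadlag γ) (d : ℝ≥0) :
    IsCadlag fun t => γ (d + t) := by
  intro t
  have hc : Continuous fun t : ℝ≥0 => d + t := by fun_prop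
  refine ⟨((h (d + t)).1).comp hc.continuousWithinAt fun s hs => add_le_add_right hs d, ?_⟩
  obtain ⟨y, hy⟩ := (h (d + t)).2
  refine ⟨y, hy.comp (tendsto_nhdsWithin_of_tendsto_nhds_of_eventually_within _
    ((hc.tendsto t).mono_left nhdsWithin_le_nhds) ?_)⟩
  filter_upwards [self_mem_nhdsWithin] with s hs using add_lt_add_right hs d

/-- Let `ℓ` be the left limit of `z` at `t`. Either `z` reaches `ℓ` before `t`, and the composition
is eventually constant, or `z` stays strictly below `ℓ`, and the left limit of `γ` at `ℓ` applies.
Monotonicity excludes any other approach. -/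
theorem IsCadlag.comp_monotone {γ : ℝ≥0 → S} (hγ : IsCadlag γ) {z : ℝ≥0 → ℝ≥0}
    (hz : IsCadlag z) (hmono : Monotone z) : IsCadlag fun t => γ (z t) := by
  intro t
  refine ⟨((hγ (z t)).1).comp (hz t).1 fun s hs => hmono hs, ?_⟩
  obtain ⟨ℓ, hℓ⟩ := (hz t).2
  have hle : ∀ s < t, z s ≤ ℓ := by
    intro s hs
    have := nhdsLT_neBot_of_exists_lt ⟨s, hs⟩
    refine ge_of_tendsto hℓ ?_
    filter_upwards [nhdsWithin_le_nhds (lt_mem_nhds hs)] with u hu using hmono hu.le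
  by_cases hex : ∃ s < t, z s = ℓ
  · obtain ⟨s, hs, hsℓ⟩ := hex
    refine ⟨γ ℓ, tendsto_const_nhds.congr' ?_⟩
    filter_upwards [nhdsWithin_le_nhds (lt_mem_nhds hs), self_mem_nhdsWithin] with u hu hut
    rw [le_antisymm (hle u hut) (hsℓ ▸ hmono hu.le)]
  · obtain ⟨y, hy⟩ := (hγ ℓ).2
    refine ⟨y, hy.comp (tendsto_nhdsWithin_of_tendsto_nhds_of_eventually_within _ hℓ ?_)⟩
    filter_upwards [self_mem_nhdsWithin] with u hu
    exact lt_of_le_of_ne (hle u hu) fun h => hex ⟨u, hu, h⟩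

theorem isCadlag_timeChanged {Ω : Type*} {X : ℝ≥0 → Ω → S} {Z : ℝ≥0 → Ω → ℝ≥0} {ω : Ω}
    (hX : IsCadlag fun t => X t ω) (hZ : IsCadlag fun t => Z t ω)
    (hmono : Monotone fun t => Z t ω) (d : ℝ≥0) : IsCadlag fun t => timeChanged X Z d t ω := by
  have hY : IsCadlag fun t => X (Z (d + t) ω) ω :=
    hX.comp_monotone (hZ.comp_add d) fun s t hst => hmono (add_le_add_right hst d)
  have hc : Continuous fun t : ℝ≥0 => d + t := by fun_prop
  intro t
  refine ⟨hc.continuousWithinAt.prodMk (hY t).1, ?_⟩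
  obtain ⟨y, hy⟩ := (hY t).2
  exact ⟨(d + t, y), ((hc.tendsto t).mono_left nhdsWithin_le_nhds).prodMk_nhds hy⟩

end Cadlag

/-! ### The Markov property of the time-changed process -/

section Markov

/-- The σ-algebras on the targets are free, so that `a` and `b` may be the identity into `Ω` with a
coarser σ-algebra. -/
theorem integral_comp_of_indepFun {Ω Ω₁ Ω₂ : Type*} {m : MeasurableSpace Ω}
    {m₁ : MeasurableSpace Ω₁} {m₂ : MeasurableSpace Ω₂} {μ : Measure Ω} [IsProbabilityMeasure μ]
    {a : Ω → Ω₁} {b : Ω → Ω₂} (ha : Measurable a) (hb : Measurable b) (hab : IndepFun a b μ)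
    {H : Ω₁ × Ω₂ → ℝ} (hH : Measurable H) {C : ℝ} (hC : ∀ p, ‖H p‖ ≤ C) :
    ∫ ω, H (a ω, b ω) ∂μ = ∫ ω, ∫ ω', H (a ω, b ω') ∂μ ∂μ := by
  have hprod := (indepFun_iff_map_prod_eq_prod_map_map ha.aemeasurable hb.aemeasurable).1 hab
  have := Measure.isProbabilityMeasure_map (μ := μ) ha.aemeasurable
  have := Measure.isProbabilityMeasure_map (μ := μ) hb.aemeasurable
  have hsm := hH.stronglyMeasurable
  have hint : Integrable H ((μ.map a).prod (μ.map b)) :=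
    Integrable.of_bound (C := C) hsm.aestronglyMeasurable (Eventually.of_forall hC)
  rw [← integral_map (φ := fun ω => (a ω, b ω)) (f := H) (ha.prodMk hb).aemeasurable
    hsm.aestronglyMeasurable, hprod, integral_prod _ hint,
    integral_map ha.aemeasurable hsm.integral_prod_right'.aestronglyMeasurable]
  refine integral_congr_ae (Eventually.of_forall fun ω => ?_)
  exact integral_map (f := fun y => H (a ω, y)) hb.aemeasurable
    (hH.comp measurable_prodMk_left).stronglyMeasurable.aestronglyMeasurable

theorem integral_comp_of_indepFun_symm {Ω Ω₁ Ω₂ : Type*} {m : MeasurableSpace Ω}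
    {m₁ : MeasurableSpace Ω₁} {m₂ : MeasurableSpace Ω₂} {μ : Measure Ω} [IsProbabilityMeasure μ]
    {a : Ω → Ω₁} {b : Ω → Ω₂} (ha : Measurable a) (hb : Measurable b) (hab : IndepFun a b μ)
    {H : Ω₁ × Ω₂ → ℝ} (hH : Measurable H) {C : ℝ} (hC : ∀ p, ‖H p‖ ≤ C) :
    ∫ ω, H (a ω, b ω) ∂μ = ∫ ω', ∫ ω, H (a ω, b ω') ∂μ ∂μ :=
  integral_comp_of_indepFun (H := fun p => H p.swap) hb ha hab.symm (hH.comp measurable_swap)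
    fun p => hC p.swap

theorem indepFun_id_left {Ω Ω' : Type*} {m' : MeasurableSpace Ω'} {m₁ m : MeasurableSpace Ω}
    {μ : Measure Ω} {b : Ω → Ω'} (h : Indep m₁ (MeasurableSpace.comap b m') μ) :
    @IndepFun Ω Ω Ω' m m₁ m' id b μ :=
  (@IndepFun_iff_Indep Ω Ω Ω' m m₁ m' id b μ).2 (by rwa [MeasurableSpace.comap_id])

theorem pastσ_le {Ω S : Type*} [m : MeasurableSpace Ω] [MeasurableSpace S] {X : ℝ≥0 → Ω → S}
    (hX : ∀ t, Measurable (X t)) (s : ℝ≥0) : pastσ X s ≤ m :=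
  iSup₂_le fun l _ => (hX l).comap_le

theorem measurable_pastσ {Ω S : Type*} [MeasurableSpace S] (X : ℝ≥0 → Ω → S) {l s : ℝ≥0}
    (hl : l ≤ s) : Measurable[pastσ X s] (X l) :=
  Measurable.mono (comap_measurable (X l))
    (le_iSup₂ (f := fun l (_ : l ≤ s) => MeasurableSpace.comap (X l) _) l hl) le_rfl

theorem measurable_into_pastσ {Ω Ω' S : Type*} {m : MeasurableSpace Ω'} [MeasurableSpace S]
    {X : ℝ≥0 → Ω → S} {s : ℝ≥0} {φ : Ω' → Ω} (h : ∀ l ≤ s, Measurable fun ω => X l (φ ω)) :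
    Measurable[m, pastσ X s] φ := by
  rw [measurable_iff_comap_le]
  simp only [MeasurableSpace.comap_iSup, MeasurableSpace.comap_comp]
  exact iSup₂_le fun l hl => (h l hl).comap_le

theorem pastσ_comp {Ω Ω' S : Type*} [MeasurableSpace S] (X : ℝ≥0 → Ω → S) (φ : Ω' → Ω)
    (s : ℝ≥0) : pastσ (fun t ω => X t (φ ω)) s = MeasurableSpace.comap φ (pastσ X s) := by
  simp only [pastσ, MeasurableSpace.comap_iSup, MeasurableSpace.comap_comp]
  rfl

theorem integrable_zeroAtInfty_comp {Ω S : Type*} [MeasurableSpace Ω] [TopologicalSpace S]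
    [MeasurableSpace S] [OpensMeasurableSpace S] {μ : Measure Ω} [IsFiniteMeasure μ] {V : Ω → S}
    (hV : Measurable V) (f : C₀(S, ℝ)) : Integrable (fun ω => f (V ω)) μ :=
  Integrable.of_bound (C := ‖f‖)
    (f.continuous.measurable.comp hV).stronglyMeasurable.aestronglyMeasurable
    (Eventually.of_forall fun _ => norm_zeroAtInfty_apply_le f _)

theorem IsFellerProcess.setIntegral_eq {Ω S : Type*} [MeasurableSpace Ω] [TopologicalSpace S]
    [MeasurableSpace S] [OpensMeasurableSpace S] {μ : Measure Ω} [IsProbabilityMeasure μ]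
    {X : ℝ≥0 → Ω → S} {P : ℝ≥0 → C₀(S, ℝ) →L[ℝ] C₀(S, ℝ)} (hX : IsFellerProcess μ X P)
    (s t : ℝ≥0) (f : C₀(S, ℝ)) {A : Set Ω} (hA : MeasurableSet[pastσ X s] A) :
    ∫ ω in A, f (X (s + t) ω) ∂μ = ∫ ω in A, P t f (X s ω) ∂μ := by
  have hle := pastσ_le hX.measurable s
  rw [← setIntegral_condExp hle (integrable_zeroAtInfty_comp (hX.measurable _) f) hA]
  exact setIntegral_congr_ae (hle _ hA) ((hX.markov s t f).mono fun _ h _ => h)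

theorem condExp_ae_eq_of_setIntegral_eq {Ω S : Type*} [MeasurableSpace Ω] [TopologicalSpace S]
    [MeasurableSpace S] [OpensMeasurableSpace S] {μ : Measure Ω} [IsProbabilityMeasure μ]
    {X : ℝ≥0 → Ω → S} (hX : ∀ t, Measurable (X t)) {s t : ℝ≥0} {f h : C₀(S, ℝ)}
    (H : ∀ A, MeasurableSet[pastσ X s] A →
      ∫ ω in A, f (X (s + t) ω) ∂μ = ∫ ω in A, h (X s ω) ∂μ) :
    μ[fun ω => f (X (s + t) ω) | pastσ X s] =ᵐ[μ] fun ω => h (X s ω) := by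
  refine (ae_eq_condExp_of_forall_setIntegral_eq (pastσ_le hX s)
    (integrable_zeroAtInfty_comp (hX _) f)
    (fun A _ _ => (integrable_zeroAtInfty_comp (hX s) h).integrableOn)
    (fun A hA _ => (H A hA).symm) ?_).symm
  exact (h.continuous.measurable.comp
    (measurable_pastσ X le_rfl)).stronglyMeasurable.aestronglyMeasurable

variable {S : Type*} [PseudoMetricSpace S] [SecondCountableTopology S] [MeasurableSpace S]
  [BorelSpace S] {P : ℝ≥0 → C₀(S, ℝ) →L[ℝ] C₀(S, ℝ)}

theorem IsContractionSemigroup.measurable_apply_apply (hP : IsContractionSemigroup P)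
    (e : C₀(S, ℝ)) : Measurable fun p : ℝ≥0 × S => P p.1 e p.2 := by
  have h1 : Continuous fun p : ℝ≥0 × S => (P p.1 e).toBCF :=
    (ZeroAtInftyContinuousMap.isometry_toBCF.continuous.comp (hP.continuous_apply e)).comp
      continuous_fst
  exact (h1.eval continuous_snd).measurable

variable {Ω : Type*} {m : MeasurableSpace Ω} {μ : Measure Ω} [IsProbabilityMeasure μ]
  {β : ℝ → ℝ} {g : ℝ → ℝ → ℝ}

/-- The increment of the subordinator is integrated out given the past of the subordinator. -/
theorem IsAdditiveSubordinator.setIntegral_apply_increment {Z : ℝ≥0 → Ω → ℝ≥0}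
    (hZ : IsAdditiveSubordinator μ Z β g) (hP : IsContractionSemigroup P) {s t : ℝ≥0}
    (f : C₀(ℝ≥0 × S, ℝ)) {A : Set Ω} (hA : MeasurableSet[pastσ Z s] A) {V : Ω → S}
    (hV : Measurable[pastσ Z s] V) :
    ∫ ω in A, P (Z (s + t) ω - Z s ω) (slice f (s + t)) (V ω) ∂μ =
      ∫ ω in A, hZ.spaceTime hP t f (s, V ω) ∂μ := by
  have hle : pastσ Z s ≤ m := pastσ_le hZ.measurable s
  have hind : @IndepFun Ω Ω ℝ≥0 m (pastσ Z s) _ id (fun ω => Z (s + t) ω - Z s ω) μ := by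
    have h1 := hZ.indepFun_past_increment (le_self_add : s ≤ s + t)
    refine indepFun_id_left (indep_of_indep_of_le_left ((IndepFun_iff_Indep _ _ _).1 h1) ?_)
    refine iSup₂_le fun l hl => ?_
    have h2 : Z l = (fun z : {l : ℝ≥0 // l ≤ s} → ℝ≥0 => z ⟨l, hl⟩) ∘
        fun ω (l : {l : ℝ≥0 // l ≤ s}) => Z l ω := rfl
    rw [h2, ← MeasurableSpace.comap_comp]
    exact MeasurableSpace.comap_mono (measurable_pi_apply _).comap_le
  let H : Ω × ℝ≥0 → ℝ := fun p =>
    A.indicator (fun _ => (1 : ℝ)) p.1 * P p.2 (slice f (s + t)) (V p.1)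
  have hH : @Measurable _ _ (@Prod.instMeasurableSpace _ _ (pastσ Z s) _) _ H := by
    refine Measurable.mul ((measurable_const.indicator hA).comp measurable_fst) ?_
    exact (hP.measurable_apply_apply (slice f (s + t))).comp
      (measurable_snd.prodMk (hV.comp measurable_fst))
  have hC : ∀ p, ‖H p‖ ≤ ‖slice f (s + t)‖ := by
    intro p
    rw [norm_mul]
    refine (mul_le_of_le_one_left (norm_nonneg _) ?_).trans
      ((norm_zeroAtInfty_apply_le _ _).trans (hP.contraction _ _))
    exact (norm_indicator_le_norm_self _ _).trans (by simp)
  have key := integral_comp_of_indepFun (m₁ := pastσ Z s) (measurable_id'' hle)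
    (hZ.measurable_increment s (s + t)) hind hH hC
  rw [← integral_indicator (hle _ hA), ← integral_indicator (hle _ hA)]
  refine Eq.trans ?_ (key.trans ?_)
  · refine integral_congr_ae (Eventually.of_forall fun ω => ?_)
    by_cases hω : ω ∈ A <;> simp [H, hω]
  · refine integral_congr_ae (Eventually.of_forall fun ω => ?_)
    by_cases hω : ω ∈ A <;> simp [H, hω, hZ.spaceTime_apply]

/-- The Markov property of the time-changed process, for processes that factor through
independent random elements. -/
theorem setIntegral_timeChanged {Ω₁ Ω₂ : Type*} {m₁ : MeasurableSpace Ω₁}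
    {m₂ : MeasurableSpace Ω₂} {a : Ω → Ω₁} {b : Ω → Ω₂} (ha : Measurable a) (hb : Measurable b)
    (hab : IndepFun a b μ) {X : ℝ≥0 → Ω₁ → S} (hXm : ∀ t, Measurable (X t))
    (hXr : ∀ ω, IsCadlag fun t => X t ω) {Z : ℝ≥0 → Ω₂ → ℝ≥0} (hZm : ∀ t, Measurable (Z t))
    (hX : IsFellerProcess μ (fun t ω => X t (a ω)) P)
    (hZ : IsAdditiveSubordinator μ (fun t ω => Z t (b ω)) β g)
    (d s t : ℝ≥0) (f : C₀(ℝ≥0 × S, ℝ)) {A : Set Ω}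
    (hA : MeasurableSet[pastσ (timeChanged (fun t ω => X t (a ω)) (fun t ω => Z t (b ω)) d) s]
      A) :
    ∫ ω in A, f (timeChanged (fun t ω => X t (a ω)) (fun t ω => Z t (b ω)) d (s + t) ω) ∂μ =
      ∫ ω in A, hZ.spaceTime hX.semigroup.isContractionSemigroup t f
        (timeChanged (fun t ω => X t (a ω)) (fun t ω => Z t (b ω)) d s ω) ∂μ := by
  have hP := hX.semigroup.isContractionSemigroup
  have hXj : Measurable fun p : ℝ≥0 × Ω₁ => X p.1 p.2 :=
    measurable_uncurry_of_rightContinuous hXm fun ω t => (hXr ω t).1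
  -- On the product the arguments of `X` and of `Z` vary separately, and an event in the past of the
  -- process is the preimage of an event `A'` in the past of `Y`.
  let Y : ℝ≥0 → Ω₁ × Ω₂ → ℝ≥0 × S := fun l p => (d + l, X (Z (d + l) p.2) p.1)
  have hXZ : ∀ l, Measurable fun p : Ω₁ × Ω₂ => X (Z l p.2) p.1 := fun l =>
    hXj.comp (((hZm l).comp measurable_snd).prodMk measurable_fst)
  have hY : ∀ l, Measurable (Y l) := fun l => measurable_const.prodMk (hXZ _)
  have hpast := pastσ_comp Y (fun ω => (a ω, b ω)) s
  obtain ⟨A', hA', rfl⟩ := (hpast ▸ hA : MeasurableSet[MeasurableSpace.comap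
    (fun ω => (a ω, b ω)) (pastσ Y s)] A)
  have hA'm : MeasurableSet A' := pastσ_le hY s _ hA'
  have hAm : MeasurableSet ((fun ω => (a ω, b ω)) ⁻¹' A') := (ha.prodMk hb) hA'm
  -- With the path of `Z` frozen, monotonicity of `Z` places the section of `A'` in the past of `X`
  -- up to the deterministic time `Z_{d+s}`.
  have hsec₁ : ∀ ω', MeasurableSet[pastσ (fun t ω => X t (a ω)) (Z (d + s) (b ω'))]
      {ω | (a ω, b ω') ∈ A'} := by
    intro ω'
    refine measurable_into_pastσ (φ := fun ω => (a ω, b ω')) (fun l hl => ?_) hA'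
    have h1 := measurable_pastσ (fun t ω => X t (a ω)) (hZ.mono ω' (add_le_add_right hl d))
    exact measurable_const.prodMk h1
  have hsec₂ : ∀ ω, MeasurableSet[pastσ (fun t ω => Z t (b ω)) (d + s)]
      {ω' | (a ω, b ω') ∈ A'} := by
    intro ω
    refine measurable_into_pastσ (φ := fun ω' => (a ω, b ω')) (fun l hl => ?_) hA'
    refine measurable_const.prodMk ((hXj.comp measurable_prodMk_right).comp
      (measurable_pastσ (fun t ω => Z t (b ω)) (add_le_add_right hl d)))
  have hV : ∀ ω, Measurable[pastσ (fun t ω => Z t (b ω)) (d + s)]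
      fun ω' => X (Z (d + s) (b ω')) (a ω) := fun ω =>
    (hXj.comp measurable_prodMk_right).comp (measurable_pastσ (fun t ω => Z t (b ω)) le_rfl)
  have hle₁ : ∀ q, pastσ (fun t ω => X t (a ω)) q ≤ m := pastσ_le fun t => (hXm t).comp ha
  have hle₂ : ∀ q, pastσ (fun t ω => Z t (b ω)) q ≤ m := pastσ_le fun t => (hZm t).comp hb
  let H₀ : Ω₁ × Ω₂ → ℝ := A'.indicator fun p => f (Y (s + t) p)
  let H₁ : Ω₁ × Ω₂ → ℝ := A'.indicator fun p =>
    P (Z (d + s + t) p.2 - Z (d + s) p.2) (slice f (d + s + t)) (X (Z (d + s) p.2) p.1)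
  let H₂ : Ω₁ × Ω₂ → ℝ := A'.indicator fun p => hZ.spaceTime hP t f (Y s p)
  have mH₀ : Measurable H₀ := (f.continuous.measurable.comp (hY _)).indicator hA'm
  have mH₁ : Measurable H₁ := ((hP.measurable_apply_apply _).comp
    ((((hZm _).sub (hZm _)).comp measurable_snd).prodMk (hXZ _))).indicator hA'm
  have mH₂ : Measurable H₂ := ((hZ.spaceTime hP t f).continuous.measurable.comp
    (hY _)).indicator hA'm
  have bH₀ : ∀ p, ‖H₀ p‖ ≤ ‖f‖ := fun p =>
    (norm_indicator_le_norm_self _ _).trans (norm_zeroAtInfty_apply_le _ _)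
  have bH₁ : ∀ p, ‖H₁ p‖ ≤ ‖slice f (d + s + t)‖ := fun p =>
    (norm_indicator_le_norm_self _ _).trans
      ((norm_zeroAtInfty_apply_le _ _).trans (hP.contraction _ _))
  have bH₂ : ∀ p, ‖H₂ p‖ ≤ ‖hZ.spaceTime hP t f‖ := fun p =>
    (norm_indicator_le_norm_self _ _).trans (norm_zeroAtInfty_apply_le _ _)
  -- The path of `Z` is fixed: this is the Markov property of `X` between `Z_{d+s}` and `Z_{d+s+t}`.
  have h01 : ∀ ω', ∫ ω, H₀ (a ω, b ω') ∂μ = ∫ ω, H₁ (a ω, b ω') ∂μ := by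
    intro ω'
    have hq : Z (d + (s + t)) (b ω') =
        Z (d + s) (b ω') + (Z (d + s + t) (b ω') - Z (d + s) (b ω')) := by
      rw [← add_assoc, add_tsub_cancel_of_le (hZ.mono ω' le_self_add)]
    have h1 := hX.setIntegral_eq (Z (d + s) (b ω')) (Z (d + s + t) (b ω') - Z (d + s) (b ω'))
      (slice f (d + s + t)) (hsec₁ ω')
    rw [← hq, ← add_assoc, ← integral_indicator (hle₁ _ _ (hsec₁ ω')),
      ← integral_indicator (hle₁ _ _ (hsec₁ ω'))] at h1
    simp only [H₀, H₁, Y, ← add_assoc]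
    exact h1
  -- The path of `X` is fixed: the increment of `Z` over `[d+s, d+s+t]` is integrated out given the
  -- past of `Z`.
  have h12 : ∀ ω, ∫ ω', H₁ (a ω, b ω') ∂μ = ∫ ω', H₂ (a ω, b ω') ∂μ := by
    intro ω
    have h1 := hZ.setIntegral_apply_increment hP (t := t) f (hsec₂ ω) (hV ω)
    rw [← integral_indicator (hle₂ _ _ (hsec₂ ω)),
      ← integral_indicator (hle₂ _ _ (hsec₂ ω))] at h1
    exact h1
  rw [← integral_indicator hAm, ← integral_indicator hAm]
  calc _ = ∫ ω, H₀ (a ω, b ω) ∂μ := rfl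
    _ = ∫ ω, H₁ (a ω, b ω) ∂μ := by
        rw [integral_comp_of_indepFun_symm ha hb hab mH₀ bH₀,
          integral_comp_of_indepFun_symm ha hb hab mH₁ bH₁]
        simp only [h01]
    _ = ∫ ω, H₂ (a ω, b ω) ∂μ := by
        rw [integral_comp_of_indepFun ha hb hab mH₁ bH₁,
          integral_comp_of_indepFun ha hb hab mH₂ bH₂]
        simp only [h12]
    _ = _ := rfl

/-- A Feller process time-changed by an independent additive subordinator is, jointly with time,
a Feller process. -/
theorem isFellerProcess_timeChanged {X : ℝ≥0 → Ω → S} {Z : ℝ≥0 → Ω → ℝ≥0}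
    (hX : IsFellerProcess μ X P) (hZ : IsAdditiveSubordinator μ Z β g)
    (hXZ : IndepFun (fun ω t => X t ω) (fun ω t => Z t ω) μ) (d : ℝ≥0) :
    IsFellerProcess μ (timeChanged X Z d)
      (hZ.spaceTime hX.semigroup.isContractionSemigroup) := by
  have hXj : Measurable fun p : ℝ≥0 × Ω => X p.1 p.2 :=
    measurable_uncurry_of_rightContinuous hX.measurable fun ω t => (hX.cadlag ω t).1
  have hm : ∀ t, Measurable (timeChanged X Z d t) := fun t =>
    measurable_const.prodMk (hXj.comp ((hZ.measurable _).prodMk measurable_id))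
  refine ⟨hZ.isFellerSemigroup_spaceTime hX.semigroup, hm,
    fun ω => isCadlag_timeChanged (hX.cadlag ω) (hZ.cadlag ω) (hZ.mono ω) d, fun s t f => ?_⟩
  refine condExp_ae_eq_of_setIntegral_eq hm fun A hA => ?_
  -- Both factors are copies of `Ω`, with the σ-algebras generated by `X` and by `Z`, and `a`, `b`
  -- are the identity; this separates the variables although `Ω` is not a product.
  exact setIntegral_timeChanged (measurable_id'' (measurable_pi_lambda _ hX.measurable).comap_le)
    (measurable_id'' (measurable_pi_lambda _ hZ.measurable).comap_le)
    (indepFun_id_left (by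
      rw [MeasurableSpace.comap_id]
      exact (IndepFun_iff_Indep _ _ _).1 hXZ))
    (fun t => (measurable_pi_apply t).comp (comap_measurable fun ω t => X t ω)) hX.cadlag
    (fun t => (measurable_pi_apply t).comp (comap_measurable fun ω t => Z t ω)) hX hZ d s t f hA

end Markov

/-- The law of an increment depends on the characteristics alone, so one semigroup serves all
starting points. -/
theorem IsAdditiveSubordinator.spaceTime_eq {S : Type*} [PseudoMetricSpace S]
    {P : ℝ≥0 → C₀(S, ℝ) →L[ℝ] C₀(S, ℝ)} {Ω Ω' : Type*} [MeasurableSpace Ω] [MeasurableSpace Ω']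
    {μ : Measure Ω} [IsProbabilityMeasure μ] {μ' : Measure Ω'} [IsProbabilityMeasure μ']
    {Z : ℝ≥0 → Ω → ℝ≥0} {Z' : ℝ≥0 → Ω' → ℝ≥0} {β : ℝ → ℝ} {g : ℝ → ℝ → ℝ}
    (hZ : IsAdditiveSubordinator μ Z β g) (hP : IsContractionSemigroup P)
    (hZ' : IsAdditiveSubordinator μ' Z' β g) : hZ.spaceTime hP = hZ'.spaceTime hP := by
  ext1 t
  ext1 f
  refine ext_slice fun s => ?_
  rw [slice_spaceTime, slice_spaceTime, hZ.evolution_apply_eq hP hZ' le_self_add]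

end AdditiveTimeChange

end

theorem mainTheorem1 (n : ℕ) {Ω : Type*} [MeasurableSpace Ω]
    (Pr : EuclideanSpace ℝ (Fin n) → Measure Ω) [∀ x, IsProbabilityMeasure (Pr x)]
    (X : ℝ≥0 → Ω → EuclideanSpace ℝ (Fin n))
    (P : ℝ≥0 → C₀(EuclideanSpace ℝ (Fin n), ℝ) →L[ℝ] C₀(EuclideanSpace ℝ (Fin n), ℝ))
    (hX : IsFellerFamily Pr X P)
    (β : ℝ → ℝ) (g : ℝ → ℝ → ℝ) (hβg : IsCharacteristics β g)
    (Z : ℝ≥0 → Ω → ℝ≥0) (hZ : ∀ x, IsAdditiveSubordinator (Pr x) Z β g)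
    (hXZ : ∀ x, IndepFun (fun ω t => X t ω) (fun ω t => Z t ω) (Pr x)) :
    ∃ Q : ℝ≥0 → C₀(ℝ≥0 × EuclideanSpace ℝ (Fin n), ℝ) →L[ℝ]
        C₀(ℝ≥0 × EuclideanSpace ℝ (Fin n), ℝ),
      -- `(D, Y)` is a Feller process with transition semigroup `Q`, for all starting points
      (∀ x d, IsFellerProcess (Pr x) (timeChanged X Z d) Q) ∧
      -- `Q_t f(s,x) = ∫ P_r f_{s+t}(x) λ_{s,s+t}(dr)`, `λ_{s,s+t}` the law of `Z_{s+t} - Z_s`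
      (∀ t f s x, Q t f (s, x) = ∫ ω, P (Z (s + t) ω - Z s ω) (slice f (s + t)) x ∂(Pr x)) ∧
      -- the generator of `Q` is densely defined
      Dense (generatorDomain Q) ∧
      -- the generator is given by the formula on regular `f` for which the formula is in `C₀`
      (∀ f df Lf, IsRegularFunction P f df Lf →
        (∀ s x, IntegrableOn (jumpIntegrand P g f s x) (Ioi 0)) ∧
        ∀ G : C₀(ℝ≥0 × EuclideanSpace ℝ (Fin n), ℝ),
          (∀ s x, G (s, x) = phillipsFormula P β g f df Lf s x) → HasGenerator Q f G) ∧
      -- jump mass continuous in time: the formula holds pointwise for all regular `f`,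
      -- and the `f` of the preceding item are dense
      (ContinuousOn (jumpMass g) (Ici 0) →
        (∀ f df Lf, IsRegularFunction P f df Lf → ∀ s x,
          Tendsto (fun t : ℝ≥0 => (t : ℝ)⁻¹ * (Q t f (s, x) - f (s, x))) (𝓝[>] 0)
            (𝓝 (phillipsFormula P β g f df Lf s x))) ∧
        Dense {f | ∃ df Lf G : C₀(ℝ≥0 × EuclideanSpace ℝ (Fin n), ℝ), IsRegularFunction P f df Lf ∧
          ∀ s x, G (s, x) = phillipsFormula P β g f df Lf s x}) ∧
      -- if moreover the characteristics are bounded, every regular `f` is in the domain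
      (ContinuousOn (jumpMass g) (Ici 0) → (∃ C, ∀ s, 0 ≤ s → β s ≤ C ∧ jumpMass g s ≤ C) →
        ∀ f df Lf, IsRegularFunction P f df Lf →
          ∃ G : C₀(ℝ≥0 × EuclideanSpace ℝ (Fin n), ℝ),
            (∀ s x, G (s, x) = phillipsFormula P β g f df Lf s x) ∧ HasGenerator Q f G) := by
  -- The law `Pr 0` is an arbitrary reference with which `Q` is defined; `hQ` transfers it to every
  -- `Pr x`.
  have hP := (hX.feller 0).semigroup.isContractionSemigroup
  have hQ : ∀ x, (hZ x).spaceTime hP = (hZ 0).spaceTime hP := fun x =>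
    (hZ x).spaceTime_eq hP (hZ 0)
  have hF : ∀ x d, IsFellerProcess (Pr x) (timeChanged X Z d) ((hZ 0).spaceTime hP) :=
    fun x d => hQ x ▸ isFellerProcess_timeChanged (hX.feller x) (hZ x) (hXZ x) d
  refine ⟨(hZ 0).spaceTime hP, hF, fun t f s x => ?_,
    (hF 0 0).semigroup.isContractionSemigroup.dense_generator_domain,
    fun f df Lf hf => ⟨hf.integrableOn_jumpIntegrand hβg hP,
      fun G hG => (hZ 0).hasGenerator_spaceTime hβg hP hf hG⟩,
    fun hm => ⟨fun f df Lf hf => (hZ 0).tendsto_spaceTime_apply hβg hm hP hf,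
      hβg.dense_regular hm hP⟩, fun hm ⟨C, hC⟩ f df Lf hf => ?_⟩
  · rw [← hQ x, (hZ x).spaceTime_apply]
  · obtain ⟨G, hG⟩ := hf.exists_formula_of_bounded hβg hm hP hC
    exact ⟨G, hG, (hZ 0).hasGenerator_spaceTime hβg hP hf hG⟩
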